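/- Let $n\ge 3$ and let $M\subset\mathbb R^n$ be a ball $\{|x|<\nu\}$ with $0<\nu<\infty$, an annulus $\{\nu_2<|x|<\nu_1\}$ with $0\le\nu_2<\nu_1<\infty$, or $\mathbb R^n$. Put $I=\{|x| : x\in M\setminus\{0\}\}$. A Finsler metric $F$ on $M$ is spherically symmetric if $F(Ax,Ay)=F(x,y)$ for all $A\in O(n)$; it is a Douglas metric if its Douglas curvature vanishes, and it has scalar flag curvature if its flag curvature depends only on $(x,y)$ and not on the flag. For a function $g$ on $I$ such that $1-2r^2g(r)$ has at most one zero in $I$, let $$T(r)=\frac{e^{-\int\frac{4rg(r)}{1-2r^2g(r)}dr}}{(1-2r^2g(r))^2},\qquad \overline T(r)=4\int\frac{g'(r)+2rg(r)^2}{1-2r^2g(r)}\,T(r)\,dr ,$$ where the constants of integration are such that $T>0$ and $\overline T$ are continuous on $I$ (if $1-2r^2g$ vanishes at a point, the formulas hold off that point and $T,\overline T$ extend continuously with $T>0$ there), and let $$\varphi(r,s)=\frac{r^2-s^2}{(r^2-s^2)\overline T(r)-T(r)},\qquad r\in I,\ |s|<r .$$ Consider functions $\phi$ which, for $r\in I$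 and $0<|s|<r$, have the form $$\phi(r,s)=s\left(h(r)-\int\frac{\eta(\varphi(r,s))}{s^2\sqrt{r^2-s^2}}\,ds\right),\qquad(1)$$ where the denominator of $\varphi$ does not vanish on $|s|<r$, $h$ and $\eta$ are differentiable, and $\eta$ stands for two functions of one variable, $\eta_+$ used on the component $s>0$ and $\eta_-$ used on the component $s<0$. Consider the positivity conditions $$-\frac{\sqrt{r^2-s^2}}{s}\,\frac{\partial}{\partial s}\big[\eta(\varphi(r,s))\big]>0,\qquad \frac{\eta(\varphi(r,s))}{\sqrt{r^2-s^2}}>0,\qquad(2)$$ strictly also up to the ends $s\to0$, $s\to\pm r$, i.e. for every $r\in I$ both left-hand sides are bounded below by a positive constant on $0<|s|<r$. (a) Let $F$ be a spherically symmetric Douglas metric of scalar flag curvature on $M$. Then $F(x,y)=|y|\,\phi\big(|x|,\tfrac{\langle x,y\rangle}{|y|}\big)$ for $y\neq0$, where $\phi(r,s)$ is positive for $|s|\le r$, smooth for $r\in I$, $|s|<r$, and of the form (1) with smooth $g,T,\overline T,h,\eta_\pm$ that satisfy (2). Moreover $\eta_+$ and $\eta_-$ agree at $\varphi(r,0)$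 for every $r\in I$, and $\eta_+=\eta_-$ if $0\in M$. Furthermore $R_2=0$ for $r\in I$, $|s|<r$, where $$R_2=2Q(2Q-sQ_s)+\tfrac1r(2Q_r-sQ_{rs}-rQ_{ss})+(r^2-s^2)(2QQ_{ss}-Q_s^2),\qquad Q=\frac1{2r}\,\frac{r\phi_{ss}-\phi_r+s\phi_{rs}}{\phi-s\phi_s+(r^2-s^2)\phi_{ss}} .$$ (b) Conversely, let $\phi$ be of the form (1), with $g$, $h$, $\eta_\pm$ differentiable, such that $\phi(|x|,s)>0$ for $x\in M$, $|s|\le|x|$, and $F(x,y)=|y|\,\phi\big(|x|,\tfrac{\langle x,y\rangle}{|y|}\big)$ is $C^\infty$ for $x\in M$, $y\ne0$. Then $F$ is a Finsler metric on $M$ if and only if (2) holds, and in that case $F$ is a spherically symmetric Douglas metric of scalar flag curvature. -/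

import Mathlib

open scoped ContDiff

namespace SphFinsler

noncomputable section

/-- Euclidean space of dimension `n`. -/
abbrev E (n : ℕ) := EuclideanSpace ℝ (Fin n)

/-- Partial derivative in the base coordinate `x^i` of a function of `(x, y)`. -/
def pdX {n : ℕ} (i : Fin n) (f : E n → E n → ℝ) (x y : E n) : ℝ :=
  fderiv ℝ (fun z => f z y) x (EuclideanSpace.single i 1)

/-- Partial derivative in the fibre coordinate `y^i` of a function of `(x, y)`. -/
def pdY {n : ℕ} (i : Fin n) (f : E n → E n → ℝ) (x y : E n) : ℝ :=
  fderiv ℝ (fun z => f x z) y (EuclideanSpace.single i 1)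

/-- The function `F ^ 2`. -/
def sqF {n : ℕ} (F : E n → E n → ℝ) (x y : E n) : ℝ := F x y ^ 2

/-- The fundamental tensor `g_{ij} = (1/2) ∂²(F²)/∂y^i∂y^j`. -/
def fundTensor {n : ℕ} (F : E n → E n → ℝ) (x y : E n) : Matrix (Fin n) (Fin n) ℝ :=
  Matrix.of fun i j => (1 / 2) * pdY i (pdY j (sqF F)) x y

/-- The inner product `g_y(u, v)` on the tangent space at `x`. -/
def innerAt {n : ℕ} (F : E n → E n → ℝ) (x y u v : E n) : ℝ :=
  ∑ i, ∑ j, fundTensor F x y i j * u i * v j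

/-- `F` is a Finsler metric on the open set `M ⊆ ℝⁿ`: nonnegative, smooth on the slit tangent
bundle, and on every tangent space a Minkowski norm (positively homogeneous, with positive definite
fundamental tensor). -/
structure IsFinsler {n : ℕ} (M : Set (E n)) (F : E n → E n → ℝ) : Prop where
  nonneg : ∀ x ∈ M, ∀ y, 0 ≤ F x y
  smooth : ContDiffOn ℝ ∞ (fun p : E n × E n => F p.1 p.2) (M ×ˢ {0}ᶜ)
  homog : ∀ x ∈ M, ∀ y, ∀ c : ℝ, 0 < c → F x (c • y) = c * F x y
  posDef : ∀ x ∈ M, ∀ y, y ≠ 0 → (fundTensor F x y).PosDef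

/-- Invariance of `F` under the orthogonal group. -/
def IsSphericallySymmetric {n : ℕ} (M : Set (E n)) (F : E n → E n → ℝ) : Prop :=
  ∀ A : E n ≃ₗᵢ[ℝ] E n, ∀ x ∈ M, ∀ y, F (A x) (A y) = F x y

/-- The geodesic coefficients
`G^i = (1/4) g^{il} ([F²]_{x^k y^l} y^k - [F²]_{x^l})`. -/
def geodCoeff {n : ℕ} (F : E n → E n → ℝ) (i : Fin n) (x y : E n) : ℝ :=
  (1 / 4) * ∑ l, (fundTensor F x y)⁻¹ i l *
    ((∑ k, pdX k (pdY l (sqF F)) x y * y k) - pdX l (sqF F) x y)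

/-- The Douglas curvature `D_j^i_{kl}`. -/
def douglasCurv {n : ℕ} (F : E n → E n → ℝ) (j i k l : Fin n) (x y : E n) : ℝ :=
  pdY j (pdY k (pdY l (fun x y =>
    geodCoeff F i x y - 1 / ((n : ℝ) + 1) * (∑ m, pdY m (geodCoeff F m) x y) * y i))) x y

/-- `F` is a Douglas metric on `M`. -/
def IsDouglas {n : ℕ} (M : Set (E n)) (F : E n → E n → ℝ) : Prop :=
  ∀ x ∈ M, ∀ y, y ≠ 0 → ∀ j i k l, douglasCurv F j i k l x y = 0

/-- The Riemann curvature
`R^i_k = 2 ∂G^i/∂x^k - y^j ∂²G^i/∂x^j∂y^k + 2 G^j ∂²G^i/∂y^j∂y^k - ∂G^i/∂y^j ∂G^j/∂y^k`. -/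
def riemCurv {n : ℕ} (F : E n → E n → ℝ) (i k : Fin n) (x y : E n) : ℝ :=
  2 * pdX k (geodCoeff F i) x y
    - ∑ j, y j * pdX j (pdY k (geodCoeff F i)) x y
    + 2 * ∑ j, geodCoeff F j x y * pdY j (pdY k (geodCoeff F i)) x y
    - ∑ j, pdY j (geodCoeff F i) x y * pdY k (geodCoeff F j) x y

/-- The vector `R_y(u)`. -/
def riemApply {n : ℕ} (F : E n → E n → ℝ) (x y u : E n) : E n :=
  WithLp.toLp 2 fun i => ∑ k, riemCurv F i k x y * u k

/-- The flag curvature of the flag with pole `y` and transverse edge `u`. -/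
def flagCurv {n : ℕ} (F : E n → E n → ℝ) (x y u : E n) : ℝ :=
  innerAt F x y (riemApply F x y u) u /
    (innerAt F x y y y * innerAt F x y u u - innerAt F x y y u ^ 2)

/-- Scalar flag curvature: the flag curvature depends only on `x` and `y`. -/
def HasScalarFlagCurv {n : ℕ} (M : Set (E n)) (F : E n → E n → ℝ) : Prop :=
  ∃ K : E n → E n → ℝ, ∀ x ∈ M, ∀ y u, LinearIndependent ℝ ![y, u] → flagCurv F x y u = K x y

/-- The symmetric domains: balls, (open) annuli and punctured balls, and the whole space. -/
def IsSymmDomain {n : ℕ} (M : Set (E n)) : Prop :=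
  (∃ ν : ℝ, 0 < ν ∧ M = Metric.ball 0 ν) ∨
  (∃ ν₁ ν₂ : ℝ, 0 ≤ ν₂ ∧ ν₂ < ν₁ ∧ M = Metric.ball 0 ν₁ \ Metric.closedBall 0 ν₂) ∨
  M = Set.univ

/-- The positive radii of the points of `M`. -/
def radii {n : ℕ} (M : Set (E n)) : Set ℝ := {r | 0 < r ∧ ∃ x ∈ M, ‖x‖ = r}

/-- The function `F(x, y) = |y| φ(|x|, ⟨x, y⟩ / |y|)`. -/
def sphericalF {n : ℕ} (φ : ℝ → ℝ → ℝ) (x y : E n) : ℝ :=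
  ‖y‖ * φ ‖x‖ (inner ℝ x y / ‖y‖)

/-- Partial derivative in the first variable. -/
def dr (f : ℝ → ℝ → ℝ) (r s : ℝ) : ℝ := deriv (fun r' => f r' s) r

/-- Partial derivative in the second variable. -/
def ds (f : ℝ → ℝ → ℝ) (r s : ℝ) : ℝ := deriv (fun s' => f r s') s

/-- The function `Q` built from `φ`. -/
def Qfun (φ : ℝ → ℝ → ℝ) (r s : ℝ) : ℝ :=
  1 / (2 * r) * ((r * ds (ds φ) r s - dr φ r s + s * dr (ds φ) r s) /
    (φ r s - s * ds φ r s + (r ^ 2 - s ^ 2) * ds (ds φ) r s))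

/-- The expression `R₂` built from a function `Q`. -/
def R2 (Q : ℝ → ℝ → ℝ) (r s : ℝ) : ℝ :=
  2 * Q r s * (2 * Q r s - s * ds Q r s)
    + 1 / r * (2 * dr Q r s - s * dr (ds Q) r s - r * ds (ds Q) r s)
    + (r ^ 2 - s ^ 2) * (2 * Q r s * ds (ds Q) r s - ds Q r s ^ 2)

/-- `u(r) = 1 - 2 r² g(r)`. -/
def uFun (g : ℝ → ℝ) (r : ℝ) : ℝ := 1 - 2 * r ^ 2 * g r

/-- `T = e^{-∫ 4rg/(1-2r²g) dr} / (1-2r²g)²` and `Tb = 4 ∫ (g'+2rg²)/(1-2r²g) T dr` on `I`, for some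
choice of the integration constants. The function `1 - 2r²g` may vanish at one point of `I`, across
which `T > 0` and `Tb` are continuous. -/
structure IsTPair (I : Set ℝ) (g T Tb : ℝ → ℝ) : Prop where
  diff_g : DifferentiableOn ℝ g I
  zero : {r ∈ I | uFun g r = 0}.Subsingleton
  cont_T : ContinuousOn T I
  cont_Tb : ContinuousOn Tb I
  pos_T : ∀ r ∈ I, 0 < T r
  eq_T : ∃ e : ℝ → ℝ, ∀ r ∈ I, uFun g r ≠ 0 →
    HasDerivAt e (4 * r * g r / uFun g r) r ∧ T r = Real.exp (-e r) / uFun g r ^ 2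
  eq_Tb : ∀ r ∈ I, uFun g r ≠ 0 →
    HasDerivAt Tb (4 * ((deriv g r + 2 * r * g r ^ 2) / uFun g r * T r)) r

/-- `φ(r,s) = (r²-s²) / ((r²-s²) Tb(r) - T(r))`. -/
def varphi (T Tb : ℝ → ℝ) (r s : ℝ) : ℝ :=
  (r ^ 2 - s ^ 2) / ((r ^ 2 - s ^ 2) * Tb r - T r)

/-- The values of `varphi` on the region `0 < |s| < r`, `r ∈ I`. -/
def varphiRange (I : Set ℝ) (T Tb : ℝ → ℝ) : Set ℝ :=
  {z | ∃ r ∈ I, ∃ s, 0 < |s| ∧ |s| < r ∧ z = varphi T Tb r s}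

/-- The composition `η(varphi(r,s))`, with `η = ηp` on `s > 0` and `η = ηm` on `s < 0`. -/
def etaComp (ηp ηm T Tb : ℝ → ℝ) (r s : ℝ) : ℝ :=
  if 0 < s then ηp (varphi T Tb r s) else ηm (varphi T Tb r s)

/-- `φ(r,s) = s (h(r) - ∫ η(varphi(r,s)) / (s² √(r²-s²)) ds)` for `0 < |s| < r`, `r ∈ I`, where `J` is
the indefinite integral and `T`, `Tb` are built from `g`. -/
structure HasForm (I : Set ℝ) (φ : ℝ → ℝ → ℝ) (g T Tb h ηp ηm : ℝ → ℝ) (J : ℝ → ℝ → ℝ) :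
    Prop where
  pair : IsTPair I g T Tb
  den : ∀ r ∈ I, ∀ s, |s| < r → (r ^ 2 - s ^ 2) * Tb r - T r ≠ 0
  diff_h : DifferentiableOn ℝ h I
  diff_ηp : DifferentiableOn ℝ ηp (varphiRange I T Tb)
  diff_ηm : DifferentiableOn ℝ ηm (varphiRange I T Tb)
  primitive : ∀ r ∈ I, ∀ s, 0 < |s| → |s| < r →
    HasDerivAt (J r) (etaComp ηp ηm T Tb r s / (s ^ 2 * √(r ^ 2 - s ^ 2))) s
  formula : ∀ r ∈ I, ∀ s, 0 < |s| → |s| < r → φ r s = s * (h r - J r s)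

/-- The positivity conditions `-(√(r²-s²)/s) ∂η/∂s > 0` and `η/√(r²-s²) > 0`, strictly up to the ends
`s → 0` and `s → ±r`: for each `r` both sides have a positive lower bound on `0 < |s| < r`. -/
def EtaPositive (I : Set ℝ) (ηp ηm T Tb : ℝ → ℝ) : Prop :=
  ∀ r ∈ I, ∃ c : ℝ, 0 < c ∧ ∀ s, 0 < |s| → |s| < r →
    c ≤ -√(r ^ 2 - s ^ 2) / s * ds (etaComp ηp ηm T Tb) r s ∧
    c ≤ etaComp ηp ηm T Tb r s / √(r ^ 2 - s ^ 2)

end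

end SphFinsler

open SphFinsler

set_option linter.unusedSectionVars false

/-! Write r = |x|, s = ⟨x, y⟩ / |y|, w = r² - s², ψ = φ - s φ_s and H = ψ + w φ_ss. Since O(n) acts
transitively on pairs (x, y) with given |x|, |y| and s, spherical symmetry means F = |y| φ(r, s).
The y-Hessian of F, multiplied by |y|, acts as H on the direction of span(x, y) orthogonal to y and
as ψ on the directions orthogonal to both x and y. Strong convexity is therefore positivity of H and
ψ, uniformly in s for each r by compactness of the unit sphere (`IsFinsler.exists_lower_bound`,
`sphericalF_isFinsler`).

The Euler-Lagrange equation puts the geodesic vector in the form G = P y + |y|² Q x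
(`IsFinsler.exists_geodVec_eq`). The Douglas tensor does not see P, so it vanishes exactly when |y|²
Q is quadratic in y, that is Q = a(r) + b(r) s² (`IsDouglas.exists_Qfun_eq`,
`IsQuadratic.isDouglas`). For such Q the curvature R_y(u) is a combination of u, y and a multiple of
x whose coefficient contains a function of r alone (`IsQuadratic.riemApply_eq`). As n ≥ 3, some
flags see this term and others do not, so scalar flag curvature is the equation a' + 2 r a² = r b u
with u = 1 - 2 r² a.

It remains to solve Q = a + b s² for φ. This is a linear first order equation for ψ. Along its
characteristics w satisfies a Bernoulli equation, solved by Tb - T / w = Z with Z constant, and √w ψ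
is constant (`hasDerivAt_along_char`). Since 1/Z is `varphi`, this says √w ψ = η(varphi), separately
for s > 0 and s < 0; and ψ = -s² ∂_s(φ/s) recovers the integral formula (1). Read backwards, the
same computation gives the converse (`HasForm.Qfun_eq`). Finally -(√w/s) ∂_s η = H and η/√w = ψ, so
the conditions (2) are exactly strong convexity.

A global point remains: η is a function only if, for each Z, the radii under the characteristic form
an interval. With the right constant in Tb one has Tb - T/r² = -1 - Y², where Y = √T u / r is
strictly decreasing, so the radii with Z < -1 - Y² do form an interval. The same monotonicity shows
that u has at most one zero. A characteristic that reaches s = 0 forces the two branches of η to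
agree there; if 0 ∈ M, then Y² is unbounded near the origin and every characteristic reaches s = 0.
-/

namespace SphFinsler

/-! ### Calculus of smooth functions of two vector variables -/

section TwoVariables

variable {A B : Type*} [NormedAddCommGroup A] [NormedSpace ℝ A] [NormedAddCommGroup B]
  [NormedSpace ℝ B]

/-- Smoothness on `U` of a function of two variables. -/
def Smooth2 (U : Set (A × B)) (f : A → B → ℝ) : Prop :=
  ContDiffOn ℝ ∞ (fun p : A × B => f p.1 p.2) U

/-- Directional derivative in the first variable. -/
noncomputable def derivX (v : A) (f : A → B → ℝ) (x : A) (y : B) : ℝ :=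
  fderiv ℝ (fun z => f z y) x v

/-- Directional derivative in the second variable. -/
noncomputable def derivY (v : B) (f : A → B → ℝ) (x : A) (y : B) : ℝ :=
  fderiv ℝ (fun z => f x z) y v

variable {U : Set (A × B)} {f g : A → B → ℝ} {x : A} {y : B}

theorem Smooth2.differentiableAt (hf : Smooth2 U f) (hU : IsOpen U) (h : (x, y) ∈ U) :
    DifferentiableAt ℝ (fun p : A × B => f p.1 p.2) (x, y) :=
  (hf.contDiffAt (hU.mem_nhds h)).differentiableAt (by simp)

theorem Smooth2.contDiffAt (hf : Smooth2 U f) (hU : IsOpen U) (h : (x, y) ∈ U) :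
    ContDiffAt ℝ ∞ (fun p : A × B => f p.1 p.2) (x, y) :=
  ContDiffOn.contDiffAt hf (hU.mem_nhds h)

theorem Smooth2.continuousAt (hf : Smooth2 U f) (hU : IsOpen U) (h : (x, y) ∈ U) :
    ContinuousAt (fun p : A × B => f p.1 p.2) (x, y) :=
  (hf.differentiableAt hU h).continuousAt

theorem Smooth2.mono {V : Set (A × B)} (hf : Smooth2 U f) (h : V ⊆ U) : Smooth2 V f :=
  ContDiffOn.mono hf h

theorem Smooth2.congr (hf : Smooth2 U f) (h : ∀ x y, (x, y) ∈ U → g x y = f x y) : Smooth2 U g :=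
  ContDiffOn.congr hf fun p hp => h p.1 p.2 hp

theorem hasFDerivAt_fst_slice (h : DifferentiableAt ℝ (fun p : A × B => f p.1 p.2) (x, y)) :
    HasFDerivAt (fun z => f z y)
      ((fderiv ℝ (fun p : A × B => f p.1 p.2) (x, y)).comp (ContinuousLinearMap.inl ℝ A B)) x := by
  have h1 : HasFDerivAt (fun z : A => (z, y)) (ContinuousLinearMap.inl ℝ A B) x := by
    simpa using (hasFDerivAt_prodMk_left x y)
  exact h.hasFDerivAt.comp x h1

theorem hasFDerivAt_snd_slice (h : DifferentiableAt ℝ (fun p : A × B => f p.1 p.2) (x, y)) :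
    HasFDerivAt (fun z => f x z)
      ((fderiv ℝ (fun p : A × B => f p.1 p.2) (x, y)).comp (ContinuousLinearMap.inr ℝ A B)) y := by
  have h1 : HasFDerivAt (fun z : B => (x, z)) (ContinuousLinearMap.inr ℝ A B) y := by
    simpa using (hasFDerivAt_prodMk_right x y)
  exact h.hasFDerivAt.comp y h1

theorem Smooth2.differentiableAt_fst (hf : Smooth2 U f) (hU : IsOpen U) (h : (x, y) ∈ U) :
    DifferentiableAt ℝ (fun z => f z y) x :=
  (hasFDerivAt_fst_slice (hf.differentiableAt hU h)).differentiableAt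

theorem Smooth2.differentiableAt_snd (hf : Smooth2 U f) (hU : IsOpen U) (h : (x, y) ∈ U) :
    DifferentiableAt ℝ (fun z => f x z) y :=
  (hasFDerivAt_snd_slice (hf.differentiableAt hU h)).differentiableAt

theorem Smooth2.derivX_eq (hf : Smooth2 U f) (hU : IsOpen U) (h : (x, y) ∈ U) (v : A) :
    derivX v f x y = fderiv ℝ (fun p : A × B => f p.1 p.2) (x, y) (v, 0) := by
  rw [derivX, (hasFDerivAt_fst_slice (hf.differentiableAt hU h)).fderiv]; simp

theorem Smooth2.derivY_eq (hf : Smooth2 U f) (hU : IsOpen U) (h : (x, y) ∈ U) (v : B) :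
    derivY v f x y = fderiv ℝ (fun p : A × B => f p.1 p.2) (x, y) (0, v) := by
  rw [derivY, (hasFDerivAt_snd_slice (hf.differentiableAt hU h)).fderiv]; simp

theorem Smooth2.fderiv_apply (hf : Smooth2 U f) (hU : IsOpen U) (v : A × B) :
    ContDiffOn ℝ ∞ (fun p => fderiv ℝ (fun p : A × B => f p.1 p.2) p v) U :=
  (hf.fderiv_of_isOpen hU (m := ∞) (by simp)).clm_apply contDiffOn_const

theorem Smooth2.derivX (hf : Smooth2 U f) (hU : IsOpen U) (v : A) : Smooth2 U (derivX v f) :=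
  (hf.fderiv_apply hU (v, 0)).congr fun _ hp => hf.derivX_eq hU hp v

theorem Smooth2.derivY (hf : Smooth2 U f) (hU : IsOpen U) (v : B) : Smooth2 U (derivY v f) :=
  (hf.fderiv_apply hU (0, v)).congr fun _ hp => hf.derivY_eq hU hp v

theorem derivX_congr (hU : IsOpen U) (h : ∀ x y, (x, y) ∈ U → f x y = g x y) (hp : (x, y) ∈ U)
    (v : A) : derivX v f x y = derivX v g x y := by
  have : (fun z => f z y) =ᶠ[nhds x] fun z => g z y := by
    have hc : ContinuousAt (fun z : A => (z, y)) x := by fun_prop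
    filter_upwards [hc (hU.mem_nhds hp)] with z hz using h _ _ hz
  rw [SphFinsler.derivX, SphFinsler.derivX, this.fderiv_eq]

theorem derivY_congr (hU : IsOpen U) (h : ∀ x y, (x, y) ∈ U → f x y = g x y) (hp : (x, y) ∈ U)
    (v : B) : derivY v f x y = derivY v g x y := by
  have : (fun z => f x z) =ᶠ[nhds y] fun z => g x z := by
    have hc : ContinuousAt (fun z : B => (x, z)) y := by fun_prop
    filter_upwards [hc (hU.mem_nhds hp)] with z hz using h _ _ hz
  rw [SphFinsler.derivY, SphFinsler.derivY, this.fderiv_eq]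

theorem Smooth2.fderiv_fderiv (hf : Smooth2 U f) (hU : IsOpen U) (h : (x, y) ∈ U) (v w : A × B) :
    fderiv ℝ (fun p => fderiv ℝ (fun p : A × B => f p.1 p.2) p v) (x, y) w =
      fderiv ℝ (fderiv ℝ (fun p : A × B => f p.1 p.2)) (x, y) w v := by
  have hd : DifferentiableAt ℝ (fderiv ℝ (fun p : A × B => f p.1 p.2)) (x, y) :=
    (((hf.fderiv_of_isOpen hU (m := ∞) (by simp)).contDiffAt (hU.mem_nhds h))).differentiableAt
      (by simp)
  have := hd.hasFDerivAt.clm_apply (hasFDerivAt_const v (x, y))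
  rw [this.fderiv]; simp

theorem Smooth2.fderiv_symm (hf : Smooth2 U f) (hU : IsOpen U) (h : (x, y) ∈ U) (v w : A × B) :
    fderiv ℝ (fderiv ℝ (fun p : A × B => f p.1 p.2)) (x, y) w v =
      fderiv ℝ (fderiv ℝ (fun p : A × B => f p.1 p.2)) (x, y) v w :=
  ((hf.contDiffAt hU h).isSymmSndFDerivAt
    (by simpa using WithTop.coe_le_coe.2 (le_top (a := (2 : ℕ∞))))).eq w v

theorem fderiv_congr_on {G : Type*} [NormedAddCommGroup G] [NormedSpace ℝ G] {V : Set G}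
    {a b : G → ℝ} (hV : IsOpen V) (h : ∀ p ∈ V, a p = b p) {p : G} (hp : p ∈ V) :
    fderiv ℝ a p = fderiv ℝ b p :=
  Filter.EventuallyEq.fderiv_eq (by filter_upwards [hV.mem_nhds hp] with q hq using h q hq)

theorem Smooth2.derivY_comm (hf : Smooth2 U f) (hU : IsOpen U) (h : (x, y) ∈ U) (v w : B) :
    SphFinsler.derivY v (SphFinsler.derivY w f) x y =
      SphFinsler.derivY w (SphFinsler.derivY v f) x y := by
  have key : ∀ v w : B, SphFinsler.derivY v (SphFinsler.derivY w f) x y =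
      fderiv ℝ (fderiv ℝ (fun p : A × B => f p.1 p.2)) (x, y) (0, v) (0, w) := fun v w => by
    rw [(hf.derivY hU w).derivY_eq hU h, ← hf.fderiv_fderiv hU h,
      fderiv_congr_on hU (fun p hp => hf.derivY_eq hU hp w) h]
  rw [key, key, hf.fderiv_symm hU h]

theorem Smooth2.derivX_comm (hf : Smooth2 U f) (hU : IsOpen U) (h : (x, y) ∈ U) (v w : A) :
    SphFinsler.derivX v (SphFinsler.derivX w f) x y =
      SphFinsler.derivX w (SphFinsler.derivX v f) x y := by
  have key : ∀ v w : A, SphFinsler.derivX v (SphFinsler.derivX w f) x y =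
      fderiv ℝ (fderiv ℝ (fun p : A × B => f p.1 p.2)) (x, y) (v, 0) (w, 0) := fun v w => by
    rw [(hf.derivX hU w).derivX_eq hU h, ← hf.fderiv_fderiv hU h,
      fderiv_congr_on hU (fun p hp => hf.derivX_eq hU hp w) h]
  rw [key, key, hf.fderiv_symm hU h]

theorem Smooth2.derivX_derivY (hf : Smooth2 U f) (hU : IsOpen U) (h : (x, y) ∈ U) (v : A) (w : B) :
    SphFinsler.derivX v (SphFinsler.derivY w f) x y =
      SphFinsler.derivY w (SphFinsler.derivX v f) x y := by
  rw [(hf.derivY hU w).derivX_eq hU h, (hf.derivX hU v).derivY_eq hU h,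
    fderiv_congr_on hU (fun p hp => hf.derivY_eq hU hp w) h,
    fderiv_congr_on hU (fun p hp => hf.derivX_eq hU hp v) h,
    hf.fderiv_fderiv hU h, hf.fderiv_fderiv hU h, hf.fderiv_symm hU h]

theorem Smooth2.add (hf : Smooth2 U f) (hg : Smooth2 U g) :
    Smooth2 U (fun x y => f x y + g x y) := ContDiffOn.add hf hg

theorem Smooth2.sub (hf : Smooth2 U f) (hg : Smooth2 U g) :
    Smooth2 U (fun x y => f x y - g x y) := ContDiffOn.sub hf hg

theorem Smooth2.mul (hf : Smooth2 U f) (hg : Smooth2 U g) :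
    Smooth2 U (fun x y => f x y * g x y) := ContDiffOn.mul hf hg

theorem Smooth2.div (hf : Smooth2 U f) (hg : Smooth2 U g) (h : ∀ x y, (x, y) ∈ U → g x y ≠ 0) :
    Smooth2 U (fun x y => f x y / g x y) := ContDiffOn.div hf hg fun p hp => h p.1 p.2 hp

theorem Smooth2.const (c : ℝ) : Smooth2 U (fun _ _ => c) := contDiffOn_const

theorem Smooth2.sum {ι : Type*} {s : Finset ι} {F : ι → A → B → ℝ}
    (h : ∀ i ∈ s, Smooth2 U (F i)) : Smooth2 U (fun x y => ∑ i ∈ s, F i x y) :=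
  ContDiffOn.sum fun i hi => h i hi

theorem Smooth2.prod {ι : Type*} {s : Finset ι} {F : ι → A → B → ℝ}
    (h : ∀ i ∈ s, Smooth2 U (F i)) : Smooth2 U (fun x y => ∏ i ∈ s, F i x y) :=
  contDiffOn_prod fun i hi => h i hi

theorem Smooth2.of_snd {k : B → ℝ} (hk : ContDiff ℝ ∞ k) : Smooth2 U (fun _ y => k y) :=
  (hk.comp contDiff_snd).contDiffOn

theorem Smooth2.of_fst {k : A → ℝ} (hk : ContDiff ℝ ∞ k) : Smooth2 U (fun x _ => k x) :=
  (hk.comp contDiff_fst).contDiffOn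

theorem derivY_of_fst (k : A → ℝ) (v : B) : derivY v (fun x (_ : B) => k x) x y = 0 := by
  simp [derivY]

theorem derivX_of_snd (k : B → ℝ) (v : A) : derivX v (fun (_ : A) y => k y) x y = 0 := by
  simp [derivX]

theorem derivX_add (hf : DifferentiableAt ℝ (fun z => f z y) x)
    (hg : DifferentiableAt ℝ (fun z => g z y) x) (v : A) :
    derivX v (fun x y => f x y + g x y) x y = derivX v f x y + derivX v g x y := by
  simp [derivX, fderiv_fun_add hf hg]

theorem derivX_mul (hf : DifferentiableAt ℝ (fun z => f z y) x)
    (hg : DifferentiableAt ℝ (fun z => g z y) x) (v : A) :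
    derivX v (fun x y => f x y * g x y) x y =
      derivX v f x y * g x y + f x y * derivX v g x y := by
  simp [derivX, fderiv_fun_mul hf hg]; ring

theorem derivY_add (hf : DifferentiableAt ℝ (fun z => f x z) y)
    (hg : DifferentiableAt ℝ (fun z => g x z) y) (v : B) :
    derivY v (fun x y => f x y + g x y) x y = derivY v f x y + derivY v g x y := by
  simp [derivY, fderiv_fun_add hf hg]

theorem derivY_mul (hf : DifferentiableAt ℝ (fun z => f x z) y)
    (hg : DifferentiableAt ℝ (fun z => g x z) y) (v : B) :
    derivY v (fun x y => f x y * g x y) x y =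
      derivY v f x y * g x y + f x y * derivY v g x y := by
  simp [derivY, fderiv_fun_mul hf hg]; ring

theorem derivX_const_mul (c : ℝ) (hf : DifferentiableAt ℝ (fun z => f z y) x) (v : A) :
    derivX v (fun x y => c * f x y) x y = c * derivX v f x y := by
  simp [derivX, fderiv_const_mul hf]

theorem derivY_const_mul (c : ℝ) (hf : DifferentiableAt ℝ (fun z => f x z) y) (v : B) :
    derivY v (fun x y => c * f x y) x y = c * derivY v f x y := by
  simp [derivY, fderiv_const_mul hf]

theorem derivX_sum {ι : Type*} {s : Finset ι} {F : ι → A → B → ℝ}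
    (h : ∀ i ∈ s, DifferentiableAt ℝ (fun z => F i z y) x) (v : A) :
    derivX v (fun x y => ∑ i ∈ s, F i x y) x y = ∑ i ∈ s, derivX v (F i) x y := by
  simp [derivX, fderiv_fun_sum h]

theorem derivY_sum {ι : Type*} {s : Finset ι} {F : ι → A → B → ℝ}
    (h : ∀ i ∈ s, DifferentiableAt ℝ (fun z => F i x z) y) (v : B) :
    derivY v (fun x y => ∑ i ∈ s, F i x y) x y = ∑ i ∈ s, derivY v (F i) x y := by
  simp [derivY, fderiv_fun_sum h]

theorem derivY_add_vec (v w : B) : derivY (v + w) f x y = derivY v f x y + derivY w f x y := by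
  simp [derivY]

theorem derivY_sub_vec (v w : B) : derivY (v - w) f x y = derivY v f x y - derivY w f x y := by
  simp [derivY]

theorem derivY_smul_vec (c : ℝ) (v : B) : derivY (c • v) f x y = c * derivY v f x y := by
  simp [derivY]

/-- Euler's relation for positively homogeneous functions of degree `k`. -/
theorem derivY_self_of_homog {k : ℕ} (hf : DifferentiableAt ℝ (fun z => f x z) y)
    (h : ∀ c : ℝ, 0 < c → f x (c • y) = c ^ k * f x y) : derivY y f x y = k * f x y := by
  have h1 : HasDerivAt (fun c : ℝ => c • y) y 1 := by
    simpa using (hasDerivAt_id (1 : ℝ)).smul_const y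
  have hf' : HasFDerivAt (fun z => f x z) (fderiv ℝ (fun z => f x z) y) ((1 : ℝ) • y) := by
    simpa using hf.hasFDerivAt
  have h2 := hf'.comp_hasDerivAt 1 h1
  have h3 : HasDerivAt (fun c : ℝ => c ^ k * f x y) (k * f x y) 1 := by
    simpa using (hasDerivAt_pow k (1 : ℝ)).mul_const (f x y)
  have h4 : (fun c : ℝ => c ^ k * f x y) =ᶠ[nhds 1] ((fun z => f x z) ∘ fun c : ℝ => c • y) := by
    filter_upwards [lt_mem_nhds one_pos] with c hc using (h c hc).symm
  exact (h2.congr_of_eventuallyEq h4).unique h3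

/-- Differentiate f(x, z) = c^(k+1) f(x, c⁻¹ z) at z = c y. Homogeneity is required only near y,
because the functions of interest are controlled only off the zero section. -/
theorem derivY_smul_of_homog {k : ℕ} {c : ℝ} (hc : 0 < c)
    (hf : DifferentiableAt ℝ (fun z => f x z) y)
    (h : ∀ᶠ z in nhds y, f x (c • z) = c ^ (k + 1) * f x z) (v : B) :
    derivY v f x (c • y) = c ^ k * derivY v f x y := by
  have h1 : HasFDerivAt (fun z => c ^ (k + 1) * f x (c⁻¹ • z))
      (c ^ (k + 1) • (fderiv ℝ (fun z => f x z) y).comp (c⁻¹ • ContinuousLinearMap.id ℝ B))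
      (c • y) := by
    have ha : HasFDerivAt (fun z : B => c⁻¹ • z) (c⁻¹ • ContinuousLinearMap.id ℝ B) (c • y) :=
      (hasFDerivAt_id (𝕜 := ℝ) (c • y)).const_smul c⁻¹
    have hb : HasFDerivAt (fun z => f x z) (fderiv ℝ (fun z => f x z) y) (c⁻¹ • c • y) := by
      rw [inv_smul_smul₀ hc.ne']; exact hf.hasFDerivAt
    exact (hb.comp (c • y) ha).const_mul _
  have h2 : (fun z => f x z) =ᶠ[nhds (c • y)] fun z => c ^ (k + 1) * f x (c⁻¹ • z) := by
    have hcont : Filter.Tendsto (fun z : B => c⁻¹ • z) (nhds (c • y)) (nhds y) := by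
      have : ContinuousAt (fun z : B => c⁻¹ • z) (c • y) := by fun_prop
      simpa [ContinuousAt, inv_smul_smul₀ hc.ne'] using this
    filter_upwards [hcont h] with z hz
    rw [← hz, smul_inv_smul₀ hc.ne']
  replace h1 := h1.congr_of_eventuallyEq h2
  rw [derivY, h1.fderiv, derivY]
  simp only [_root_.smul_apply, ContinuousLinearMap.comp_apply,
    ContinuousLinearMap.id_apply, map_smul, smul_eq_mul]
  field_simp
  ring

theorem derivX_smul_of_homog {k : ℕ} {c : ℝ}
    (hf : DifferentiableAt ℝ (fun z => f z y) x)
    (h : ∀ᶠ z in nhds x, f z (c • y) = c ^ k * f z y) (v : A) :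
    derivX v f x (c • y) = c ^ k * derivX v f x y := by
  have h2 : (fun z => f z (c • y)) =ᶠ[nhds x] fun z => c ^ k * f z y := h
  rw [derivX, h2.fderiv_eq, fderiv_const_mul hf, derivX]; simp

end TwoVariables

/-! ### Symmetric domains, the function φ, and the normal form of a pair (x, y) -/

section Domain

variable {n : ℕ}

/-- The first three standard basis vectors. -/
noncomputable def stdVec (hn : 3 ≤ n) (k : Fin 3) : E n := EuclideanSpace.single (Fin.castLE hn k) 1

theorem inner_stdVec (hn : 3 ≤ n) (i j : Fin 3) :
    inner ℝ (stdVec hn i) (stdVec hn j) = if i = j then (1 : ℝ) else 0 := by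
  simp [stdVec, EuclideanSpace.inner_single_left]

theorem norm_stdVec (hn : 3 ≤ n) (i : Fin 3) : ‖stdVec hn i‖ = 1 := by simp [stdVec]

theorem norm_smul_stdVec (hn : 3 ≤ n) (i : Fin 3) {r : ℝ} (hr : 0 ≤ r) : ‖r • stdVec hn i‖ = r := by
  rw [norm_smul, norm_stdVec, Real.norm_eq_abs, abs_of_nonneg hr, mul_one]

theorem IsSymmDomain.isOpen {M : Set (E n)} (hM : IsSymmDomain M) : IsOpen M := by
  rcases hM with ⟨ν, -, rfl⟩ | ⟨ν₁, ν₂, -, -, rfl⟩ | rfl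
  · exact Metric.isOpen_ball
  · exact Metric.isOpen_ball.sdiff Metric.isClosed_closedBall
  · exact isOpen_univ

theorem IsSymmDomain.mem_of_norm_eq {M : Set (E n)} (hM : IsSymmDomain M) {x z : E n}
    (h : ‖z‖ = ‖x‖) (hx : x ∈ M) : z ∈ M := by
  rcases hM with ⟨ν, -, rfl⟩ | ⟨ν₁, ν₂, -, -, rfl⟩ | rfl
  · simpa [h] using hx
  · simpa [h] using hx
  · trivial

theorem IsSymmDomain.mem_radii_iff {M : Set (E n)} (hM : IsSymmDomain M) (hn : 3 ≤ n) {r : ℝ} :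
    r ∈ radii M ↔ 0 < r ∧ r • stdVec hn 0 ∈ M := by
  refine ⟨?_, fun h => ⟨h.1, _, h.2, norm_smul_stdVec hn 0 h.1.le⟩⟩
  rintro ⟨hr, x, hx, rfl⟩
  exact ⟨hr, hM.mem_of_norm_eq (norm_smul_stdVec hn 0 hr.le) hx⟩

theorem norm_mem_radii {M : Set (E n)} {x : E n} (hx : x ∈ M) (h : x ≠ 0) : ‖x‖ ∈ radii M :=
  ⟨norm_pos_iff.2 h, x, hx, rfl⟩

theorem IsSymmDomain.isOpen_radii {M : Set (E n)} (hM : IsSymmDomain M) (hn : 3 ≤ n) :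
    IsOpen (radii M) := by
  have : radii M = Set.Ioi 0 ∩ (fun r : ℝ => r • stdVec hn 0) ⁻¹' M := by
    ext r; exact hM.mem_radii_iff hn
  rw [this]
  exact isOpen_Ioi.inter (hM.isOpen.preimage (by fun_prop))

theorem IsSymmDomain.ordConnected_radii {M : Set (E n)} (hM : IsSymmDomain M) (hn : 3 ≤ n) :
    (radii M).OrdConnected := by
  refine ⟨fun a ha b hb t ht => ?_⟩
  rw [hM.mem_radii_iff hn] at ha hb ⊢
  have h0 : 0 < t := ha.1.trans_le ht.1
  refine ⟨h0, ?_⟩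
  have na := norm_smul_stdVec hn 0 ha.1.le
  have nb := norm_smul_stdVec hn 0 hb.1.le
  have nt := norm_smul_stdVec hn 0 h0.le
  rcases hM with ⟨ν, -, rfl⟩ | ⟨ν₁, ν₂, -, -, rfl⟩ | rfl
  · rw [mem_ball_zero_iff] at *
    linarith [hb.2, ht.2]
  · rw [Set.mem_sdiff, mem_ball_zero_iff, mem_closedBall_zero_iff] at *
    refine ⟨by linarith [hb.2.1, ht.2], fun h => ha.2.2 (by linarith [ht.1])⟩
  · trivial

theorem IsSymmDomain.eventually_mem_radii {M : Set (E n)} (hM : IsSymmDomain M) (hn : 3 ≤ n)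
    (h0 : (0 : E n) ∈ M) : ∀ᶠ r in nhdsWithin (0 : ℝ) (Set.Ioi 0), r ∈ radii M := by
  have hc : Filter.Tendsto (fun r : ℝ => r • stdVec hn 0) (nhds 0) (nhds 0) := by
    have : ContinuousAt (fun r : ℝ => r • stdVec hn 0) 0 := by fun_prop
    simpa [ContinuousAt] using this
  have := (hc (hM.isOpen.mem_nhds h0))
  filter_upwards [nhdsWithin_le_nhds this, self_mem_nhdsWithin] with r hr hr0
  exact (hM.mem_radii_iff hn).2 ⟨hr0, hr⟩

/-- The region `0 ≤ |s| < r`, `r ∈ I`. -/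
def polarDomain (I : Set ℝ) : Set (ℝ × ℝ) := {p | p.1 ∈ I ∧ |p.2| < p.1}

theorem isOpen_polarDomain {I : Set ℝ} (hI : IsOpen I) : IsOpen (polarDomain I) :=
  (hI.preimage continuous_fst).inter
    (isOpen_lt (continuous_abs.comp continuous_snd) continuous_fst)

/-- The unit vector `a e₀ + √(1 - a²) e₁`. -/
noncomputable def arcVec (hn : 3 ≤ n) (a : ℝ) : E n :=
  a • stdVec hn 0 + √(1 - a ^ 2) • stdVec hn 1

theorem inner_stdVec_zero_arcVec (hn : 3 ≤ n) (a : ℝ) :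
    inner ℝ (stdVec hn 0) (arcVec hn a) = a := by
  rw [arcVec, inner_add_right, inner_smul_right, inner_smul_right, inner_stdVec, inner_stdVec]
  simp

theorem norm_arcVec (hn : 3 ≤ n) {a : ℝ} (ha : |a| ≤ 1) : ‖arcVec hn a‖ = 1 := by
  have h1 : 0 ≤ 1 - a ^ 2 := by
    have := (sq_le_one_iff_abs_le_one a).2 ha
    linarith
  have : ‖arcVec hn a‖ ^ 2 = 1 := by
    rw [← real_inner_self_eq_norm_sq]
    simp only [arcVec, inner_add_left, inner_add_right, inner_smul_left, inner_smul_right,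
      inner_stdVec]
    simp
    nlinarith [Real.mul_self_sqrt h1]
  nlinarith [norm_nonneg (arcVec hn a)]

theorem arcVec_ne_zero (hn : 3 ≤ n) {a : ℝ} (ha : |a| ≤ 1) : arcVec hn a ≠ 0 := by
  rw [← norm_pos_iff, norm_arcVec hn ha]; exact one_pos

theorem abs_div_le_one {r s : ℝ} (h : |s| ≤ r) : |s / r| ≤ 1 := by
  rw [abs_div]
  exact div_le_one_of_le₀ (h.trans (le_abs_self r)) (abs_nonneg r)

/-- The slit tangent bundle of `M`. -/
def slit (M : Set (E n)) : Set (E n × E n) := M ×ˢ {0}ᶜ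

theorem mem_slit {M : Set (E n)} {x y : E n} : (x, y) ∈ slit M ↔ x ∈ M ∧ y ≠ 0 := by
  simp [slit]

theorem isOpen_slit {M : Set (E n)} (hM : IsOpen M) : IsOpen (slit M) :=
  hM.prod isOpen_compl_singleton

/-- `F` is given by `φ` on the slit tangent bundle of `M`. -/
def IsGivenBy (M : Set (E n)) (F : E n → E n → ℝ) (φ : ℝ → ℝ → ℝ) : Prop :=
  ∀ x ∈ M, ∀ y, y ≠ 0 → F x y = sphericalF φ x y

theorem IsGivenBy.phi_eq {M : Set (E n)} {F : E n → E n → ℝ} {φ : ℝ → ℝ → ℝ}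
    (h : IsGivenBy M F φ) (hM : IsSymmDomain M) (hn : 3 ≤ n) {r s : ℝ} (hr : r ∈ radii M)
    (hs : |s| ≤ r) : φ r s = F (r • stdVec hn 0) (arcVec hn (s / r)) := by
  have ha := abs_div_le_one hs
  have hr' := (hM.mem_radii_iff hn).1 hr
  rw [h _ hr'.2 _ (arcVec_ne_zero hn ha), sphericalF, norm_arcVec hn ha,
    norm_smul_stdVec hn 0 hr'.1.le, real_inner_smul_left, inner_stdVec_zero_arcVec]
  simp [mul_div_cancel₀ s hr'.1.ne']

/-- φ is recovered by restricting F to a family of pairs depending smoothly on (r, s). The family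
contains √(1 - s²/r²), which is why the ends s = ±r are excluded. -/
theorem IsGivenBy.smooth_phi {M : Set (E n)} {F : E n → E n → ℝ} {φ : ℝ → ℝ → ℝ}
    (h : IsGivenBy M F φ) (hM : IsSymmDomain M) (hn : 3 ≤ n) (hF : Smooth2 (slit M) F) :
    Smooth2 (polarDomain (radii M)) φ := by
  have hmaps : ∀ p ∈ polarDomain (radii M),
      (p.1 • stdVec hn 0, arcVec hn (p.2 / p.1)) ∈ slit M := fun p hp =>
    mem_slit.2 ⟨((hM.mem_radii_iff hn).1 hp.1).2, arcVec_ne_zero hn (abs_div_le_one hp.2.le)⟩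
  have hc : ContDiffOn ℝ ∞ (fun p : ℝ × ℝ => (p.1 • stdVec hn 0, arcVec hn (p.2 / p.1)))
      (polarDomain (radii M)) := by
    have hdiv : ContDiffOn ℝ ∞ (fun p : ℝ × ℝ => p.2 / p.1) (polarDomain (radii M)) :=
      contDiff_snd.contDiffOn.div contDiff_fst.contDiffOn fun p hp => hp.1.1.ne'
    have hsq : ContDiffOn ℝ ∞ (fun p : ℝ × ℝ => √(1 - (p.2 / p.1) ^ 2))
        (polarDomain (radii M)) := by
      refine ContDiffOn.sqrt (contDiffOn_const.sub (hdiv.pow 2)) fun p hp => ?_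
      have : |p.2 / p.1| < 1 := by
        rw [abs_div, abs_of_pos hp.1.1, div_lt_one hp.1.1]; exact hp.2
      have := (sq_lt_one_iff_abs_lt_one _).2 this
      linarith
    exact (contDiff_fst.contDiffOn.smul contDiffOn_const).prodMk
      ((hdiv.smul contDiffOn_const).add (hsq.smul contDiffOn_const))
  refine (ContDiffOn.comp hF hc hmaps).congr fun p hp => ?_
  exact h.phi_eq hM hn hp.1 hp.2.le

/-- Compose two reflections. The first takes x to the first axis. The second exchanges the image of
y with its target; it fixes the image of x, because the vector being reflected is orthogonal to it,
both candidates having the same inner product with that image. -/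
theorem exists_isometry_normal_form (hn : 3 ≤ n) (x y : E n) (hy : y ≠ 0) :
    ∃ A : E n ≃ₗᵢ[ℝ] E n, A x = ‖x‖ • stdVec hn 0 ∧
      A y = ‖y‖ • arcVec hn (inner ℝ x y / ‖y‖ / ‖x‖) := by
  set A₁ : E n ≃ₗᵢ[ℝ] E n := (ℝ ∙ (x - ‖x‖ • stdVec hn 0))ᗮ.reflection with hA₁
  have h1 : A₁ x = ‖x‖ • stdVec hn 0 :=
    Submodule.reflection_sub (norm_smul_stdVec hn 0 (norm_nonneg x)).symm
  have hy0 : 0 < ‖y‖ := norm_pos_iff.2 hy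
  have ha : |inner ℝ x y / ‖y‖ / ‖x‖| ≤ 1 := by
    refine abs_div_le_one ?_
    rw [abs_div, abs_of_pos hy0, div_le_iff₀ hy0]
    exact abs_real_inner_le_norm x y
  set z : E n := ‖y‖ • arcVec hn (inner ℝ x y / ‖y‖ / ‖x‖) with hz
  have hnz : ‖A₁ y‖ = ‖z‖ := by
    rw [A₁.norm_map, hz, norm_smul, norm_arcVec hn ha, mul_one, norm_norm]
  set A₂ : E n ≃ₗᵢ[ℝ] E n := (ℝ ∙ (A₁ y - z))ᗮ.reflection with hA₂
  have h2 : A₂ (A₁ y) = z := Submodule.reflection_sub hnz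
  have h3 : A₂ (A₁ x) = A₁ x := by
    rw [hA₂]
    refine Submodule.reflection_mem_subspace_eq_self ?_
    rw [Submodule.mem_orthogonal_singleton_iff_inner_left, inner_sub_right,
      A₁.inner_map_map, h1, hz, real_inner_smul_left, real_inner_smul_right,
      inner_stdVec_zero_arcVec]
    rcases eq_or_ne x 0 with rfl | hx
    · simp
    · have := norm_ne_zero_iff.2 hx
      field_simp
      ring
  exact ⟨A₁.trans A₂, h3.trans h1, h2⟩

theorem IsSphericallySymmetric.exists_isGivenBy {M : Set (E n)} {F : E n → E n → ℝ}
    (hS : IsSphericallySymmetric M F) (hM : IsSymmDomain M) (hn : 3 ≤ n) (hF : IsFinsler M F) :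
    IsGivenBy M F fun r s => F (r • stdVec hn 0) (arcVec hn (s / r)) := by
  intro x hx y hy
  obtain ⟨A, hAx, hAy⟩ := exists_isometry_normal_form hn x y hy
  rw [← hS A x hx y, hAx, hAy, hF.homog _ _ _ _ (norm_pos_iff.2 hy), sphericalF]
  exact hM.mem_of_norm_eq (norm_smul_stdVec hn 0 (norm_nonneg x)) hx

theorem sphericalF_isSphericallySymmetric (M : Set (E n)) (φ : ℝ → ℝ → ℝ) :
    IsSphericallySymmetric M (sphericalF (n := n) φ) := by
  intro A x _ y
  simp [sphericalF]

end Domain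

/-! ### Calculus in the variables (r, s) -/

section PolarCalculus

variable {D : Set (ℝ × ℝ)} {f : ℝ → ℝ → ℝ} {r s : ℝ}

theorem ds_eq_derivY (f : ℝ → ℝ → ℝ) : ds f = derivY 1 f := by
  funext r s; simp [ds, derivY]

theorem dr_eq_derivX (f : ℝ → ℝ → ℝ) : dr f = derivX 1 f := by
  funext r s; simp [dr, derivX]

theorem Smooth2.ds (hf : Smooth2 D f) (hD : IsOpen D) : Smooth2 D (ds f) := by
  rw [ds_eq_derivY]; exact hf.derivY hD 1

theorem Smooth2.dr (hf : Smooth2 D f) (hD : IsOpen D) : Smooth2 D (dr f) := by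
  rw [dr_eq_derivX]; exact hf.derivX hD 1

theorem Smooth2.hasDerivAt_ds (hf : Smooth2 D f) (hD : IsOpen D) (h : (r, s) ∈ D) :
    HasDerivAt (fun s => f r s) (SphFinsler.ds f r s) s :=
  (hf.differentiableAt_snd hD h).hasDerivAt

theorem Smooth2.hasDerivAt_dr (hf : Smooth2 D f) (hD : IsOpen D) (h : (r, s) ∈ D) :
    HasDerivAt (fun r => f r s) (SphFinsler.dr f r s) r :=
  (hf.differentiableAt_fst hD h).hasDerivAt

theorem Smooth2.fderiv_eq_dr_ds (hf : Smooth2 D f) (hD : IsOpen D) (h : (r, s) ∈ D) (a b : ℝ) :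
    fderiv ℝ (fun p : ℝ × ℝ => f p.1 p.2) (r, s) (a, b) =
      SphFinsler.dr f r s * a + SphFinsler.ds f r s * b := by
  have : ((a, b) : ℝ × ℝ) = a • (1, 0) + b • (0, 1) := by simp
  rw [dr_eq_derivX, ds_eq_derivY, hf.derivX_eq hD h, hf.derivY_eq hD h, this, map_add, map_smul,
    map_smul]
  simp [mul_comm]

/-- Chain rule along a curve. -/
theorem Smooth2.hasDerivAt_comp (hf : Smooth2 D f) (hD : IsOpen D) {α β : ℝ → ℝ} {t a b : ℝ}
    (hα : HasDerivAt α a t) (hβ : HasDerivAt β b t) (h : (α t, β t) ∈ D) :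
    HasDerivAt (fun t => f (α t) (β t))
      (SphFinsler.dr f (α t) (β t) * a + SphFinsler.ds f (α t) (β t) * b) t := by
  have := (hf.differentiableAt hD h).hasFDerivAt.comp_hasDerivAt t (hα.prodMk hβ)
  rw [hf.fderiv_eq_dr_ds hD h] at this
  exact this

/-- `ψ = φ - s φ_s`. -/
noncomputable def legendre (f : ℝ → ℝ → ℝ) (r s : ℝ) : ℝ := f r s - s * ds f r s

theorem Smooth2.legendre (hf : Smooth2 D f) (hD : IsOpen D) : Smooth2 D (legendre f) :=
  hf.sub ((Smooth2.of_snd contDiff_id).mul (hf.ds hD))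

theorem Smooth2.ds_legendre (hf : Smooth2 D f) (hD : IsOpen D) (h : (r, s) ∈ D) :
    SphFinsler.ds (SphFinsler.legendre f) r s =
      -s * SphFinsler.ds (SphFinsler.ds f) r s := by
  have := (hf.hasDerivAt_ds hD h).sub
    ((hasDerivAt_id s).mul ((hf.ds hD).hasDerivAt_ds hD h))
  refine HasDerivAt.deriv (this.congr_deriv ?_)
  simp

theorem Smooth2.dr_legendre (hf : Smooth2 D f) (hD : IsOpen D) (h : (r, s) ∈ D) :
    SphFinsler.dr (SphFinsler.legendre f) r s =
      SphFinsler.dr f r s - s * SphFinsler.dr (SphFinsler.ds f) r s :=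
  ((hf.hasDerivAt_dr hD h).sub (((hf.ds hD).hasDerivAt_dr hD h).const_mul s)).deriv

end PolarCalculus

/-! ### First and second derivatives of a spherically symmetric function -/

section SphericalCalculus

variable {n : ℕ} {M : Set (E n)} {φ f : ℝ → ℝ → ℝ} {x y : E n}

/-- Pairs of linearly independent vectors over the nonzero points of `M`. -/
def generic (M : Set (E n)) : Set (E n × E n) :=
  {p | p.1 ∈ M ∧ p.1 ≠ 0 ∧ p.2 ≠ 0 ∧ |inner ℝ p.1 p.2| < ‖p.1‖ * ‖p.2‖}

theorem isOpen_generic (hM : IsOpen M) : IsOpen (generic M) := by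
  have h1 : IsOpen {p : E n × E n | p.1 ∈ M} := hM.preimage continuous_fst
  have h2 : IsOpen {p : E n × E n | p.1 ≠ 0} := isOpen_compl_singleton.preimage continuous_fst
  have h3 : IsOpen {p : E n × E n | p.2 ≠ 0} := isOpen_compl_singleton.preimage continuous_snd
  have h4 : IsOpen {p : E n × E n | |inner ℝ p.1 p.2| < ‖p.1‖ * ‖p.2‖} :=
    isOpen_lt (by fun_prop) (by fun_prop)
  exact h1.inter (h2.inter (h3.inter h4))

theorem generic_subset_slit : generic M ⊆ slit M := fun _ hp => ⟨hp.1, hp.2.2.1⟩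

theorem polar_mem (h : (x, y) ∈ generic M) : (‖x‖, inner ℝ x y / ‖y‖) ∈ polarDomain (radii M) := by
  refine ⟨norm_mem_radii h.1 h.2.1, ?_⟩
  have hy : 0 < ‖y‖ := norm_pos_iff.2 h.2.2.1
  show |inner ℝ x y / ‖y‖| < ‖x‖
  rw [abs_div, abs_norm, div_lt_iff₀ hy]
  exact h.2.2.2

/-- A function of `r = |x|` and `s = ⟨x, y⟩ / |y|`. -/
noncomputable def polar (f : ℝ → ℝ → ℝ) (x y : E n) : ℝ := f ‖x‖ (inner ℝ x y / ‖y‖)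

theorem smooth_norm_snd : Smooth2 (generic M) (fun _ y => ‖y‖) := fun _ hp =>
  ((contDiffAt_norm ℝ hp.2.2.1).comp _ contDiffAt_snd).contDiffWithinAt

theorem smooth_norm_fst : Smooth2 (generic M) (fun x _ => ‖x‖) := fun _ hp =>
  ((contDiffAt_norm ℝ hp.2.1).comp _ contDiffAt_fst).contDiffWithinAt

theorem smooth_inner {U : Set (E n × E n)} : Smooth2 U (fun x y => inner ℝ x y) :=
  (contDiff_inner (𝕜 := ℝ) (E := E n)).contDiffOn

theorem Smooth2.polar (hf : Smooth2 (polarDomain (radii M)) f) : Smooth2 (generic M) (polar f) :=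
  ContDiffOn.comp (g := fun p : ℝ × ℝ => f p.1 p.2) hf
    (ContDiffOn.prodMk (smooth_norm_fst (M := M))
      (smooth_inner.div smooth_norm_snd fun _ _ h => norm_ne_zero_iff.2 h.2.2.1))
    fun _ hp => polar_mem hp

theorem hasFDerivAt_norm' (hy : y ≠ 0) :
    HasFDerivAt (fun z : E n => ‖z‖) (‖y‖⁻¹ • innerSL ℝ y) y := by
  have h1 : HasFDerivAt (fun z : E n => ‖z‖ ^ 2) (2 • innerSL ℝ y) y :=
    (hasStrictFDerivAt_norm_sq y).hasFDerivAt
  have h2 := h1.sqrt (by positivity)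
  have h3 : (fun z : E n => √(‖z‖ ^ 2)) = fun z => ‖z‖ := by
    funext z; exact Real.sqrt_sq (norm_nonneg z)
  rw [h3, Real.sqrt_sq (norm_nonneg y)] at h2
  refine h2.congr_fderiv ?_
  ext v
  simp
  ring

theorem hasFDerivAt_inner_div_norm (x : E n) (hy : y ≠ 0) :
    HasFDerivAt (fun z : E n => inner ℝ x z / ‖z‖)
      (‖y‖⁻¹ • innerSL ℝ x - (inner ℝ x y / ‖y‖ ^ 3) • innerSL ℝ y) y := by
  have hn := norm_ne_zero_iff.2 hy
  have := ((innerSL ℝ x).hasFDerivAt (x := y)).mul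
    ((hasDerivAt_inv hn).comp_hasFDerivAt y (hasFDerivAt_norm' hy))
  refine (this.congr_of_eventuallyEq (Filter.Eventually.of_forall fun z => ?_)).congr_fderiv ?_
  · simp [div_eq_mul_inv]
  ext v
  simp
  field_simp
  ring

theorem derivY_norm (hy : y ≠ 0) (v : E n) :
    derivY v (fun (_ : E n) y => ‖y‖) x y = inner ℝ y v / ‖y‖ := by
  rw [derivY, (hasFDerivAt_norm' hy).fderiv]
  simp; ring

theorem derivY_inner_div_norm (hy : y ≠ 0) (u v : E n) :
    derivY u (fun (_ : E n) y => inner ℝ y v / ‖y‖) x y =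
      (inner ℝ u v - inner ℝ y u / ‖y‖ * (inner ℝ y v / ‖y‖)) / ‖y‖ := by
  have hn := norm_ne_zero_iff.2 hy
  have h1 : (fun z : E n => inner ℝ z v / ‖z‖) = fun z => inner ℝ v z / ‖z‖ := by
    funext z; rw [real_inner_comm]
  rw [derivY, h1, (hasFDerivAt_inner_div_norm v hy).fderiv]
  simp [real_inner_comm]
  field_simp

theorem derivX_inner (u v : E n) : derivX u (fun x (_ : E n) => inner ℝ x v) x y = inner ℝ u v := by
  have h1 : (fun z : E n => (inner ℝ z v : ℝ)) = fun z => innerSL ℝ v z := by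
    funext z; simp [real_inner_comm]
  rw [derivX, h1, ContinuousLinearMap.fderiv]
  simp [real_inner_comm]

theorem derivY_polar (hM : IsOpen (radii M)) (hf : Smooth2 (polarDomain (radii M)) f)
    (h : (x, y) ∈ generic M) (v : E n) :
    derivY v (polar f) x y = polar (ds f) x y *
      ((inner ℝ x v - inner ℝ x y / ‖y‖ * (inner ℝ y v / ‖y‖)) / ‖y‖) := by
  have h1 := (hf.hasDerivAt_ds (isOpen_polarDomain hM) (polar_mem h)).comp_hasFDerivAt y
    (hasFDerivAt_inner_div_norm x h.2.2.1)
  have hn := norm_ne_zero_iff.2 h.2.2.1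
  rw [derivY]
  have h2 := h1.fderiv
  simp only [Function.comp_def] at h2
  simp only [polar]
  rw [h2]
  simp
  field_simp
  simp

theorem derivX_polar (hM : IsOpen (radii M)) (hf : Smooth2 (polarDomain (radii M)) f)
    (h : (x, y) ∈ generic M) (v : E n) :
    derivX v (polar f) x y = polar (dr f) x y * (inner ℝ x v / ‖x‖) +
      polar (ds f) x y * (inner ℝ y v / ‖y‖) := by
  have hin : HasFDerivAt (fun z : E n => inner ℝ z y / ‖y‖) (‖y‖⁻¹ • innerSL ℝ y) x := by
    have := ((innerSL ℝ y).hasFDerivAt (x := x)).const_mul (‖y‖⁻¹)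
    refine this.congr_of_eventuallyEq (Filter.Eventually.of_forall fun z => ?_)
    simp [real_inner_comm]; ring
  have h1 := (hf.differentiableAt (isOpen_polarDomain hM) (polar_mem h)).hasFDerivAt.comp x
    ((hasFDerivAt_norm' h.2.1).prodMk hin)
  have h2 := h1.fderiv
  simp only [Function.comp_def] at h2
  rw [derivX]
  simp only [polar]
  rw [h2]
  simp only [ContinuousLinearMap.comp_apply, ContinuousLinearMap.prod_apply,
    _root_.smul_apply, innerSL_apply_apply, smul_eq_mul]
  rw [hf.fderiv_eq_dr_ds (isOpen_polarDomain hM) (polar_mem h)]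
  ring

/-- Grouping the terms by y/|y| and x produces ψ as a coefficient. The identity ψ_s = -s φ_ss then
keeps the second derivatives short. -/
theorem derivY_of_isGivenBy (hM : IsOpen M) (hI : IsOpen (radii M)) {F : E n → E n → ℝ}
    (hF : IsGivenBy M F φ) (hφ : Smooth2 (polarDomain (radii M)) φ)
    (h : (x, y) ∈ generic M) (v : E n) :
    derivY v F x y = polar (legendre φ) x y * (inner ℝ y v / ‖y‖) +
      polar (ds φ) x y * inner ℝ x v := by
  have hU := isOpen_generic hM
  rw [derivY_congr (g := fun x y => ‖y‖ * polar φ x y) hU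
    (fun x y h => hF x h.1 y h.2.2.1) h, derivY_mul (f := fun _ y => ‖y‖) (smooth_norm_snd.differentiableAt_snd hU h)
    (hφ.polar.differentiableAt_snd hU h), derivY_norm h.2.2.1, derivY_polar hI hφ h]
  have hn := norm_ne_zero_iff.2 h.2.2.1
  simp only [polar, legendre]
  field_simp
  ring

theorem derivX_of_isGivenBy (hM : IsOpen M) (hI : IsOpen (radii M)) {F : E n → E n → ℝ}
    (hF : IsGivenBy M F φ) (hφ : Smooth2 (polarDomain (radii M)) φ)
    (h : (x, y) ∈ generic M) (v : E n) :
    derivX v F x y = ‖y‖ * polar (dr φ) x y * (inner ℝ x v / ‖x‖) +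
      polar (ds φ) x y * inner ℝ y v := by
  have hU := isOpen_generic hM
  rw [derivX_congr (g := fun x y => ‖y‖ * polar φ x y) hU
    (fun x y h => hF x h.1 y h.2.2.1) h, derivX_mul (f := fun _ y => ‖y‖) (smooth_norm_snd.differentiableAt_fst hU h)
    (hφ.polar.differentiableAt_fst hU h), derivX_of_snd (fun y => ‖y‖), derivX_polar hI hφ h]
  have hn := norm_ne_zero_iff.2 h.2.2.1
  field_simp
  ring

theorem smooth_inner_div_norm (v : E n) :
    Smooth2 (generic M) (fun _ y => inner ℝ y v / ‖y‖) :=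
  Smooth2.div (Smooth2.of_snd (contDiff_id.inner ℝ contDiff_const)) smooth_norm_snd
    fun _ _ h => norm_ne_zero_iff.2 h.2.2.1

theorem smooth_inner_fst {U : Set (E n × E n)} (v : E n) : Smooth2 U (fun x _ => inner ℝ x v) :=
  Smooth2.of_fst (contDiff_id.inner ℝ contDiff_const)

/-- The second fibre derivative of a spherically symmetric function. -/
theorem derivY_derivY_of_isGivenBy (hM : IsOpen M) (hI : IsOpen (radii M)) {F : E n → E n → ℝ}
    (hF : IsGivenBy M F φ) (hφ : Smooth2 (polarDomain (radii M)) φ)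
    (h : (x, y) ∈ generic M) (u v : E n) :
    derivY u (derivY v F) x y =
      (polar (legendre φ) x y * (inner ℝ u v - inner ℝ y u / ‖y‖ * (inner ℝ y v / ‖y‖)) +
        polar (ds (ds φ)) x y * ((inner ℝ x u - inner ℝ x y / ‖y‖ * (inner ℝ y u / ‖y‖)) *
          (inner ℝ x v - inner ℝ x y / ‖y‖ * (inner ℝ y v / ‖y‖)))) / ‖y‖ := by
  have hU := isOpen_generic hM
  have hD := isOpen_polarDomain hI
  have hψ := hφ.legendre hD
  have hφs := hφ.ds hD
  rw [derivY_congr (g := fun x y => polar (legendre φ) x y * (inner ℝ y v / ‖y‖) +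
      polar (ds φ) x y * inner ℝ x v) hU (fun x y h => derivY_of_isGivenBy hM hI hF hφ h v) h,
    derivY_add ((hψ.polar.mul (smooth_inner_div_norm v)).differentiableAt_snd hU h)
      ((hφs.polar.mul (smooth_inner_fst v)).differentiableAt_snd hU h),
    derivY_mul (hψ.polar.differentiableAt_snd hU h)
      ((smooth_inner_div_norm v).differentiableAt_snd hU h),
    derivY_mul (hφs.polar.differentiableAt_snd hU h)
      ((smooth_inner_fst v).differentiableAt_snd hU h), derivY_of_fst,
    derivY_polar hI hψ h, derivY_polar hI hφs h, derivY_inner_div_norm h.2.2.1]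
  have hn := norm_ne_zero_iff.2 h.2.2.1
  have e : polar (ds (legendre φ)) x y = -(inner ℝ x y / ‖y‖) * polar (ds (ds φ)) x y :=
    hφ.ds_legendre hD (polar_mem h)
  rw [e]
  field_simp
  ring

/-- The quantity `(r φ_ss - φ_r + s φ_rs) / r`. -/
noncomputable def sprayNum (φ : ℝ → ℝ → ℝ) (r s : ℝ) : ℝ :=
  (r * ds (ds φ) r s - dr φ r s + s * dr (ds φ) r s) / r

/-- The Euler-Lagrange expression of a spherically symmetric function. -/
theorem derivX_self_derivY_sub_of_isGivenBy (hM : IsOpen M) (hI : IsOpen (radii M))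
    {F : E n → E n → ℝ} (hF : IsGivenBy M F φ) (hφ : Smooth2 (polarDomain (radii M)) φ)
    (h : (x, y) ∈ generic M) (v : E n) :
    derivX y (derivY v F) x y - derivX v F x y =
      ‖y‖ * polar (sprayNum φ) x y *
        (inner ℝ x v - inner ℝ x y / ‖y‖ * (inner ℝ y v / ‖y‖)) := by
  have hU := isOpen_generic hM
  have hD := isOpen_polarDomain hI
  have hψ := hφ.legendre hD
  have hφs := hφ.ds hD
  rw [derivX_congr (g := fun x y => polar (legendre φ) x y * (inner ℝ y v / ‖y‖) +
      polar (ds φ) x y * inner ℝ x v) hU (fun x y h => derivY_of_isGivenBy hM hI hF hφ h v) h,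
    derivX_add (f := fun x y => polar (legendre φ) x y * (inner ℝ y v / ‖y‖))
      (g := fun x y => polar (ds φ) x y * inner ℝ x v) ((hψ.polar.mul (smooth_inner_div_norm v)).differentiableAt_fst hU h)
      ((hφs.polar.mul (smooth_inner_fst v)).differentiableAt_fst hU h),
    derivX_mul (f := polar (legendre φ)) (g := fun _ y => inner ℝ y v / ‖y‖)
      (hψ.polar.differentiableAt_fst hU h)
      ((smooth_inner_div_norm v).differentiableAt_fst hU h),
    derivX_mul (hφs.polar.differentiableAt_fst hU h)
      ((smooth_inner_fst v).differentiableAt_fst hU h),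
    derivX_of_snd (fun z => inner ℝ z v / ‖z‖), derivX_inner,
    derivX_polar hI hψ h, derivX_polar hI hφs h, derivX_of_isGivenBy hM hI hF hφ h]
  have hn := norm_ne_zero_iff.2 h.2.2.1
  have hn' := norm_ne_zero_iff.2 h.2.1
  have e : polar (ds (legendre φ)) x y = -(inner ℝ x y / ‖y‖) * polar (ds (ds φ)) x y :=
    hφ.ds_legendre hD (polar_mem h)
  have e' : polar (dr (legendre φ)) x y =
      polar (dr φ) x y - (inner ℝ x y / ‖y‖) * polar (dr (ds φ)) x y :=
    hφ.dr_legendre hD (polar_mem h)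
  have e'' : polar (sprayNum φ) x y = (‖x‖ * polar (ds (ds φ)) x y - polar (dr φ) x y +
    (inner ℝ x y / ‖y‖) * polar (dr (ds φ)) x y) / ‖x‖ := rfl
  rw [e, e', e'', real_inner_self_eq_norm_sq]
  field_simp
  ring

end SphericalCalculus

/-! ### General Finsler geometry: geodesic coefficients, connection and curvature -/

section Finsler

variable {n : ℕ} {M : Set (E n)} {F f : E n → E n → ℝ} {x y : E n}

theorem sum_smul_single (v : E n) : ∑ i, v i • EuclideanSpace.single i (1 : ℝ) = v := by
  ext j
  simp [Pi.single_apply]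

/-- This and its companions turn the coordinate definitions into directional derivatives, so that
later computations are free of indices. -/
theorem sum_mul_pdY (v : E n) (f : E n → E n → ℝ) (x y : E n) :
    ∑ i, v i * pdY i f x y = derivY v f x y := by
  conv_rhs => rw [derivY, ← sum_smul_single v, map_sum]
  simp [pdY]

theorem sum_mul_pdX (v : E n) (f : E n → E n → ℝ) (x y : E n) :
    ∑ i, v i * pdX i f x y = derivX v f x y := by
  conv_rhs => rw [derivX, ← sum_smul_single v, map_sum]
  simp [pdX]

theorem pdX_eq (i : Fin n) (f : E n → E n → ℝ) :
    pdX i f = derivX (EuclideanSpace.single i (1 : ℝ)) f := rfl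

theorem pdY_eq (i : Fin n) (f : E n → E n → ℝ) :
    pdY i f = derivY (EuclideanSpace.single i (1 : ℝ)) f := rfl

variable {U : Set (E n × E n)}

theorem Smooth2.pdY (hf : Smooth2 U f) (hU : IsOpen U) (i : Fin n) : Smooth2 U (pdY i f) :=
  hf.derivY hU _

theorem Smooth2.pdX (hf : Smooth2 U f) (hU : IsOpen U) (i : Fin n) : Smooth2 U (pdX i f) :=
  hf.derivX hU _

theorem sum_mul_derivY_pdY (hf : Smooth2 U f) (hU : IsOpen U) (h : (x, y) ∈ U) (u v : E n) :
    ∑ j, v j * derivY u (pdY j f) x y = derivY u (derivY v f) x y := by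
  have e : derivY v f = fun x y => ∑ j, v j * pdY j f x y := by
    funext x y; rw [sum_mul_pdY]
  have hd : ∀ j, DifferentiableAt ℝ (fun z => SphFinsler.pdY j f x z) y := fun j =>
    (hf.pdY hU j).differentiableAt_snd hU h
  rw [e, derivY_sum fun j _ => (hd j).const_mul _]
  exact Finset.sum_congr rfl fun j _ => (derivY_const_mul _ (hd j) u).symm

theorem sum_mul_derivX_pdY (hf : Smooth2 U f) (hU : IsOpen U) (h : (x, y) ∈ U) (u v : E n) :
    ∑ j, v j * derivX u (pdY j f) x y = derivX u (derivY v f) x y := by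
  have e : derivY v f = fun x y => ∑ j, v j * pdY j f x y := by
    funext x y; rw [sum_mul_pdY]
  have hd : ∀ j, DifferentiableAt ℝ (fun z => SphFinsler.pdY j f z y) x := fun j =>
    (hf.pdY hU j).differentiableAt_fst hU h
  rw [e, derivX_sum fun j _ => (hd j).const_mul _]
  exact Finset.sum_congr rfl fun j _ => (derivX_const_mul _ (hd j) u).symm

theorem sum_mul_derivX_pdX (hf : Smooth2 U f) (hU : IsOpen U) (h : (x, y) ∈ U) (u v : E n) :
    ∑ j, v j * derivX u (pdX j f) x y = derivX u (derivX v f) x y := by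
  have e : derivX v f = fun x y => ∑ j, v j * pdX j f x y := by
    funext x y; rw [sum_mul_pdX]
  have hd : ∀ j, DifferentiableAt ℝ (fun z => SphFinsler.pdX j f z y) x := fun j =>
    (hf.pdX hU j).differentiableAt_fst hU h
  rw [e, derivX_sum fun j _ => (hd j).const_mul _]
  exact Finset.sum_congr rfl fun j _ => (derivX_const_mul _ (hd j) u).symm

theorem sum_mul_derivY_pdX (hf : Smooth2 U f) (hU : IsOpen U) (h : (x, y) ∈ U) (u v : E n) :
    ∑ j, v j * derivY u (pdX j f) x y = derivY u (derivX v f) x y := by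
  have e : derivX v f = fun x y => ∑ j, v j * pdX j f x y := by
    funext x y; rw [sum_mul_pdX]
  have hd : ∀ j, DifferentiableAt ℝ (fun z => SphFinsler.pdX j f x z) y := fun j =>
    (hf.pdX hU j).differentiableAt_snd hU h
  rw [e, derivY_sum fun j _ => (hd j).const_mul _]
  exact Finset.sum_congr rfl fun j _ => (derivY_const_mul _ (hd j) u).symm

theorem Smooth2.sqF (hF : Smooth2 U F) : Smooth2 U (sqF F) :=
  (hF.mul hF).congr fun x y _ => by simp [SphFinsler.sqF, sq]

theorem derivY_sqF (hF : Smooth2 U F) (hU : IsOpen U) (h : (x, y) ∈ U) (v : E n) :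
    derivY v (sqF F) x y = 2 * (F x y * derivY v F x y) := by
  have hd := hF.differentiableAt_snd hU h
  rw [derivY_congr (g := fun x y => F x y * F x y) hU (fun x y _ => by simp [sqF, sq]) h,
    derivY_mul hd hd]
  ring

theorem derivX_sqF (hF : Smooth2 U F) (hU : IsOpen U) (h : (x, y) ∈ U) (v : E n) :
    derivX v (sqF F) x y = 2 * (F x y * derivX v F x y) := by
  have hd := hF.differentiableAt_fst hU h
  rw [derivX_congr (g := fun x y => F x y * F x y) hU (fun x y _ => by simp [sqF, sq]) h,
    derivX_mul hd hd]
  ring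

theorem derivY_derivY_sqF (hF : Smooth2 U F) (hU : IsOpen U) (h : (x, y) ∈ U) (u v : E n) :
    derivY u (derivY v (sqF F)) x y =
      2 * (derivY u F x y * derivY v F x y + F x y * derivY u (derivY v F) x y) := by
  rw [derivY_congr hU (fun x y h => derivY_sqF hF hU h v) h,
    derivY_const_mul _ ((hF.mul (hF.derivY hU v)).differentiableAt_snd hU h),
    derivY_mul (hF.differentiableAt_snd hU h) ((hF.derivY hU v).differentiableAt_snd hU h)]

theorem derivX_derivY_sqF (hF : Smooth2 U F) (hU : IsOpen U) (h : (x, y) ∈ U) (u v : E n) :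
    derivX u (derivY v (sqF F)) x y =
      2 * (derivX u F x y * derivY v F x y + F x y * derivX u (derivY v F) x y) := by
  rw [derivX_congr hU (fun x y h => derivY_sqF hF hU h v) h,
    derivX_const_mul _ ((hF.mul (hF.derivY hU v)).differentiableAt_fst hU h),
    derivX_mul (hF.differentiableAt_fst hU h) ((hF.derivY hU v).differentiableAt_fst hU h)]

theorem innerAt_eq_half (hF : Smooth2 U F) (hU : IsOpen U) (h : (x, y) ∈ U) (u v : E n) :
    innerAt F x y u v = 1 / 2 * derivY u (derivY v (sqF F)) x y := by
  rw [← sum_mul_derivY_pdY hF.sqF hU h, Finset.mul_sum, innerAt, Finset.sum_comm]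
  refine Finset.sum_congr rfl fun j _ => ?_
  rw [← sum_mul_pdY, Finset.mul_sum, Finset.mul_sum]
  refine Finset.sum_congr rfl fun i _ => ?_
  simp only [fundTensor, Matrix.of_apply]
  ring

theorem innerAt_eq (hF : Smooth2 U F) (hU : IsOpen U) (h : (x, y) ∈ U) (u v : E n) :
    innerAt F x y u v =
      derivY u F x y * derivY v F x y + F x y * derivY u (derivY v F) x y := by
  rw [innerAt_eq_half hF hU h, derivY_derivY_sqF hF hU h]; ring

theorem innerAt_eq_dotProduct (F : E n → E n → ℝ) (x y u v : E n) :
    innerAt F x y u v = dotProduct u.ofLp ((fundTensor F x y).mulVec v.ofLp) := by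
  simp only [innerAt, dotProduct, Matrix.mulVec, Finset.mul_sum]
  exact Finset.sum_congr rfl fun i _ => Finset.sum_congr rfl fun j _ => by ring

theorem fundTensor_isHermitian (hF : Smooth2 U F) (hU : IsOpen U) (h : (x, y) ∈ U) :
    (fundTensor F x y).IsHermitian := by
  ext i j
  simp only [Matrix.conjTranspose_apply, fundTensor, Matrix.of_apply, star_trivial, pdY_eq]
  rw [hF.sqF.derivY_comm hU h]

theorem fundTensor_posDef_iff (hF : Smooth2 U F) (hU : IsOpen U) (h : (x, y) ∈ U) :
    (fundTensor F x y).PosDef ↔ ∀ v : E n, v ≠ 0 → 0 < innerAt F x y v v := by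
  rw [Matrix.posDef_iff_dotProduct_mulVec]
  constructor
  · rintro ⟨-, hp⟩ v hv
    rw [innerAt_eq_dotProduct]
    simpa using hp (x := v.ofLp) (by simpa using hv)
  · refine fun hp => ⟨fundTensor_isHermitian hF hU h, fun v hv => ?_⟩
    have := hp (WithLp.toLp 2 v) (by simpa using hv)
    rw [innerAt_eq_dotProduct] at this
    simpa using this

theorem Smooth2.det {ι : Type*} [Fintype ι] [DecidableEq ι] {m : E n → E n → Matrix ι ι ℝ}
    (h : ∀ i j, Smooth2 U fun x y => m x y i j) : Smooth2 U fun x y => (m x y).det := by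
  simp only [Matrix.det_apply']
  exact Smooth2.sum fun σ _ => (Smooth2.const _).mul (Smooth2.prod fun i _ => h _ _)

theorem Smooth2.matrix_inv {ι : Type*} [Fintype ι] [DecidableEq ι]
    {m : E n → E n → Matrix ι ι ℝ} (h : ∀ i j, Smooth2 U fun x y => m x y i j)
    (hd : ∀ x y, (x, y) ∈ U → (m x y).det ≠ 0) (i j : ι) :
    Smooth2 U fun x y => (m x y)⁻¹ i j := by
  have h1 : Smooth2 U fun x y => (m x y).adjugate i j := by
    simp only [Matrix.adjugate_apply]
    refine Smooth2.det fun a b => ?_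
    by_cases hab : a = j
    · subst hab
      simp only [Matrix.updateRow_self]
      exact Smooth2.const _
    · simp only [Matrix.updateRow_ne hab]
      exact h a b
  refine (h1.div (Smooth2.det h) hd).congr fun x y _ => ?_
  rw [Matrix.inv_def, Ring.inverse_eq_inv', Matrix.smul_apply, smul_eq_mul, div_eq_mul_inv,
    mul_comm]

theorem IsFinsler.smooth2 (hF : IsFinsler M F) : Smooth2 (slit M) F := hF.smooth

theorem Smooth2.fundTensor (hF : Smooth2 U F) (hU : IsOpen U) (i j : Fin n) :
    Smooth2 U fun x y => fundTensor F x y i j :=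
  (Smooth2.const (1 / 2)).mul ((hF.sqF.pdY hU j).pdY hU i)

theorem smooth_coord_snd (i : Fin n) : Smooth2 U fun (_ : E n) y => y i :=
  Smooth2.of_snd (by fun_prop)

theorem smooth_coord_fst (i : Fin n) : Smooth2 U fun x (_ : E n) => x i :=
  Smooth2.of_fst (by fun_prop)

theorem IsFinsler.smooth_geodCoeff (hF : IsFinsler M F) (hM : IsOpen M) (i : Fin n) :
    Smooth2 (slit M) (geodCoeff F i) := by
  have hU := isOpen_slit hM
  have hS := hF.smooth2.sqF
  refine (Smooth2.const (1 / 4)).mul (Smooth2.sum fun l _ => ?_)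
  refine (Smooth2.matrix_inv (fun i j => hF.smooth2.fundTensor hU i j) (fun x y h => ?_) i l).mul
    ((Smooth2.sum fun k _ => ((hS.pdY hU l).pdX hU k).mul (smooth_coord_snd k)).sub (hS.pdX hU l))
  exact (hF.posDef x (mem_slit.1 h).1 y (mem_slit.1 h).2).det_pos.ne'

/-- The geodesic coefficients as a vector. -/
noncomputable def geodVec (F : E n → E n → ℝ) (x y : E n) : E n :=
  WithLp.toLp 2 fun i => geodCoeff F i x y

/-- Lowering the index cancels the inverse matrix in the geodesic coefficients, which never has to
be computed afterwards. -/
theorem IsFinsler.innerAt_geodVec (hF : IsFinsler M F) (hM : IsOpen M) (h : (x, y) ∈ slit M)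
    (v : E n) : innerAt F x y v (geodVec F x y) =
      1 / 4 * (derivX y (derivY v (sqF F)) x y - derivX v (sqF F) x y) := by
  have hU := isOpen_slit hM
  have hS := hF.smooth2.sqF
  have hdet : IsUnit (fundTensor F x y).det :=
    isUnit_iff_ne_zero.2 (hF.posDef x (mem_slit.1 h).1 y (mem_slit.1 h).2).det_pos.ne'
  set L : Fin n → ℝ := fun l => (∑ k, pdX k (pdY l (sqF F)) x y * y k) - pdX l (sqF F) x y with hL
  have h1 : (geodVec F x y).ofLp = (1 / 4 : ℝ) • ((fundTensor F x y)⁻¹.mulVec L) := by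
    funext i
    simp [geodVec, geodCoeff, Matrix.mulVec, dotProduct, hL]
  rw [innerAt_eq_dotProduct, h1, Matrix.mulVec_smul, Matrix.mulVec_mulVec,
    Matrix.mul_nonsing_inv _ hdet, Matrix.one_mulVec, dotProduct_smul, smul_eq_mul,
    ← sum_mul_derivX_pdY hS hU h, ← sum_mul_pdX v, ← Finset.sum_sub_distrib]
  congr 1
  refine Finset.sum_congr rfl fun l _ => ?_
  rw [hL, ← sum_mul_pdX y]
  simp only [mul_sub]
  congr 2
  exact Finset.sum_congr rfl fun k _ => mul_comm _ _

theorem IsFinsler.derivY_self (hF : IsFinsler M F) (hM : IsOpen M) (h : (x, y) ∈ slit M) :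
    derivY y F x y = F x y := by
  have := derivY_self_of_homog (k := 1) (hF.smooth2.differentiableAt_snd (isOpen_slit hM) h)
    fun c hc => by rw [hF.homog x (mem_slit.1 h).1 y c hc, pow_one]
  simpa using this

theorem smul_mem_slit {c : ℝ} (hc : 0 < c) (h : (x, y) ∈ slit M) : (x, c • y) ∈ slit M :=
  mem_slit.2 ⟨(mem_slit.1 h).1, smul_ne_zero hc.ne' (mem_slit.1 h).2⟩

theorem IsFinsler.derivY_self_derivY (hF : IsFinsler M F) (hM : IsOpen M) (h : (x, y) ∈ slit M)
    (v : E n) : derivY y (derivY v F) x y = 0 := by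
  have hU := isOpen_slit hM
  have := derivY_self_of_homog (k := 0) ((hF.smooth2.derivY hU v).differentiableAt_snd hU h)
    fun c hc => derivY_smul_of_homog (k := 0) hc (hF.smooth2.differentiableAt_snd hU h)
      (.of_forall fun z => by rw [hF.homog x (mem_slit.1 h).1 z c hc, zero_add, pow_one]) v
  simpa using this

theorem IsFinsler.derivY_self_derivX (hF : IsFinsler M F) (hM : IsOpen M) (h : (x, y) ∈ slit M)
    (v : E n) : derivY y (derivX v F) x y = derivX v F x y := by
  have hU := isOpen_slit hM
  have := derivY_self_of_homog (k := 1) ((hF.smooth2.derivX hU v).differentiableAt_snd hU h)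
    fun c hc => derivX_smul_of_homog (k := 1) (hF.smooth2.differentiableAt_fst hU h)
      (by
        filter_upwards [hM.mem_nhds (mem_slit.1 h).1] with z hz
        rw [hF.homog z hz y c hc, pow_one]) v
  simpa using this

theorem IsFinsler.innerAt_self (hF : IsFinsler M F) (hM : IsOpen M) (h : (x, y) ∈ slit M)
    (v : E n) : innerAt F x y v y = F x y * derivY v F x y := by
  have hU := isOpen_slit hM
  rw [innerAt_eq hF.smooth2 hU h, hF.derivY_self hM h, hF.smooth2.derivY_comm hU h,
    hF.derivY_self_derivY hM h]
  ring

/-- By Euler's relation g_y(y, y) = F², so positive definiteness excludes F = 0. -/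
theorem IsFinsler.pos (hF : IsFinsler M F) (hM : IsOpen M) (h : (x, y) ∈ slit M) : 0 < F x y := by
  have h1 := (fundTensor_posDef_iff hF.smooth2 (isOpen_slit hM) h).1
    (hF.posDef x (mem_slit.1 h).1 y (mem_slit.1 h).2) y (mem_slit.1 h).2
  rw [hF.innerAt_self hM h, hF.derivY_self hM h] at h1
  exact lt_of_le_of_ne (hF.nonneg x (mem_slit.1 h).1 y) fun h0 => by simp [← h0] at h1

theorem IsFinsler.spray (hF : IsFinsler M F) (hM : IsOpen M) (h : (x, y) ∈ slit M) (v : E n) :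
    derivY v F x y * derivY (geodVec F x y) F x y +
        F x y * derivY v (derivY (geodVec F x y) F) x y =
      1 / 2 * (derivX y F x y * derivY v F x y +
        F x y * (derivX y (derivY v F) x y - derivX v F x y)) := by
  have hU := isOpen_slit hM
  rw [← innerAt_eq hF.smooth2 hU h, hF.innerAt_geodVec hM h, derivX_derivY_sqF hF.smooth2 hU h,
    derivX_sqF hF.smooth2 hU h]
  ring

/-- Take v = y in `IsFinsler.spray`: y lies in the kernel of the y-Hessian of F, and homogeneity
collapses the remaining terms. -/
theorem IsFinsler.derivY_geodVec (hF : IsFinsler M F) (hM : IsOpen M) (h : (x, y) ∈ slit M) :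
    2 * derivY (geodVec F x y) F x y = derivX y F x y := by
  have hU := isOpen_slit hM
  have h1 := hF.spray hM h y
  rw [hF.derivY_self hM h, hF.derivY_self_derivY hM h, hF.smooth2.derivX_derivY hU h,
    hF.derivY_self_derivX hM h] at h1
  have h2 := (hF.pos hM h).ne'
  have h3 : F x y * (2 * derivY (geodVec F x y) F x y - derivX y F x y) = 0 := by linarith
  linarith [(mul_eq_zero.1 h3).resolve_left h2]

/-- The Euler-Lagrange equation of the geodesics. -/
theorem IsFinsler.euler_lagrange (hF : IsFinsler M F) (hM : IsOpen M) (h : (x, y) ∈ slit M)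
    (v : E n) : 2 * derivY v (derivY (geodVec F x y) F) x y =
      derivX y (derivY v F) x y - derivX v F x y := by
  have h1 := hF.spray hM h v
  have h2 := (hF.pos hM h).ne'
  have h3 := hF.derivY_geodVec hM h
  have h4 : F x y * (2 * derivY v (derivY (geodVec F x y) F) x y -
      (derivX y (derivY v F) x y - derivX v F x y)) = 0 := by
    rw [← h3] at h1; linarith
  linarith [(mul_eq_zero.1 h4).resolve_left h2]

theorem derivY_sum_mul {V W : Fin n → E n → E n → ℝ} (hV : ∀ i, Smooth2 U (V i))
    (hW : ∀ i, Smooth2 U (W i)) (hU : IsOpen U) (h : (x, y) ∈ U) (v : E n) :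
    derivY v (fun x y => ∑ i, V i x y * W i x y) x y =
      ∑ i, derivY v (V i) x y * W i x y + ∑ i, V i x y * derivY v (W i) x y := by
  rw [derivY_sum fun i _ => ((hV i).mul (hW i)).differentiableAt_snd hU h,
    ← Finset.sum_add_distrib]
  exact Finset.sum_congr rfl fun i _ => derivY_mul ((hV i).differentiableAt_snd hU h)
    ((hW i).differentiableAt_snd hU h) v

theorem derivX_sum_mul {V W : Fin n → E n → E n → ℝ} (hV : ∀ i, Smooth2 U (V i))
    (hW : ∀ i, Smooth2 U (W i)) (hU : IsOpen U) (h : (x, y) ∈ U) (v : E n) :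
    derivX v (fun x y => ∑ i, V i x y * W i x y) x y =
      ∑ i, derivX v (V i) x y * W i x y + ∑ i, V i x y * derivX v (W i) x y := by
  rw [derivX_sum fun i _ => ((hV i).mul (hW i)).differentiableAt_fst hU h,
    ← Finset.sum_add_distrib]
  exact Finset.sum_congr rfl fun i _ => derivX_mul ((hV i).differentiableAt_fst hU h)
    ((hW i).differentiableAt_fst hU h) v

theorem derivY_coord (i : Fin n) (v : E n) :
    derivY v (fun (_ : E n) y => y i) x y = v i := by
  have : HasFDerivAt (fun z : E n => z i) (EuclideanSpace.proj (𝕜 := ℝ) i) y :=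
    (EuclideanSpace.proj (𝕜 := ℝ) i).hasFDerivAt
  rw [derivY, this.fderiv]; simp

theorem derivX_coord (i : Fin n) (v : E n) :
    derivX v (fun x (_ : E n) => x i) x y = v i := by
  have : HasFDerivAt (fun z : E n => z i) (EuclideanSpace.proj (𝕜 := ℝ) i) x :=
    (EuclideanSpace.proj (𝕜 := ℝ) i).hasFDerivAt
  rw [derivX, this.fderiv]; simp

/-- The derivative `∂_v G` of the geodesic coefficients in a fibre direction. -/
noncomputable def connVec (F : E n → E n → ℝ) (x y v : E n) : E n :=
  WithLp.toLp 2 fun i => derivY v (geodCoeff F i) x y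

theorem IsFinsler.sum_geodCoeff (hF : IsFinsler M F) (hM : IsOpen M) (h : (x, y) ∈ slit M) :
    2 * ∑ i, geodCoeff F i x y * pdY i F x y = ∑ i, y i * pdX i F x y := by
  rw [sum_mul_pdX, ← hF.derivY_geodVec hM h, ← sum_mul_pdY]
  rfl

/-- The metric is constant along the horizontal distribution. -/
theorem IsFinsler.derivX_eq_derivY_connVec (hF : IsFinsler M F) (hM : IsOpen M)
    (h : (x, y) ∈ slit M) (v : E n) : derivX v F x y = derivY (connVec F x y v) F x y := by
  have hU := isOpen_slit hM
  have hs := hF.smooth2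
  have hG := hF.smooth_geodCoeff hM
  -- Differentiating 2 G^i F_{y^i} = y^i F_{x^i} in y yields the claim once the second order terms
  -- are removed by the Euler-Lagrange equation.
  have h1 := derivY_congr hU (fun x y h => hF.sum_geodCoeff hM h) h v
  rw [derivY_const_mul _ ((Smooth2.sum fun i _ => (hG i).mul (hs.pdY hU i)).differentiableAt_snd
      hU h), derivY_sum_mul hG (fun i => hs.pdY hU i) hU h,
    derivY_sum_mul smooth_coord_snd (fun i => hs.pdX hU i) hU h] at h1
  simp only [derivY_coord] at h1
  rw [sum_mul_pdX, sum_mul_derivY_pdX hs hU h, ← hs.derivX_derivY hU h] at h1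
  have h2 := sum_mul_derivY_pdY hs hU h v (geodVec F x y)
  have h3 := sum_mul_pdY (connVec F x y v) F x y
  simp only [geodVec, connVec] at h2 h3
  rw [h2, h3] at h1
  have h4 := hF.euler_lagrange hM h v
  simp only [geodVec] at h4
  simp only [connVec]
  linarith

theorem IsFinsler.riemApply_apply (hF : IsFinsler M F) (hM : IsOpen M) (h : (x, y) ∈ slit M)
    (u : E n) (i : Fin n) : riemApply F x y u i =
      2 * derivX u (geodCoeff F i) x y - derivX y (derivY u (geodCoeff F i)) x y +
        2 * derivY (geodVec F x y) (derivY u (geodCoeff F i)) x y -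
        derivY (connVec F x y u) (geodCoeff F i) x y := by
  have hU := isOpen_slit hM
  have hG := hF.smooth_geodCoeff hM
  have h1 : riemApply F x y u i = ∑ k, riemCurv F i k x y * u k := rfl
  have e : ∀ k, riemCurv F i k x y * u k =
      2 * (u k * pdX k (geodCoeff F i) x y) - u k * derivX y (pdY k (geodCoeff F i)) x y +
      2 * (u k * derivY (geodVec F x y) (pdY k (geodCoeff F i)) x y) -
      ∑ j, u k * pdY k (geodCoeff F j) x y * pdY j (geodCoeff F i) x y := by
    intro k
    rw [← sum_mul_pdX y, ← sum_mul_pdY (geodVec F x y), riemCurv]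
    simp only [geodVec]
    rw [sub_mul, add_mul, sub_mul]
    congr 1
    · ring
    · rw [Finset.sum_mul]
      exact Finset.sum_congr rfl fun j _ => by ring
  rw [h1]
  simp only [e]
  rw [Finset.sum_sub_distrib, Finset.sum_add_distrib, Finset.sum_sub_distrib, ← Finset.mul_sum,
    ← Finset.mul_sum, sum_mul_pdX, sum_mul_derivX_pdY (hG i) hU h,
    sum_mul_derivY_pdY (hG i) hU h, Finset.sum_comm]
  congr 1
  rw [← sum_mul_pdY]
  refine Finset.sum_congr rfl fun j _ => ?_
  rw [← Finset.sum_mul, sum_mul_pdY]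
  rfl

/-- R_y is a curvature of the horizontal distribution, along which F is constant, so dF annihilates
its values; equivalently R_y(u) is g_y-orthogonal to y. In formulas, 2 G^i F_{y^i} = y^i F_{x^i} is
differentiated along u in x, and horizontal constancy along y in x and along G in y. The second
derivatives of F cancel by symmetry and the Euler-Lagrange equation. -/
theorem IsFinsler.derivY_riemApply (hF : IsFinsler M F) (hM : IsOpen M) (h : (x, y) ∈ slit M)
    (u : E n) : derivY (riemApply F x y u) F x y = 0 := by
  have hU := isOpen_slit hM
  have hs := hF.smooth2
  have hG := hF.smooth_geodCoeff hM
  have hsY := fun i => hs.pdY hU i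
  have hB : ∀ x y, (x, y) ∈ slit M → ∀ v, derivX v F x y =
      ∑ i, derivY v (geodCoeff F i) x y * pdY i F x y := fun x y h v => by
    rw [hF.derivX_eq_derivY_connVec hM h, ← sum_mul_pdY]; rfl
  have hGu := fun i => (hG i).derivY hU u
  have h1 := derivX_congr hU (fun x y h => hF.sum_geodCoeff hM h) h u
  rw [derivX_const_mul _ ((Smooth2.sum fun i _ => (hG i).mul (hsY i)).differentiableAt_fst
      hU h), derivX_sum_mul hG hsY hU h,
    derivX_sum_mul smooth_coord_snd (fun i => hs.pdX hU i) hU h] at h1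
  have h1a := sum_mul_derivX_pdY hs hU h u (geodVec F x y)
  simp only [geodVec] at h1a
  rw [h1a, sum_mul_derivX_pdX hs hU h] at h1
  have h1b : ∑ i, derivX u (fun (_ : E n) (y : E n) => y i) x y * pdX i F x y = 0 :=
    Finset.sum_eq_zero fun i _ => by rw [derivX_of_snd (fun y : E n => y i), zero_mul]
  rw [h1b, zero_add] at h1
  have h2 := derivX_congr hU (fun x y h => hB x y h u) h y
  rw [derivX_sum_mul hGu hsY hU h] at h2
  have h2a := sum_mul_derivX_pdY hs hU h y (connVec F x y u)
  have h3 := derivY_congr hU (fun x y h => hB x y h u) h (geodVec F x y)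
  rw [derivY_sum_mul hGu hsY hU h] at h3
  have h3a := sum_mul_derivY_pdY hs hU h (geodVec F x y) (connVec F x y u)
  have h4 := hB x y h (connVec F x y u)
  have h5 := hF.euler_lagrange hM h (connVec F x y u)
  simp only [connVec] at h2a h3a
  rw [h2a] at h2
  rw [h3a] at h3
  have h6 := hs.derivX_comm hU h u y
  have h7 := hs.derivX_derivY hU h u (geodVec F x y)
  have h8 := hs.derivY_comm hU h (geodVec F x y) (connVec F x y u)
  rw [← sum_mul_pdY]
  simp only [hF.riemApply_apply hM h u, sub_mul, add_mul, Finset.sum_sub_distrib,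
    Finset.sum_add_distrib, mul_assoc, ← Finset.mul_sum]
  simp only [geodVec, connVec] at *
  linarith

theorem IsFinsler.sqF_smul (hF : IsFinsler M F) (hx : x ∈ M) {c : ℝ} (hc : 0 < c) (y : E n) :
    sqF F x (c • y) = c ^ 2 * sqF F x y := by
  rw [sqF, sqF, hF.homog x hx y c hc]; ring

/-- F² has degree 2 in y, so the fundamental tensor has degree 0, while the bracket multiplied by
its inverse has degree 2. -/
theorem IsFinsler.geodCoeff_smul (hF : IsFinsler M F) (hM : IsOpen M) (h : (x, y) ∈ slit M)
    {c : ℝ} (hc : 0 < c) (i : Fin n) :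
    geodCoeff F i x (c • y) = c ^ 2 * geodCoeff F i x y := by
  have hU := isOpen_slit hM
  have hS := hF.smooth2.sqF
  have hx := (mem_slit.1 h).1
  have h1 : ∀ z ∈ M, ∀ v w, w ≠ 0 →
      derivY v (sqF F) z (c • w) = c ^ 1 * derivY v (sqF F) z w := fun z hz v w hw =>
    derivY_smul_of_homog hc (hS.differentiableAt_snd hU (mem_slit.2 ⟨hz, hw⟩))
      (.of_forall fun w => hF.sqF_smul hz hc w) v
  have h0 : ∀ v w, derivY w (derivY v (sqF F)) x (c • y) = derivY w (derivY v (sqF F)) x y := by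
    intro v w
    have e1 : (fun z => derivY v (sqF F) x (c • z)) =ᶠ[nhds y]
        fun z => c * derivY v (sqF F) x z := by
      filter_upwards [isOpen_compl_singleton.mem_nhds (mem_slit.1 h).2] with z hz
      rw [h1 x hx v z hz, pow_one]
    have hd := (hS.derivY hU v).differentiableAt_snd hU (smul_mem_slit hc h)
    have hd' := (hS.derivY hU v).differentiableAt_snd hU h
    have e2 : HasFDerivAt (fun z => derivY v (sqF F) x (c • z))
        ((fderiv ℝ (fun z => derivY v (sqF F) x z) (c • y)).comp
          (c • ContinuousLinearMap.id ℝ (E n))) y :=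
      hd.hasFDerivAt.comp y ((hasFDerivAt_id (𝕜 := ℝ) y).const_smul c)
    have e3 := e2.unique ((hd'.hasFDerivAt.const_mul c).congr_of_eventuallyEq e1)
    have e4 := congrArg (fun L : E n →L[ℝ] ℝ => L w) e3
    simp only [ContinuousLinearMap.comp_apply, _root_.smul_apply, ContinuousLinearMap.id_apply,
      map_smul, smul_eq_mul] at e4
    exact mul_left_cancel₀ hc.ne' e4
  have h2 : fundTensor F x (c • y) = fundTensor F x y := by
    ext i j
    simp only [fundTensor, Matrix.of_apply, pdY_eq, h0]
  have h3 : ∀ v w, derivX w (derivY v (sqF F)) x (c • y) = c ^ 1 * derivX w (derivY v (sqF F)) x y :=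
    fun v w => derivX_smul_of_homog ((hS.derivY hU v).differentiableAt_fst hU h)
      (by
        filter_upwards [hM.mem_nhds hx] with z hz
        exact h1 z hz v y (mem_slit.1 h).2) w
  have h4 : ∀ w, derivX w (sqF F) x (c • y) = c ^ 2 * derivX w (sqF F) x y :=
    fun w => derivX_smul_of_homog (hS.differentiableAt_fst hU h)
      (by
        filter_upwards [hM.mem_nhds hx] with z hz
        exact hF.sqF_smul hz hc y) w
  simp only [geodCoeff, h2, pdX_eq, pdY_eq, h3, h4, PiLp.smul_apply, smul_eq_mul]
  rw [mul_left_comm, Finset.mul_sum (a := c ^ 2)]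
  congr 1
  refine Finset.sum_congr rfl fun l _ => ?_
  rw [mul_left_comm]
  congr 1
  rw [mul_sub, Finset.mul_sum]
  congr 1
  exact Finset.sum_congr rfl fun k _ => by ring

end Finsler

/-! ### Extension of identities and inequalities by density -/

section Density

variable {n : ℕ} {M : Set (E n)}

theorem dense_compl_submodule {s : Submodule ℝ (E n)} (hs : s ≠ ⊤) : Dense (s : Set (E n))ᶜ := by
  rw [← interior_eq_empty_iff_dense_compl]
  by_contra h
  exact hs (s.eq_top_of_nonempty_interior' (Set.nonempty_iff_ne_empty.2 h))

theorem abs_inner_lt_of_notMem_span {x y : E n} (hx : x ≠ 0) (h : y ∉ Submodule.span ℝ {x}) :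
    |inner ℝ x y| < ‖x‖ * ‖y‖ := by
  refine lt_of_le_of_ne (abs_real_inner_le_norm x y) fun he => h ?_
  rcases eq_or_ne y 0 with rfl | hy
  · exact zero_mem _
  · obtain ⟨r, -, hr⟩ := (norm_inner_eq_norm_iff (𝕜 := ℝ) hx hy).1 he
    exact Submodule.mem_span_singleton.2 ⟨r, hr.symm⟩

theorem span_singleton_ne_top (hn : 3 ≤ n) (x : E n) : Submodule.span ℝ {x} ≠ ⊤ := by
  intro h
  have h1 := finrank_span_le_card (R := ℝ) ({x} : Set (E n))
  rw [h, finrank_top, finrank_euclideanSpace_fin] at h1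
  simp at h1
  omega

/-- The complement of the two proper subspaces x^⊥ and ℝx. Avoiding the first gives s ≠ 0, avoiding
the second gives |s| < r. -/
theorem dense_oblique (hn : 3 ≤ n) {x : E n} (hx : x ≠ 0) :
    Dense {y : E n | inner ℝ x y ≠ 0 ∧ |inner ℝ x y| < ‖x‖ * ‖y‖} := by
  have h1 : Dense (((ℝ ∙ x)ᗮ : Submodule ℝ (E n)) : Set (E n))ᶜ := by
    refine dense_compl_submodule fun h => hx ?_
    have : x ∈ (ℝ ∙ x)ᗮ := h ▸ Submodule.mem_top
    exact inner_self_eq_zero.1 ((Submodule.mem_orthogonal_singleton_iff_inner_right).1 this)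
  have h2 := dense_compl_submodule (span_singleton_ne_top hn x)
  have h3 : IsOpen ((Submodule.span ℝ {x} : Submodule ℝ (E n)) : Set (E n))ᶜ :=
    (Submodule.closed_of_finiteDimensional _).isOpen_compl
  refine (h1.inter_of_isOpen_right h2 h3).mono fun y hy => 
    ⟨fun h => hy.1 (Submodule.mem_orthogonal_singleton_iff_inner_right.2 h),
      abs_inner_lt_of_notMem_span hx hy.2⟩

theorem le_of_dense {X : Type*} [TopologicalSpace X] {S : Set X} (hS : Dense S) {f g : X → ℝ}
    {z : X} (hf : ContinuousAt f z) (hg : ContinuousAt g z)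
    (h : ∀ᶠ y in nhds z, y ∈ S → f y ≤ g y) : f z ≤ g z := by
  have : (nhdsWithin z S).NeBot := mem_closure_iff_nhdsWithin_neBot.1 (hS z)
  refine le_of_tendsto_of_tendsto (b := nhdsWithin z S) (hf.mono_left nhdsWithin_le_nhds)
    (hg.mono_left nhdsWithin_le_nhds) ?_
  exact eventually_nhdsWithin_iff.2 h

theorem eq_of_dense {X : Type*} [TopologicalSpace X] {S : Set X} (hS : Dense S) {f g : X → ℝ}
    {z : X} (hf : ContinuousAt f z) (hg : ContinuousAt g z)
    (h : ∀ᶠ y in nhds z, y ∈ S → f y = g y) : f z = g z :=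
  le_antisymm (le_of_dense hS hf hg (h.mono fun _ hy hs => (hy hs).le))
    (le_of_dense hS hg hf (h.mono fun _ hy hs => (hy hs).ge))

/-- A relation between continuous functions on the slit tangent bundle that holds at generic points
holds everywhere. -/
theorem eq_on_slit_of_generic (hn : 3 ≤ n) {f g : E n → E n → ℝ}
    {V : Set (E n × E n)} (hV : IsOpen V) (hVM : V ⊆ slit M)
    (hf : ∀ x y, (x, y) ∈ V → ContinuousAt (fun p : E n × E n => f p.1 p.2) (x, y))
    (hg : ∀ x y, (x, y) ∈ V → ContinuousAt (fun p : E n × E n => g p.1 p.2) (x, y))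
    (h : ∀ x y, (x, y) ∈ V → (x, y) ∈ generic M → f x y = g x y) {x y : E n}
    (hp : (x, y) ∈ V) : f x y = g x y := by
  have key : ∀ x y, (x, y) ∈ V → x ≠ 0 → f x y = g x y := by
    intro x y hp hx
    have hc : ContinuousAt (fun z : E n => (x, z)) y := by fun_prop
    refine eq_of_dense (dense_oblique hn hx) (f := fun z => f x z) (g := fun z => g x z)
      (ContinuousAt.comp (f := fun z : E n => (x, z)) (hf x y hp) hc)
      (ContinuousAt.comp (f := fun z : E n => (x, z)) (hg x y hp) hc) ?_
    filter_upwards [hc (hV.mem_nhds hp)] with z hz hz'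
    have hs := mem_slit.1 (hVM hz)
    exact h x z hz ⟨hs.1, hx, hs.2, hz'.2⟩
  have hc : ContinuousAt (fun z : E n => (z, y)) x := by fun_prop
  have : Nontrivial (E n) := ⟨⟨stdVec hn 0, 0, fun h0 => by
    have := norm_stdVec hn 0
    simp [h0] at this⟩⟩
  refine eq_of_dense (dense_compl_singleton (0 : E n)) (f := fun z => f z y)
    (g := fun z => g z y) (ContinuousAt.comp (f := fun z : E n => (z, y)) (hf x y hp) hc)
    (ContinuousAt.comp (f := fun z : E n => (z, y)) (hg x y hp) hc) ?_
  filter_upwards [hc (hV.mem_nhds hp)] with z hz hz'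
  exact key z y hz hz'

end Density

/-! ### Strong convexity in terms of φ -/

section Positivity

variable {n : ℕ} {M : Set (E n)} {F : E n → E n → ℝ} {φ : ℝ → ℝ → ℝ} {x y : E n}

/-- `φ - s φ_s + (r² - s²) φ_ss`. -/
noncomputable def radialHess (φ : ℝ → ℝ → ℝ) (r s : ℝ) : ℝ :=
  legendre φ r s + (r ^ 2 - s ^ 2) * ds (ds φ) r s

theorem derivY_derivY_expand {U : Set (E n × E n)} {f : E n → E n → ℝ} (hf : Smooth2 U f)
    (hU : IsOpen U) (h : (x, y) ∈ U) (u v : E n) : derivY u (derivY v f) x y =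
      ∑ j, ∑ i, v j * (u i * pdY i (pdY j f) x y) := by
  rw [← sum_mul_derivY_pdY hf hU h]
  refine Finset.sum_congr rfl fun j _ => ?_
  rw [← sum_mul_pdY, Finset.mul_sum]

/-- Subtract from v the multiple of y that makes the result tangent to the indicatrix. This does not
change the Hessian of F, and on the new vector g_y equals F times that Hessian. -/
theorem IsFinsler.derivY_derivY_pos (hF : IsFinsler M F) (hM : IsOpen M) (h : (x, y) ∈ slit M)
    {v : E n} (hv : ∀ t : ℝ, v ≠ t • y) : 0 < derivY v (derivY v F) x y := by
  have hU := isOpen_slit hM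
  have hpos := hF.pos hM h
  set t := derivY v F x y / F x y with ht
  have hz : v - t • y ≠ 0 := fun h0 => hv t (sub_eq_zero.1 h0)
  have h1 := (fundTensor_posDef_iff hF.smooth2 hU h).1
    (hF.posDef x (mem_slit.1 h).1 y (mem_slit.1 h).2) _ hz
  have h2 : derivY (v - t • y) F x y = 0 := by
    rw [derivY_sub_vec, derivY_smul_vec, hF.derivY_self hM h, ht, div_mul_cancel₀ _ hpos.ne',
      sub_self]
  have h3 : ∀ w, derivY w (derivY (v - t • y) F) x y = derivY w (derivY v F) x y := fun w => by
    rw [hF.smooth2.derivY_comm hU h, derivY_sub_vec, derivY_smul_vec,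
      hF.derivY_self_derivY hM h, hF.smooth2.derivY_comm hU h]
    ring
  rw [innerAt_eq hF.smooth2 hU h, h2, h3, derivY_sub_vec, derivY_smul_vec,
    hF.derivY_self_derivY hM h] at h1
  simp only [mul_zero, zero_add, sub_zero] at h1
  exact (mul_pos_iff_of_pos_left hpos).1 h1

theorem smul_stdVec_arcVec_mem_generic (hM : IsSymmDomain M) (hn : 3 ≤ n) {r s : ℝ}
    (hr : r ∈ radii M) (hs : |s| < r) :
    (r • stdVec hn 0, arcVec hn (s / r)) ∈ generic M := by
  have ha := abs_div_le_one hs.le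
  have hr' := (hM.mem_radii_iff hn).1 hr
  have hnr := norm_smul_stdVec hn 0 hr'.1.le
  refine ⟨hr'.2, ?_, arcVec_ne_zero hn ha, ?_⟩
  · rw [← norm_pos_iff, hnr]; exact hr'.1
  · simp only
    rw [real_inner_smul_left, inner_stdVec_zero_arcVec, hnr, norm_arcVec hn ha, mul_one,
      mul_div_cancel₀ s hr'.1.ne']
    exact hs

theorem inner_smul_stdVec_arcVec (hn : 3 ≤ n) {r s : ℝ} (hr : 0 < r) :
    inner ℝ (r • stdVec hn 0) (arcVec hn (s / r)) = s := by
  rw [real_inner_smul_left, inner_stdVec_zero_arcVec, mul_div_cancel₀ s hr.ne']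

theorem polar_arcVec (hn : 3 ≤ n) (f : ℝ → ℝ → ℝ) {r s : ℝ} (hr : 0 < r) (hs : |s| ≤ r) :
    polar f (r • stdVec hn 0) (arcVec hn (s / r)) = f r s := by
  rw [polar, inner_smul_stdVec_arcVec hn hr, norm_arcVec hn (abs_div_le_one hs),
    norm_smul_stdVec hn 0 hr.le, div_one]

/-- The derivative of the arc of unit vectors, rotated back to a continuous field. -/
noncomputable def arcNormal (hn : 3 ≤ n) (a : ℝ) : E n :=
  -√(1 - a ^ 2) • stdVec hn 0 + a • stdVec hn 1

theorem exists_lower_bound_of_continuous {k : ℝ → ℝ}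
    (hk : ContinuousOn k (Set.Icc (-1) 1)) (hpos : ∀ a ∈ Set.Icc (-1 : ℝ) 1, 0 < k a) :
    ∃ c : ℝ, 0 < c ∧ ∀ a ∈ Set.Icc (-1 : ℝ) 1, c ≤ k a := by
  obtain ⟨a, ha, hmin⟩ := isCompact_Icc.exists_isMinOn (by simp) hk
  exact ⟨k a, hpos a ha, fun b hb => hmin hb⟩

/-- The arc is closed: it contains the directions s = ±r, where φ itself need not be smooth but F
is. Compactness then gives bounds that survive s → ±r. -/
theorem continuousOn_second_derivative_arc (hF : IsFinsler M F) (hM : IsSymmDomain M)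
    (hn : 3 ≤ n) {r : ℝ} (hr : r ∈ radii M) {w : ℝ → E n} (hw : Continuous w) :
    ContinuousOn (fun a => derivY (w a) (derivY (w a) F) (r • stdVec hn 0) (arcVec hn a))
      (Set.Icc (-1) 1) := by
  have hU := isOpen_slit hM.isOpen
  have hmem : ∀ a ∈ Set.Icc (-1 : ℝ) 1, (r • stdVec hn 0, arcVec hn a) ∈ slit M := fun a ha =>
    mem_slit.2 ⟨((hM.mem_radii_iff hn).1 hr).2, arcVec_ne_zero hn (abs_le.2 ha)⟩
  have harc : Continuous (arcVec hn) := by unfold arcVec; fun_prop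
  refine ContinuousOn.congr ?_ fun a ha => derivY_derivY_expand hF.smooth2 hU (hmem a ha) _ _
  refine continuousOn_finsetSum _ fun j _ => continuousOn_finsetSum _ fun i _ => ?_
  refine ContinuousOn.mul (by fun_prop) (ContinuousOn.mul (by fun_prop) ?_)
  exact ContinuousOn.comp (((hF.smooth2.pdY hU j).pdY hU i).continuousOn)
    (f := fun a => (r • stdVec hn 0, arcVec hn a)) (by fun_prop) hmem

/-- Strong convexity bounds the radial Hessian and the Legendre transform from below. -/
theorem IsFinsler.exists_lower_bound (hF : IsFinsler M F) (hM : IsSymmDomain M) (hn : 3 ≤ n)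
    (hφ : IsGivenBy M F φ) {r : ℝ} (hr : r ∈ radii M) :
    ∃ c : ℝ, 0 < c ∧ ∀ s, |s| < r → c ≤ radialHess φ r s ∧ c ≤ legendre φ r s := by
  have hmem : ∀ a ∈ Set.Icc (-1 : ℝ) 1, (r • stdVec hn 0, arcVec hn a) ∈ slit M := fun a ha =>
    mem_slit.2 ⟨((hM.mem_radii_iff hn).1 hr).2, arcVec_ne_zero hn (abs_le.2 ha)⟩
  have hr0 : 0 < r := hr.1
  have hsm := hφ.smooth_phi hM hn hF.smooth2
  have hI := hM.isOpen_radii hn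
  have i00 := inner_stdVec hn 0 0
  have i01 := inner_stdVec hn 0 1
  have i10 := inner_stdVec hn 1 0
  have i11 := inner_stdVec hn 1 1
  have i22 := inner_stdVec hn 2 2
  have i02 := inner_stdVec hn 0 2
  have i12 := inner_stdVec hn 1 2
  simp only [if_true, reduceIte, Fin.isValue, show (0 : Fin 3) ≠ 1 by decide,
    show (1 : Fin 3) ≠ 0 by decide, show (0 : Fin 3) ≠ 2 by decide,
    show (1 : Fin 3) ≠ 2 by decide] at i00 i01 i10 i11 i22 i02 i12
  have hsq : ∀ a ∈ Set.Icc (-1 : ℝ) 1, √(1 - a ^ 2) ^ 2 = 1 - a ^ 2 := fun a ha =>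
    Real.sq_sqrt (by nlinarith [ha.1, ha.2])
  have hyv : ∀ a, inner ℝ (arcVec hn a) (arcNormal hn a) = 0 := fun a => by
    simp only [arcVec, arcNormal, inner_add_left, inner_add_right, real_inner_smul_left,
      real_inner_smul_right, i00, i01, i10, i11]
    ring
  have hvv : ∀ a ∈ Set.Icc (-1 : ℝ) 1, inner ℝ (arcNormal hn a) (arcNormal hn a) = 1 :=
    fun a ha => by
      simp only [arcNormal, inner_add_left, inner_add_right, real_inner_smul_left,
        real_inner_smul_right, i00, i01, i10, i11]
      nlinarith [hsq a ha]
  have hye : ∀ a, inner ℝ (arcVec hn a) (stdVec hn 2) = 0 := fun a => by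
    simp only [arcVec, inner_add_left, real_inner_smul_left, i02, i12]
    ring
  have hpos : ∀ a ∈ Set.Icc (-1 : ℝ) 1, ∀ v, inner ℝ (arcVec hn a) v = 0 → inner ℝ v v = 1 →
      0 < derivY v (derivY v F) (r • stdVec hn 0) (arcVec hn a) := by
    intro a ha v h1 h2
    refine hF.derivY_derivY_pos hM.isOpen (hmem a ha) fun t ht => ?_
    rw [ht, real_inner_smul_right, real_inner_self_eq_norm_sq, norm_arcVec hn (abs_le.2 ha)] at h1
    rw [ht, show t = 0 by linarith] at h2
    simp at h2
  -- Two unit directions orthogonal to y suffice: the one in the plane of x and y sees H, and a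
  -- third axis, available since n ≥ 3, sees ψ.
  obtain ⟨c₁, hc₁, h₁⟩ := exists_lower_bound_of_continuous
    (continuousOn_second_derivative_arc hF hM hn hr (w := arcNormal hn)
      (by unfold arcNormal; fun_prop)) fun a ha => hpos a ha _ (hyv a) (hvv a ha)
  obtain ⟨c₂, hc₂, h₂⟩ := exists_lower_bound_of_continuous
    (continuousOn_second_derivative_arc hF hM hn hr (w := fun _ => stdVec hn 2)
      continuous_const) fun a ha => hpos a ha _ (hye a) i22
  refine ⟨min c₁ c₂, lt_min hc₁ hc₂, fun s hs => ?_⟩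
  have ha : s / r ∈ Set.Icc (-1 : ℝ) 1 := abs_le.1 (abs_div_le_one hs.le)
  have hg := smul_stdVec_arcVec_mem_generic hM hn hr hs
  have k₁ := h₁ _ ha
  have k₂ := h₂ _ ha
  rw [derivY_derivY_of_isGivenBy hM.isOpen hI hφ hsm hg, polar_arcVec hn _ hr0 hs.le,
    polar_arcVec hn _ hr0 hs.le, norm_arcVec hn (abs_le.2 ha), inner_smul_stdVec_arcVec hn hr0]
    at k₁ k₂
  rw [hvv _ ha, hyv] at k₁
  rw [i22, hye, real_inner_smul_left, i02] at k₂
  have hxv : inner ℝ (r • stdVec hn 0) (arcNormal hn (s / r)) = -(r * √(1 - (s / r) ^ 2)) := by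
    simp only [arcNormal, inner_add_right, real_inner_smul_left, real_inner_smul_right, i00, i01]
    ring
  have hw : r ^ 2 * √(1 - (s / r) ^ 2) ^ 2 = r ^ 2 - s ^ 2 := by
    rw [hsq _ ha]; field_simp
  rw [hxv] at k₁
  refine ⟨(min_le_left _ _).trans (k₁.trans_eq ?_), (min_le_right _ _).trans (k₂.trans_eq ?_)⟩
  · rw [radialHess, ← hw]; ring
  · ring

/-- Cauchy-Schwarz for the components of x and v orthogonal to y. -/
theorem inner_sq_le_of_perp {x y v : E n} (hy : y ≠ 0) :
    (inner ℝ x v - inner ℝ x y / ‖y‖ * (inner ℝ y v / ‖y‖)) ^ 2 ≤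
      (‖x‖ ^ 2 - (inner ℝ x y / ‖y‖) ^ 2) * (inner ℝ v v - (inner ℝ y v / ‖y‖) ^ 2) := by
  have hn := norm_ne_zero_iff.2 hy
  set x' := x - (inner ℝ x y / ‖y‖ ^ 2) • y with hx'
  set v' := v - (inner ℝ y v / ‖y‖ ^ 2) • y with hv'
  have e1 : inner ℝ x' v' = inner ℝ x v - inner ℝ x y / ‖y‖ * (inner ℝ y v / ‖y‖) := by
    simp only [hx', hv', inner_sub_left, inner_sub_right, real_inner_smul_left,
      real_inner_smul_right, real_inner_self_eq_norm_sq]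
    field_simp
    ring
  have e2 : inner ℝ x' x' = ‖x‖ ^ 2 - (inner ℝ x y / ‖y‖) ^ 2 := by
    simp only [hx', inner_sub_left, inner_sub_right, real_inner_smul_left,
      real_inner_smul_right, real_inner_comm x y]
    rw [real_inner_self_eq_norm_sq x, real_inner_self_eq_norm_sq y]
    field_simp
    ring
  have e3 : inner ℝ v' v' = inner ℝ v v - (inner ℝ y v / ‖y‖) ^ 2 := by
    simp only [hv', inner_sub_left, inner_sub_right, real_inner_smul_left,
      real_inner_smul_right, real_inner_comm y v]
    rw [real_inner_self_eq_norm_sq v, real_inner_self_eq_norm_sq y]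
    field_simp
    ring
  rw [← e1, ← e2, ← e3, sq]
  exact real_inner_mul_inner_self_le x' v'

theorem sphericalF_smul (φ : ℝ → ℝ → ℝ) (x y : E n) {c : ℝ} (hc : 0 < c) :
    sphericalF φ x (c • y) = c * sphericalF φ x y := by
  rw [sphericalF, sphericalF, norm_smul, Real.norm_of_nonneg hc.le, real_inner_smul_right,
    mul_div_mul_left _ _ hc.ne', mul_assoc]

theorem sphericalF_pos (hφ : ∀ x ∈ M, ∀ s, |s| ≤ ‖x‖ → 0 < φ ‖x‖ s) (hx : x ∈ M) (hy : y ≠ 0) :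
    0 < sphericalF φ x y := by
  have hy0 := norm_pos_iff.2 hy
  refine mul_pos hy0 (hφ x hx _ ?_)
  rw [abs_div, abs_norm, div_le_iff₀ hy0]
  exact abs_real_inner_le_norm x y

/-- At generic y the right side is ψ m + φ_ss b², where m is the squared length of the part of v
orthogonal to y and 0 ≤ b² ≤ (r² - s²) m. This is affine in b², with extreme values ψ m and H m,
both at least c m. Density covers the remaining y, including s = 0 and s = ±r. -/
theorem second_derivative_lower_bound (hn : 3 ≤ n) (hM : IsSymmDomain M)
    (hs : Smooth2 (slit M) (sphericalF (n := n) φ)) (hx : x ≠ 0) {c : ℝ}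
    (hc : ∀ s, 0 < |s| → |s| < ‖x‖ → c ≤ radialHess φ ‖x‖ s ∧ c ≤ legendre φ ‖x‖ s)
    (h : (x, y) ∈ slit M) (v : E n) :
    c * (inner ℝ v v - (inner ℝ y v / ‖y‖) ^ 2) ≤
      ‖y‖ * derivY v (derivY v (sphericalF φ)) x y := by
  have hU := isOpen_slit hM.isOpen
  have hg : IsGivenBy M (sphericalF (n := n) φ) φ := fun _ _ _ _ => rfl
  have hsm := hg.smooth_phi hM hn hs
  have hy0 := norm_ne_zero_iff.2 (mem_slit.1 h).2
  refine le_of_dense (dense_oblique hn hx)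
    (f := fun y => c * (inner ℝ v v - (inner ℝ y v / ‖y‖) ^ 2))
    (g := fun y => ‖y‖ * derivY v (derivY v (sphericalF φ)) x y) ?_ ?_ ?_
  · refine ContinuousAt.mul continuousAt_const (continuousAt_const.sub (ContinuousAt.pow ?_ 2))
    exact ContinuousAt.div (by fun_prop) (by fun_prop) hy0
  · exact continuousAt_id.norm.mul
      (((hs.derivY hU v).derivY hU v).differentiableAt_snd hU h).continuousAt
  · filter_upwards [isOpen_compl_singleton.mem_nhds (mem_slit.1 h).2] with z hz0 hz
    have hgen : (x, z) ∈ generic M := ⟨(mem_slit.1 h).1, hx, hz0, hz.2⟩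
    have hz1 : 0 < ‖z‖ := norm_pos_iff.2 hz0
    have hp := polar_mem hgen
    obtain ⟨c1, c2⟩ := hc (inner ℝ x z / ‖z‖) (by
      rw [abs_pos]; exact div_ne_zero hz.1 hz1.ne') hp.2
    rw [derivY_derivY_of_isGivenBy hM.isOpen (hM.isOpen_radii hn) hg hsm hgen,
      mul_div_cancel₀ _ hz1.ne']
    have h1 := inner_sq_le_of_perp (x := x) (v := v) hz0
    simp only [polar, radialHess] at c1 c2 ⊢
    generalize inner ℝ x v - inner ℝ x z / ‖z‖ * (inner ℝ z v / ‖z‖) = b at h1 ⊢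
    have h2 : 0 ≤ inner ℝ v v - (inner ℝ z v / ‖z‖) ^ 2 := by
      rw [sub_nonneg, div_pow, div_le_iff₀ (by positivity), real_inner_self_eq_norm_sq, ← mul_pow,
        mul_comm ‖v‖]
      exact sq_le_sq' (by linarith [neg_abs_le (inner ℝ z v : ℝ), abs_real_inner_le_norm z v])
        (real_inner_le_norm z v)
    have e : inner ℝ v v - inner ℝ z v / ‖z‖ * (inner ℝ z v / ‖z‖) =
      inner ℝ v v - (inner ℝ z v / ‖z‖) ^ 2 := by ring
    rw [e]
    generalize inner ℝ v v - (inner ℝ z v / ‖z‖) ^ 2 = m at *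
    generalize inner ℝ x z / ‖z‖ = s at *
    -- The sign of φ_ss decides whether the minimum is at b = 0 (value ψ m) or at the largest b²
    -- (value H m).
    rcases le_total 0 (ds (ds φ) ‖x‖ s) with hd | hd
    · nlinarith [mul_nonneg hd (mul_self_nonneg b), mul_le_mul_of_nonneg_right c2 h2]
    · have h3 := mul_le_mul_of_nonpos_left h1 hd
      have h4 := mul_le_mul_of_nonneg_right c1 h2
      nlinarith

/-- Over the origin s = 0 for all y, so F is a positive multiple of the Euclidean norm. The (r, s)
calculus does not reach this point. -/
theorem fundTensor_zero (hφ : 0 < φ 0 0) (hU : IsOpen (slit M))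
    (hs : Smooth2 (slit M) (sphericalF (n := n) φ)) (h : ((0 : E n), y) ∈ slit M) {v : E n}
    (hv : v ≠ 0) : 0 < innerAt (sphericalF φ) 0 y v v := by
  rw [innerAt_eq_half hs hU h]
  have e : ∀ z : E n, sqF (sphericalF φ) 0 z = φ 0 0 ^ 2 * ‖z‖ ^ 2 := fun z => by
    simp [sqF, sphericalF]; ring
  have e1 : ∀ z : E n, derivY v (sqF (sphericalF φ)) 0 z = φ 0 0 ^ 2 * 2 * inner ℝ v z := by
    intro z
    have := ((hasStrictFDerivAt_norm_sq z).hasFDerivAt).const_mul (φ 0 0 ^ 2)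
    rw [derivY, funext e, this.fderiv]
    simp [real_inner_comm]
    ring
  have h3 := ((innerSL ℝ v).hasFDerivAt (x := y)).const_mul (φ 0 0 ^ 2 * 2)
  have h4 : (fun z => derivY v (sqF (sphericalF φ)) (0 : E n) z) =
      fun z => φ 0 0 ^ 2 * 2 * innerSL ℝ v z := by
    funext z; rw [e1]; simp
  have e2 : derivY v (derivY v (sqF (sphericalF φ))) 0 y = φ 0 0 ^ 2 * 2 * ‖v‖ ^ 2 := by
    rw [derivY, h4, h3.fderiv]
    simp
  rw [e2]
  have := norm_pos_iff.2 hv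
  positivity

/-- Lower bounds of the radial Hessian and the Legendre transform give strong convexity. -/
theorem sphericalF_isFinsler (hn : 3 ≤ n) (hM : IsSymmDomain M)
    (hφ : ∀ x ∈ M, ∀ s, |s| ≤ ‖x‖ → 0 < φ ‖x‖ s)
    (hs : Smooth2 (slit M) (sphericalF (n := n) φ))
    (hc : ∀ r ∈ radii M, ∃ c : ℝ, 0 < c ∧ ∀ s, 0 < |s| → |s| < r →
      c ≤ radialHess φ r s ∧ c ≤ legendre φ r s) :
    IsFinsler M (sphericalF (n := n) φ) where
  nonneg x hx y := by
    rcases eq_or_ne y 0 with rfl | hy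
    · simp [sphericalF]
    · exact (sphericalF_pos hφ hx hy).le
  smooth := hs
  homog x _ y c hc := sphericalF_smul φ x y hc
  posDef x hx y hy := by
    have hU := isOpen_slit hM.isOpen
    have h : (x, y) ∈ slit M := mem_slit.2 ⟨hx, hy⟩
    rw [fundTensor_posDef_iff hs hU h]
    intro v hv
    rcases eq_or_ne x 0 with rfl | hx0
    · exact fundTensor_zero (by simpa using hφ 0 hx 0 (by simp)) hU hs h hv
    obtain ⟨c, c0, hc⟩ := hc ‖x‖ (norm_mem_radii hx hx0)
    have h1 := second_derivative_lower_bound hn hM hs hx0 hc h v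
    have hy0 := norm_pos_iff.2 hy
    have hF0 := sphericalF_pos hφ hx hy
    rw [innerAt_eq hs hU h]
    -- For v parallel to y positivity comes from (dF(v))², since dF(y) = F; otherwise it comes from
    -- the Hessian of F.
    by_cases hpar : ∃ t : ℝ, v = t • y
    · obtain ⟨t, rfl⟩ := hpar
      have ht : t ≠ 0 := fun h0 => hv (by simp [h0])
      have h2 : inner ℝ (t • y) (t • y) - (inner ℝ y (t • y) / ‖y‖) ^ 2 = (0 : ℝ) := by
        rw [real_inner_smul_left, real_inner_smul_right, real_inner_self_eq_norm_sq]
        field_simp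
        ring
      rw [h2, mul_zero] at h1
      have h3 := nonneg_of_mul_nonneg_right h1 hy0
      have h4 : derivY (t • y) (sphericalF φ) x y = t * sphericalF φ x y := by
        rw [derivY_smul_vec, derivY_self_of_homog (k := 1) (hs.differentiableAt_snd hU h)
          fun c hc => by rw [sphericalF_smul φ x y hc, pow_one]]
        simp
      rw [h4]
      have h5 : 0 < t * sphericalF φ x y * (t * sphericalF φ x y) :=
        mul_self_pos.2 (mul_ne_zero ht hF0.ne')
      have h6 := mul_nonneg hF0.le h3
      linarith
    · have h2 : 0 < inner ℝ v v - (inner ℝ y v / ‖y‖) ^ 2 := by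
        have hns : v ∉ Submodule.span ℝ {y} := fun hm => by
          obtain ⟨t, ht⟩ := Submodule.mem_span_singleton.1 hm
          exact hpar ⟨t, ht.symm⟩
        have := abs_inner_lt_of_notMem_span hy hns
        rw [sub_pos, div_pow, div_lt_iff₀ (by positivity), real_inner_self_eq_norm_sq, ← mul_pow,
          mul_comm ‖v‖]
        exact sq_lt_sq' (by linarith [neg_abs_le (inner ℝ y v : ℝ)])
          ((le_abs_self _).trans_lt this)
      have h3 : 0 < derivY v (derivY v (sphericalF φ)) x y :=
        (mul_pos_iff_of_pos_left hy0).1 ((mul_pos c0 h2).trans_le h1)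
      have h4 := mul_self_nonneg (derivY v (sphericalF φ) x y)
      have h5 := mul_pos hF0 h3
      linarith

end Positivity

/-! ### The geodesic vector lies in the span of x and y -/

section Spray

variable {n : ℕ} {M : Set (E n)} {F : E n → E n → ℝ} {φ : ℝ → ℝ → ℝ} {x y : E n}

theorem Qfun_eq (φ : ℝ → ℝ → ℝ) (r s : ℝ) :
    Qfun φ r s = sprayNum φ r s / (2 * radialHess φ r s) := by
  rw [Qfun, sprayNum, radialHess, legendre, div_div, div_mul_div_comm, one_mul]
  ring_nf

theorem IsFinsler.radialHess_pos (hF : IsFinsler M F) (hM : IsSymmDomain M) (hn : 3 ≤ n)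
    (hφ : IsGivenBy M F φ) {r s : ℝ} (h : (r, s) ∈ polarDomain (radii M)) :
    0 < radialHess φ r s := by
  obtain ⟨c, hc, h1⟩ := hF.exists_lower_bound hM hn hφ h.1
  exact hc.trans_le (h1 s h.2).1

theorem smooth_sprayNum (hI : IsOpen (radii M)) (hφ : Smooth2 (polarDomain (radii M)) φ) :
    Smooth2 (polarDomain (radii M)) (sprayNum φ) := by
  have hD := isOpen_polarDomain hI
  have h1 : Smooth2 (polarDomain (radii M)) (fun r _ => r) := Smooth2.of_fst contDiff_id
  have h2 : Smooth2 (polarDomain (radii M)) (fun _ s => s) := Smooth2.of_snd contDiff_id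
  exact (((h1.mul ((hφ.ds hD).ds hD)).sub (hφ.dr hD)).add (h2.mul ((hφ.ds hD).dr hD))).div h1
    fun r s h => h.1.1.ne'

theorem smooth_radialHess (hI : IsOpen (radii M)) (hφ : Smooth2 (polarDomain (radii M)) φ) :
    Smooth2 (polarDomain (radii M)) (radialHess φ) := by
  have hD := isOpen_polarDomain hI
  have h1 : Smooth2 (polarDomain (radii M)) (fun r _ => r ^ 2) := Smooth2.of_fst (by fun_prop)
  have h2 : Smooth2 (polarDomain (radii M)) (fun _ s => s ^ 2) := Smooth2.of_snd (by fun_prop)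
  exact (hφ.legendre hD).add ((h1.sub h2).mul ((hφ.ds hD).ds hD))

theorem IsFinsler.smooth_Qfun (hF : IsFinsler M F) (hM : IsSymmDomain M) (hn : 3 ≤ n)
    (hφ : IsGivenBy M F φ) : Smooth2 (polarDomain (radii M)) (Qfun φ) := by
  have hI := hM.isOpen_radii hn
  have hs := hφ.smooth_phi hM hn hF.smooth2
  refine ((smooth_sprayNum hI hs).div ((Smooth2.const 2).mul (smooth_radialHess hI hs))
    fun r s h => ?_).congr fun r s _ => Qfun_eq φ r s
  exact (mul_pos two_pos (hF.radialHess_pos hM hn hφ h)).ne'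

/-- The coefficient of `x` in the geodesic vector. -/
noncomputable def sprayCoeff (φ : ℝ → ℝ → ℝ) (x y : E n) : ℝ := ‖y‖ ^ 2 * polar (Qfun φ) x y

theorem IsFinsler.smooth_sprayCoeff (hF : IsFinsler M F) (hM : IsSymmDomain M) (hn : 3 ≤ n)
    (hφ : IsGivenBy M F φ) : Smooth2 (generic M) (sprayCoeff φ) :=
  (Smooth2.of_snd (contDiff_norm_sq ℝ)).mul (hF.smooth_Qfun hM hn hφ).polar

/-- The geodesic vector of a spherically symmetric metric lies in the span of `x` and `y`. -/
theorem IsFinsler.exists_geodVec_eq (hF : IsFinsler M F) (hM : IsSymmDomain M) (hn : 3 ≤ n)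
    (hφ : IsGivenBy M F φ) (h : (x, y) ∈ generic M) :
    ∃ p : ℝ, geodVec F x y = p • y + sprayCoeff φ x y • x := by
  have hI := hM.isOpen_radii hn
  have hs := hφ.smooth_phi hM hn hF.smooth2
  have hsl := generic_subset_slit h
  have hU := isOpen_slit hM.isOpen
  have hpos := hF.pos hM.isOpen hsl
  have hy0 := norm_ne_zero_iff.2 h.2.2.1
  have hden := hF.radialHess_pos hM hn hφ (polar_mem h)
  -- The Euler-Lagrange covector is a multiple of ⟨x, v⟩ - s ⟨y, v⟩ / |y|, and so is the Hessian of
  -- F applied to x, with factor H / |y|. The ratio is |y|² Q, so z lies in the kernel of the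
  -- Hessian.
  set z := geodVec F x y - sprayCoeff φ x y • x with hz
  have hlin : ∀ a b w : E n, ∀ c : ℝ, derivY (a - c • b) (derivY w F) x y =
      derivY a (derivY w F) x y - c * derivY b (derivY w F) x y := fun a b w c => by
    rw [derivY_sub_vec, derivY_smul_vec]
  have hz0 : ∀ v, derivY z (derivY v F) x y = 0 := by
    intro v
    have h1 := hF.euler_lagrange hM.isOpen hsl v
    rw [derivX_self_derivY_sub_of_isGivenBy hM.isOpen hI hφ hs h] at h1
    have h2 := derivY_derivY_of_isGivenBy hM.isOpen hI hφ hs h x v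
    rw [hz, hlin, hF.smooth2.derivY_comm hU hsl, h2]
    have hQ : polar (Qfun φ) x y = polar (sprayNum φ) x y / (2 * polar (radialHess φ) x y) :=
      Qfun_eq φ _ _
    have hR : polar (radialHess φ) x y = polar (legendre φ) x y +
      (‖x‖ ^ 2 - (inner ℝ x y / ‖y‖) ^ 2) * polar (ds (ds φ)) x y := rfl
    have hden' : polar (radialHess φ) x y ≠ 0 := hden.ne'
    have h3 : polar (legendre φ) x y = polar (radialHess φ) x y -
      (‖x‖ ^ 2 - (inner ℝ x y / ‖y‖) ^ 2) * polar (ds (ds φ)) x y := by rw [hR]; ring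
    rw [sprayCoeff, hQ, h3, real_inner_self_eq_norm_sq, real_inner_comm x y]
    have h4 : derivY v (derivY (geodVec F x y) F) x y = ‖y‖ * polar (sprayNum φ) x y *
        (inner ℝ x v - inner ℝ x y / ‖y‖ * (inner ℝ y v / ‖y‖)) / 2 := by linarith
    rw [h4]
    field_simp
    ring
  -- This value makes dF(z - a y) = 0. Since the Hessian also kills z - a y, its g_y-norm vanishes.
  set a := derivY z F x y / F x y with ha
  refine ⟨a, ?_⟩
  have hza : z - a • y = 0 := by
    by_contra hne
    have h1 := (fundTensor_posDef_iff hF.smooth2 hU hsl).1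
      (hF.posDef x h.1 y h.2.2.1) _ hne
    rw [innerAt_eq hF.smooth2 hU hsl, hlin, hz0, hF.derivY_self_derivY hM.isOpen hsl,
      derivY_sub_vec, derivY_smul_vec, hF.derivY_self hM.isOpen hsl, ha,
      div_mul_cancel₀ _ hpos.ne'] at h1
    simp at h1
  rw [← sub_eq_zero.1 hza, hz]
  abel

/-- The coefficient of `y` in the geodesic vector. -/
noncomputable def projCoeff (F : E n → E n → ℝ) (φ : ℝ → ℝ → ℝ) (x y : E n) : ℝ :=
  ((∑ i, geodCoeff F i x y * y i) - sprayCoeff φ x y * inner ℝ x y) / ‖y‖ ^ 2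

theorem IsFinsler.smooth_projCoeff (hF : IsFinsler M F) (hM : IsSymmDomain M) (hn : 3 ≤ n)
    (hφ : IsGivenBy M F φ) : Smooth2 (generic M) (projCoeff F φ) := by
  refine ((Smooth2.sum fun i _ => ((hF.smooth_geodCoeff hM.isOpen i).mono
    generic_subset_slit).mul (smooth_coord_snd i)).sub
    ((hF.smooth_sprayCoeff hM hn hφ).mul smooth_inner)).div
    (Smooth2.of_snd (contDiff_norm_sq ℝ)) fun x y h => ?_
  exact pow_ne_zero 2 (norm_ne_zero_iff.2 h.2.2.1)

theorem IsFinsler.geodVec_eq (hF : IsFinsler M F) (hM : IsSymmDomain M) (hn : 3 ≤ n)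
    (hφ : IsGivenBy M F φ) (h : (x, y) ∈ generic M) :
    geodVec F x y = projCoeff F φ x y • y + sprayCoeff φ x y • x := by
  obtain ⟨p, hp⟩ := hF.exists_geodVec_eq hM hn hφ h
  have hy0 := norm_ne_zero_iff.2 h.2.2.1
  have h1 : ∑ i, geodCoeff F i x y * y i = inner ℝ (geodVec F x y) y := by
    simp [geodVec, PiLp.inner_apply, mul_comm]
  have h2 : projCoeff F φ x y = p := by
    rw [projCoeff, h1, hp, inner_add_left, real_inner_smul_left, real_inner_smul_left,
      real_inner_self_eq_norm_sq]
    field_simp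
    ring
  rw [h2, hp]

theorem IsFinsler.geodCoeff_eq (hF : IsFinsler M F) (hM : IsSymmDomain M) (hn : 3 ≤ n)
    (hφ : IsGivenBy M F φ) (h : (x, y) ∈ generic M) (i : Fin n) :
    geodCoeff F i x y = projCoeff F φ x y * y i + sprayCoeff φ x y * x i := by
  have := congrArg (fun v : E n => v i) (hF.geodVec_eq hM hn hφ h)
  simpa [geodVec] using this

theorem sprayCoeff_smul (φ : ℝ → ℝ → ℝ) {c : ℝ} (hc : 0 < c) (x y : E n) :
    sprayCoeff φ x (c • y) = c ^ 2 * sprayCoeff φ x y := by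
  simp only [sprayCoeff, polar, norm_smul, real_inner_smul_right, Real.norm_eq_abs, abs_of_pos hc]
  rw [mul_div_mul_left _ _ hc.ne']
  ring

theorem IsFinsler.projCoeff_smul (hF : IsFinsler M F) (hM : IsSymmDomain M)
    {c : ℝ} (hc : 0 < c) (h : (x, y) ∈ generic M) :
    projCoeff F φ x (c • y) = c ^ 1 * projCoeff F φ x y := by
  have hy0 := norm_ne_zero_iff.2 h.2.2.1
  have h1 : ∑ i, geodCoeff F i x (c • y) * (c • y) i =
      c ^ 3 * ∑ i, geodCoeff F i x y * y i := by
    rw [Finset.mul_sum]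
    refine Finset.sum_congr rfl fun i _ => ?_
    rw [hF.geodCoeff_smul hM.isOpen (generic_subset_slit h) hc, PiLp.smul_apply, smul_eq_mul]
    ring
  rw [projCoeff, projCoeff, h1, sprayCoeff_smul φ hc, norm_smul, real_inner_smul_right,
    Real.norm_eq_abs, abs_of_pos hc]
  field_simp

end Spray

/-! ### Vanishing Douglas curvature forces Q to be quadratic in s -/

section Douglas

variable {n : ℕ} {M : Set (E n)} {F : E n → E n → ℝ} {φ : ℝ → ℝ → ℝ} {x y : E n}

/-- The projectively invariant part of the geodesic coefficients. -/
noncomputable def thomasCoeff (F : E n → E n → ℝ) (i : Fin n) (x y : E n) : ℝ :=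
  geodCoeff F i x y - 1 / ((n : ℝ) + 1) * (∑ m, pdY m (geodCoeff F m) x y) * y i

theorem douglasCurv_eq (F : E n → E n → ℝ) (j i k l : Fin n) :
    douglasCurv F j i k l = pdY j (pdY k (pdY l (thomasCoeff F i))) := rfl

theorem IsFinsler.smooth_thomasCoeff (hF : IsFinsler M F) (hM : IsOpen M) (i : Fin n) :
    Smooth2 (slit M) (thomasCoeff F i) := by
  have hG := hF.smooth_geodCoeff hM
  exact (hG i).sub (((Smooth2.const _).mul (Smooth2.sum fun m _ =>
    (hG m).pdY (isOpen_slit hM) m)).mul (smooth_coord_snd i))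

theorem IsFinsler.thomasCoeff_smul (hF : IsFinsler M F) (hM : IsOpen M) (h : (x, y) ∈ slit M)
    {c : ℝ} (hc : 0 < c) (i : Fin n) :
    thomasCoeff F i x (c • y) = c ^ 2 * thomasCoeff F i x y := by
  have h1 : ∀ m, pdY m (geodCoeff F m) x (c • y) = c ^ 1 * pdY m (geodCoeff F m) x y := by
    intro m
    have hd := (hF.smooth_geodCoeff hM m).differentiableAt_snd (isOpen_slit hM) h
    refine derivY_smul_of_homog hc hd ?_ _
    filter_upwards [isOpen_compl_singleton.mem_nhds (mem_slit.1 h).2] with z hz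
    exact hF.geodCoeff_smul hM (mem_slit.2 ⟨(mem_slit.1 h).1, hz⟩) hc m
  simp only [thomasCoeff, hF.geodCoeff_smul hM h hc, h1, ← Finset.mul_sum, PiLp.smul_apply,
    smul_eq_mul]
  ring

theorem one_lt_rank (hn : 3 ≤ n) : 1 < Module.rank ℝ (E n) := by
  rw [← Module.finrank_eq_rank, finrank_euclideanSpace_fin]
  exact_mod_cast (by omega : 1 < n)

/-- The Douglas tensor is the third y-derivative, and the punctured space is connected. -/
theorem IsDouglas.exists_const (hD : IsDouglas M F) (hF : IsFinsler M F) (hM : IsOpen M)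
    (hn : 3 ≤ n) (hx : x ∈ M) (i k l : Fin n) :
    ∃ B : ℝ, ∀ y, y ≠ 0 → pdY k (pdY l (thomasCoeff F i)) x y = B := by
  have hU := isOpen_slit hM
  have hs := ((hF.smooth_thomasCoeff hM i).pdY hU l).pdY hU k
  have hd : ∀ y : E n, y ≠ 0 →
      DifferentiableAt ℝ (fun z => pdY k (pdY l (thomasCoeff F i)) x z) y := fun y hy =>
    hs.differentiableAt_snd hU (mem_slit.2 ⟨hx, hy⟩)
  obtain ⟨B, hB⟩ := isOpen_compl_singleton.exists_is_const_of_fderiv_eq_zero (𝕜 := ℝ)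
    (s := ({0}ᶜ : Set (E n)))
    (isConnected_compl_singleton_of_one_lt_rank (one_lt_rank hn) 0).isPreconnected
    (fun y hy => (hd y hy).differentiableWithinAt) (fun y hy => by
      ext v
      have : derivY v (pdY k (pdY l (thomasCoeff F i))) x y = 0 := by
        rw [← sum_mul_pdY]
        refine Finset.sum_eq_zero fun j _ => ?_
        rw [← douglasCurv_eq, hD x hx y hy, mul_zero]
      simpa [derivY] using this)
  exact ⟨B, fun y hy => hB y hy⟩

/-- Euler's relation applied twice expresses a function of degree 2 through its second derivatives,
which are constant. They are evaluated at one fixed nonzero vector, so that a symmetric bilinear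
form results. -/
theorem IsDouglas.exists_quadratic (hD : IsDouglas M F) (hF : IsFinsler M F) (hM : IsOpen M)
    (hn : 3 ≤ n) (hx : x ∈ M) (i : Fin n) (u v : E n) :
    ∃ α β γ : ℝ, ∀ a b : ℝ, a • u + b • v ≠ 0 →
      thomasCoeff F i x (a • u + b • v) = α * a ^ 2 + β * (a * b) + γ * b ^ 2 := by
  have hU := isOpen_slit hM
  have hs := hF.smooth_thomasCoeff hM i
  choose B hB using fun k l => hD.exists_const hF hM hn hx i k l
  have hz : stdVec hn 0 ≠ 0 := by
    rw [← norm_pos_iff, norm_stdVec]; exact one_pos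
  have hzm : (x, stdVec hn 0) ∈ slit M := mem_slit.2 ⟨hx, hz⟩
  set D : E n → E n → ℝ := fun u v => derivY u (derivY v (thomasCoeff F i)) x (stdVec hn 0) with hDd
  have hconst : ∀ y, y ≠ 0 → 2 * thomasCoeff F i x y = D y y := by
    intro y hy
    have h : (x, y) ∈ slit M := mem_slit.2 ⟨hx, hy⟩
    have h1 := derivY_self_of_homog (k := 2) (hs.differentiableAt_snd hU h)
      fun c hc => hF.thomasCoeff_smul hM h hc i
    have h2 := derivY_self_of_homog (k := 1) ((hs.derivY hU y).differentiableAt_snd hU h)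
      fun c hc => derivY_smul_of_homog hc (hs.differentiableAt_snd hU h) (by
        filter_upwards [isOpen_compl_singleton.mem_nhds hy] with z hz
        exact hF.thomasCoeff_smul hM (mem_slit.2 ⟨hx, hz⟩) hc i) y
    have h3 : derivY y (derivY y (thomasCoeff F i)) x y = D y y := by
      simp only [hDd]
      rw [derivY_derivY_expand hs hU h, derivY_derivY_expand hs hU hzm]
      simp only [hB _ _ _ hy, hB _ _ _ hz]
    rw [← h3, h2, h1]
    push_cast
    ring
  have hadd : ∀ u v w, D (u + v) w = D u w + D v w := fun u v w => derivY_add_vec u v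
  have hsmul : ∀ c u w, D (c • u) w = c * D u w := fun c u w => derivY_smul_vec c u
  have hcomm : ∀ u v, D u v = D v u := fun u v => hs.derivY_comm hU hzm u v
  refine ⟨D u u / 2, D u v, D v v / 2, fun a b hab => ?_⟩
  have h1 := hconst _ hab
  rw [hadd, hsmul, hsmul, hcomm u, hcomm v, hadd, hadd, hsmul, hsmul, hsmul, hsmul,
    hcomm v u] at h1
  linarith

/-- Restrict to x = r e₀ and unit y = a e₀ + b e₁. The combination of components 0 and 1 that kills
every multiple of y leaves r Q b equal to a cubic form in (a, b). Because Q depends only on a, only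
the part odd in b contributes; after division by b it is quadratic in a = s/r. -/
theorem IsDouglas.exists_Qfun_eq (hD : IsDouglas M F) (hF : IsFinsler M F) (hM : IsSymmDomain M)
    (hn : 3 ≤ n) (hφ : IsGivenBy M F φ) {r : ℝ} (hr : r ∈ radii M) :
    ∃ A B : ℝ, ∀ s, |s| < r → Qfun φ r s = A + B * s ^ 2 := by
  have hr' := (hM.mem_radii_iff hn).1 hr
  have hr0 := hr'.1
  set i₀ : Fin n := Fin.castLE hn 0
  set i₁ : Fin n := Fin.castLE hn 1
  have hi : i₀ ≠ i₁ := by simp [i₀, i₁, Fin.ext_iff]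
  obtain ⟨α, β, γ, h0⟩ := hD.exists_quadratic hF hM.isOpen hn hr'.2 i₀ (stdVec hn 0) (stdVec hn 1)
  obtain ⟨α', β', γ', h1⟩ :=
    hD.exists_quadratic hF hM.isOpen hn hr'.2 i₁ (stdVec hn 0) (stdVec hn 1)
  have key : ∀ a b : ℝ, a ^ 2 + b ^ 2 = 1 → b ≠ 0 → r * Qfun φ r (r * a) * b =
      (α * a ^ 2 + β * (a * b) + γ * b ^ 2) * b - (α' * a ^ 2 + β' * (a * b) + γ' * b ^ 2) * a := by
    intro a b hab hb
    set y := a • stdVec hn 0 + b • stdVec hn 1 with hy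
    have hny : ‖y‖ = 1 := by
      have : ‖y‖ ^ 2 = 1 := by
        rw [← real_inner_self_eq_norm_sq]
        simp only [hy, inner_add_left, inner_add_right, inner_smul_left, inner_smul_right,
          inner_stdVec]
        simp
        linarith
      nlinarith [norm_nonneg y]
    have hy0 : y ≠ 0 := by rw [← norm_pos_iff, hny]; exact one_pos
    have hnx := norm_smul_stdVec hn 0 hr0.le
    have hin : inner ℝ (r • stdVec hn 0) y = r * a := by
      simp only [hy, real_inner_smul_left, inner_add_right, inner_smul_right, inner_stdVec]
      simp [mul_comm]
    have hg : (r • stdVec hn 0, y) ∈ generic M := by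
      refine ⟨hr'.2, by rw [← norm_pos_iff, hnx]; exact hr0, hy0, ?_⟩
      simp only
      rw [hnx, hny, hin, abs_mul, abs_of_pos hr0]
      have : |a| < 1 := (sq_lt_one_iff_abs_lt_one a).1 (by nlinarith [mul_self_pos.2 hb])
      nlinarith
    have hq : sprayCoeff φ (r • stdVec hn 0) y = Qfun φ r (r * a) := by
      rw [sprayCoeff, polar, hnx, hny, hin]; simp
    have e0 := h0 a b hy0
    have e1 := h1 a b hy0
    have y0 : y i₀ = a := by simp [hy, stdVec, i₀]
    have y1 : y i₁ = b := by simp [hy, stdVec, i₁]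
    have x0 : (r • stdVec hn 0) i₀ = r := by simp [stdVec, i₀]
    have x1 : (r • stdVec hn 0) i₁ = 0 := by simp [stdVec, i₁]
    rw [thomasCoeff, hF.geodCoeff_eq hM hn hφ hg, hq] at e0 e1
    rw [y0, x0] at e0
    rw [y1, x1] at e1
    linear_combination b * e0 - a * e1
  -- These come from r Q = α a² + γ (1 - a²) - β' a² with a = s/r.
  refine ⟨γ / r, (α - β' - γ) / r ^ 3, fun s hs => ?_⟩
  set a := s / r with ha
  have has : r * a = s := mul_div_cancel₀ s hr0.ne'
  have ha1 : a ^ 2 < 1 := by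
    rw [sq_lt_one_iff_abs_lt_one, ha, abs_div, abs_of_pos hr0, div_lt_one hr0]; exact hs
  set b := √(1 - a ^ 2) with hb
  have hbpos : 0 < b := Real.sqrt_pos.2 (by linarith)
  have hbsq : b ^ 2 = 1 - a ^ 2 := Real.sq_sqrt (by linarith)
  have k1 := key a b (by rw [hbsq]; ring) hbpos.ne'
  -- Reflecting y in the first axis leaves s, hence Q, unchanged; half the difference of the two
  -- relations is the part odd in b.
  have k2 := key a (-b) (by rw [neg_sq, hbsq]; ring) (neg_ne_zero.2 hbpos.ne')
  rw [has] at k1 k2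
  have k3 : b * (r * Qfun φ r s - (α * a ^ 2 + γ * b ^ 2 - β' * a ^ 2)) = 0 := by
    linear_combination (k1 - k2) / 2
  have k4 := (mul_eq_zero.1 k3).resolve_left hbpos.ne'
  rw [hbsq] at k4
  have k5 : Qfun φ r s = (α * a ^ 2 + γ * (1 - a ^ 2) - β' * a ^ 2) / r := by
    rw [eq_div_iff hr0.ne']; linarith
  rw [k5, ha]
  field_simp
  ring

/-- `Q = a(r) + b(r) s²` with smooth coefficients. -/
structure IsQuadratic (I : Set ℝ) (Q : ℝ → ℝ → ℝ) (a b : ℝ → ℝ) : Prop where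
  smooth_left : ContDiffOn ℝ ∞ a I
  smooth_right : ContDiffOn ℝ ∞ b I
  eq : ∀ r ∈ I, ∀ s, |s| < r → Q r s = a r + b r * s ^ 2

/-- The coefficients can be read off from the values at s = 0 and s = r/2, so they inherit
smoothness from Q. -/
theorem isQuadratic_of_exists {I : Set ℝ} (hpos : ∀ r ∈ I, 0 < r) {Q : ℝ → ℝ → ℝ}
    (hQ : Smooth2 (polarDomain I) Q)
    (h : ∀ r ∈ I, ∃ A B : ℝ, ∀ s, |s| < r → Q r s = A + B * s ^ 2) :
    IsQuadratic I Q (fun r => Q r 0) (fun r => 4 * (Q r (r / 2) - Q r 0) / r ^ 2) := by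
  have h0 : ContDiffOn ℝ ∞ (fun r => Q r 0) I :=
    ContDiffOn.comp hQ (f := fun r : ℝ => (r, (0 : ℝ))) (by fun_prop)
      fun r hr => ⟨hr, by simpa using hpos r hr⟩
  have h1 : ContDiffOn ℝ ∞ (fun r => Q r (r / 2)) I :=
    ContDiffOn.comp hQ (f := fun r : ℝ => (r, r / 2)) (by fun_prop)
      fun r hr => ⟨hr, by
        have := hpos r hr
        simp only
        rw [abs_of_pos (by linarith)]
        linarith⟩
  refine ⟨h0, (contDiffOn_const.mul (h1.sub h0)).div (by fun_prop)
    fun r hr => pow_ne_zero 2 (hpos r hr).ne', fun r hr s hs => ?_⟩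
  obtain ⟨A, B, hAB⟩ := h r hr
  have hr0 := hpos r hr
  rw [hAB s hs, hAB 0 (by simpa using hr0), hAB (r / 2) (by
    rw [abs_of_pos (by linarith)]; linarith)]
  field_simp
  ring

end Douglas

/-! ### Sum and product rules for smooth functions -/

section Rules

variable {A B : Type*} [NormedAddCommGroup A] [NormedSpace ℝ A] [NormedAddCommGroup B]
  [NormedSpace ℝ B] {U : Set (A × B)} {f g : A → B → ℝ} {x : A} {y : B}

theorem Smooth2.derivX_add_eq (hf : Smooth2 U f) (hg : Smooth2 U g) (hU : IsOpen U)
    (h : (x, y) ∈ U) (v : A) : SphFinsler.derivX v (fun x y => f x y + g x y) x y =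
      SphFinsler.derivX v f x y + SphFinsler.derivX v g x y :=
  derivX_add (hf.differentiableAt_fst hU h) (hg.differentiableAt_fst hU h) v

theorem Smooth2.derivX_mul_eq (hf : Smooth2 U f) (hg : Smooth2 U g) (hU : IsOpen U)
    (h : (x, y) ∈ U) (v : A) : SphFinsler.derivX v (fun x y => f x y * g x y) x y =
      SphFinsler.derivX v f x y * g x y + f x y * SphFinsler.derivX v g x y :=
  derivX_mul (hf.differentiableAt_fst hU h) (hg.differentiableAt_fst hU h) v

theorem Smooth2.derivY_add_eq (hf : Smooth2 U f) (hg : Smooth2 U g) (hU : IsOpen U)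
    (h : (x, y) ∈ U) (v : B) : SphFinsler.derivY v (fun x y => f x y + g x y) x y =
      SphFinsler.derivY v f x y + SphFinsler.derivY v g x y :=
  derivY_add (hf.differentiableAt_snd hU h) (hg.differentiableAt_snd hU h) v

theorem Smooth2.derivY_mul_eq (hf : Smooth2 U f) (hg : Smooth2 U g) (hU : IsOpen U)
    (h : (x, y) ∈ U) (v : B) : SphFinsler.derivY v (fun x y => f x y * g x y) x y =
      SphFinsler.derivY v f x y * g x y + f x y * SphFinsler.derivY v g x y :=
  derivY_mul (hf.differentiableAt_snd hU h) (hg.differentiableAt_snd hU h) v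

end Rules

/-! ### Douglas and Riemann curvature when Q is quadratic -/

section QuadraticSpray

variable {n : ℕ} {M : Set (E n)} {F : E n → E n → ℝ} {φ : ℝ → ℝ → ℝ} {g c : ℝ → ℝ} {x y : E n}

/-- The functions met here are polynomials of degree at most 2 in y, so a derivative is the linear
coefficient along a line and can be found by `ring`. -/
theorem derivY_eq_of_line {A : Type*} {f : A → E n → ℝ} {x : A} {v : E n} {β γ : ℝ}
    (hd : DifferentiableAt ℝ (fun z => f x z) y)
    (h : ∀ t : ℝ, f x (y + t • v) = f x y + β * t + γ * t ^ 2) : derivY v f x y = β := by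
  have h1 : HasDerivAt (fun t : ℝ => y + t • v) v 0 := by
    simpa using ((hasDerivAt_id (0 : ℝ)).smul_const v).const_add y
  have hd' : HasFDerivAt (fun z => f x z) (fderiv ℝ (fun z => f x z) y) (y + (0 : ℝ) • v) := by
    simpa using hd.hasFDerivAt
  have h2 := hd'.comp_hasDerivAt 0 h1
  have h3 : HasDerivAt (fun t : ℝ => f x y + β * t + γ * t ^ 2) β 0 := by
    have := (((hasDerivAt_id (0 : ℝ)).const_mul β).const_add (f x y)).add
      ((hasDerivAt_pow 2 (0 : ℝ)).const_mul γ)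
    refine (this.congr_deriv (by simp)).congr_of_eventuallyEq ?_
    exact Filter.Eventually.of_forall fun t => rfl
  exact h2.unique (h3.congr_of_eventuallyEq (Filter.Eventually.of_forall h))

theorem smooth_radial (hg : ContDiffOn ℝ ∞ g (radii M)) :
    Smooth2 (generic M) fun x _ => g ‖x‖ :=
  ContDiffOn.comp hg (smooth_norm_fst (M := M)) fun _ hp => norm_mem_radii hp.1 hp.2.1

theorem derivX_radial (hI : IsOpen (radii M)) (hg : ContDiffOn ℝ ∞ g (radii M))
    (h : (x, y) ∈ generic M) (v : E n) :
    derivX v (fun x (_ : E n) => g ‖x‖) x y = deriv g ‖x‖ * (inner ℝ x v / ‖x‖) := by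
  have hd : HasDerivAt g (deriv g ‖x‖) ‖x‖ :=
    (((hg.contDiffAt (hI.mem_nhds (norm_mem_radii h.1 h.2.1))).differentiableAt
      (by simp))).hasDerivAt
  have := (hd.comp_hasFDerivAt x (hasFDerivAt_norm' h.2.1)).fderiv
  simp only [Function.comp_def] at this
  rw [derivX, this]
  simp only [_root_.smul_apply, innerSL_apply_apply, smul_eq_mul]
  ring

theorem differentiableAt_inner_fst (v : E n) : DifferentiableAt ℝ (fun z : E n => inner ℝ z v) x :=
  differentiableAt_id.inner ℝ (differentiableAt_const v)

theorem differentiableAt_inner_snd (v : E n) : DifferentiableAt ℝ (fun z : E n => inner ℝ v z) x :=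
  (differentiableAt_const v).inner ℝ differentiableAt_id

/-- The quadratic form `g(|x|) |y|² + c(|x|) ⟨x, y⟩²`. -/
noncomputable def quadSpray (g c : ℝ → ℝ) (x y : E n) : ℝ :=
  g ‖x‖ * inner ℝ y y + c ‖x‖ * inner ℝ x y ^ 2

/-- The fibre derivative of `quadSpray`. -/
noncomputable def quadSprayY (g c : ℝ → ℝ) (v : E n) (x y : E n) : ℝ :=
  g ‖x‖ * (2 * inner ℝ y v) + c ‖x‖ * (2 * (inner ℝ x y * inner ℝ x v))

theorem differentiableAt_quadSpray (g c : ℝ → ℝ) (x y : E n) :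
    DifferentiableAt ℝ (fun z => quadSpray g c x z) y :=
  ((differentiableAt_id.inner ℝ differentiableAt_id).const_mul _).add
    (((differentiableAt_inner_snd x).pow 2).const_mul _)

theorem differentiableAt_quadSprayY (g c : ℝ → ℝ) (v x y : E n) :
    DifferentiableAt ℝ (fun z => quadSprayY g c v x z) y :=
  (((differentiableAt_inner_fst v).const_mul _).const_mul _).add
    ((((differentiableAt_inner_snd x).mul_const _).const_mul _).const_mul _)

theorem derivY_quadSpray (v : E n) : derivY v (quadSpray g c) x y = quadSprayY g c v x y := by
  refine derivY_eq_of_line (γ := quadSpray g c x v) ?_ fun t => ?_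
  · exact differentiableAt_quadSpray g c x y
  · simp only [quadSpray, quadSprayY, inner_add_left, inner_add_right, real_inner_smul_left,
      real_inner_smul_right, real_inner_comm y v]
    ring

theorem derivY_quadSprayY (u v : E n) : derivY u (quadSprayY g c v) x y =
    g ‖x‖ * (2 * inner ℝ u v) + c ‖x‖ * (2 * (inner ℝ x u * inner ℝ x v)) := by
  refine derivY_eq_of_line (γ := 0) ?_ fun t => ?_
  · exact differentiableAt_quadSprayY g c v x y
  · simp only [quadSprayY, inner_add_left, inner_add_right, real_inner_smul_left,
      real_inner_smul_right]
    ring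

theorem derivX_inner_self (v : E n) :
    derivX v (fun x y : E n => (inner ℝ x y : ℝ)) x y = inner ℝ v y := derivX_inner (y := y) v y

theorem derivX_quadSpray (hI : IsOpen (radii M)) (hM : IsOpen M)
    (hg : ContDiffOn ℝ ∞ g (radii M)) (hc : ContDiffOn ℝ ∞ c (radii M))
    (h : (x, y) ∈ generic M) (v : E n) : derivX v (quadSpray g c) x y =
      deriv g ‖x‖ * (inner ℝ x v / ‖x‖) * inner ℝ y y +
        (deriv c ‖x‖ * (inner ℝ x v / ‖x‖) * inner ℝ x y ^ 2 +
          c ‖x‖ * (2 * (inner ℝ x y * inner ℝ v y))) := by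
  have hU := isOpen_generic hM
  have s1 := smooth_radial (n := n) hg
  have s2 := smooth_radial (n := n) hc
  have s3 : Smooth2 (generic M) (fun _ y : E n => (inner ℝ y y : ℝ)) :=
    Smooth2.of_snd (contDiff_id.inner ℝ contDiff_id)
  have s4 := smooth_inner (U := generic M)
  have e : quadSpray (n := n) g c = fun x y => g ‖x‖ * inner ℝ y y +
      c ‖x‖ * (inner ℝ x y * inner ℝ x y) := by
    funext x y; rw [quadSpray, sq]
  rw [e, (s1.mul s3).derivX_add_eq (s2.mul (s4.mul s4)) hU h, s1.derivX_mul_eq s3 hU h,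
    s2.derivX_mul_eq (s4.mul s4) hU h, s4.derivX_mul_eq s4 hU h,
    derivX_of_snd (fun y : E n => (inner ℝ y y : ℝ)), derivX_inner_self, derivX_radial hI hg h,
    derivX_radial hI hc h]
  ring

theorem derivX_quadSprayY (hI : IsOpen (radii M)) (hM : IsOpen M)
    (hg : ContDiffOn ℝ ∞ g (radii M)) (hc : ContDiffOn ℝ ∞ c (radii M))
    (h : (x, y) ∈ generic M) (u v : E n) : derivX u (quadSprayY g c v) x y =
      deriv g ‖x‖ * (inner ℝ x u / ‖x‖) * (2 * inner ℝ y v) +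
        (deriv c ‖x‖ * (inner ℝ x u / ‖x‖) * (2 * (inner ℝ x y * inner ℝ x v)) +
          c ‖x‖ * (2 * (inner ℝ u y * inner ℝ x v + inner ℝ x y * inner ℝ u v))) := by
  have hU := isOpen_generic hM
  have s1 := smooth_radial (n := n) hg
  have s2 := (Smooth2.const (U := generic M) 2).mul (smooth_radial (n := n) hc)
  have s3 : Smooth2 (generic M) (fun _ y : E n => 2 * (inner ℝ y v : ℝ)) :=
    (Smooth2.const 2).mul (Smooth2.of_snd (contDiff_id.inner ℝ contDiff_const))
  have s4 := smooth_inner (U := generic M)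
  have s5 := smooth_inner_fst (U := generic M) v
  have e : quadSprayY (n := n) g c v = fun x y => g ‖x‖ * (2 * inner ℝ y v) +
      (2 * c ‖x‖) * (inner ℝ x y * inner ℝ x v) := by
    funext x y; rw [quadSprayY]; ring
  rw [e, (s1.mul s3).derivX_add_eq (s2.mul (s4.mul s5)) hU h, s1.derivX_mul_eq s3 hU h,
    s2.derivX_mul_eq (s4.mul s5) hU h, s4.derivX_mul_eq s5 hU h,
    (Smooth2.const (U := generic M) 2).derivX_mul_eq (smooth_radial (n := n) hc) hU h,
    derivX_of_snd (fun y : E n => 2 * (inner ℝ y v : ℝ)), derivX_inner_self, derivX_inner,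
    derivX_of_snd (fun _ : E n => (2 : ℝ)), derivX_radial hI hg h, derivX_radial hI hc h]
  ring

theorem IsQuadratic.sprayCoeff_eq (hq : IsQuadratic (radii M) (Qfun φ) g c)
    (h : (x, y) ∈ generic M) : sprayCoeff φ x y = quadSpray g c x y := by
  have hn := norm_ne_zero_iff.2 h.2.2.1
  have hp := polar_mem h
  rw [sprayCoeff, polar, hq.eq _ hp.1 _ hp.2, quadSpray, real_inner_self_eq_norm_sq]
  field_simp

theorem IsQuadratic.smooth_quadSpray (hq : IsQuadratic (radii M) (Qfun φ) g c) :
    Smooth2 (generic M) (quadSpray (n := n) g c) :=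
  ((smooth_radial hq.smooth_left).mul (Smooth2.of_snd (contDiff_id.inner ℝ contDiff_id))).add
    ((smooth_radial hq.smooth_right).mul (smooth_inner.pow 2))

theorem IsQuadratic.geodCoeff_eq (hq : IsQuadratic (radii M) (Qfun φ) g c) (hF : IsFinsler M F)
    (hM : IsSymmDomain M) (hn : 3 ≤ n) (hφ : IsGivenBy M F φ) (h : (x, y) ∈ generic M)
    (i : Fin n) :
    geodCoeff F i x y = projCoeff F φ x y * y i + quadSpray g c x y * x i := by
  rw [hF.geodCoeff_eq hM hn hφ h, hq.sprayCoeff_eq h]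

theorem IsQuadratic.derivY_geodCoeff (hq : IsQuadratic (radii M) (Qfun φ) g c)
    (hF : IsFinsler M F) (hM : IsSymmDomain M) (hn : 3 ≤ n) (hφ : IsGivenBy M F φ)
    (h : (x, y) ∈ generic M) (v : E n) (i : Fin n) :
    derivY v (geodCoeff F i) x y = derivY v (projCoeff F φ) x y * y i + projCoeff F φ x y * v i +
      quadSprayY g c v x y * x i := by
  have hU := isOpen_generic hM.isOpen
  have hp := hF.smooth_projCoeff hM hn hφ
  have hQ := hq.smooth_quadSpray
  rw [derivY_congr hU (fun x y h => hq.geodCoeff_eq hF hM hn hφ h i) h,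
    derivY_add ((hp.mul (smooth_coord_snd i)).differentiableAt_snd hU h)
      ((hQ.mul (smooth_coord_fst i)).differentiableAt_snd hU h),
    derivY_mul (hp.differentiableAt_snd hU h) ((smooth_coord_snd i).differentiableAt_snd hU h),
    derivY_mul (hQ.differentiableAt_snd hU h) ((smooth_coord_fst i).differentiableAt_snd hU h),
    derivY_coord, derivY_of_fst (fun x : E n => x i), derivY_quadSpray]
  ring

theorem IsQuadratic.smooth_quadSprayY (hq : IsQuadratic (radii M) (Qfun φ) g c) (v : E n) :
    Smooth2 (generic M) (quadSprayY (n := n) g c v) :=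
  ((smooth_radial hq.smooth_left).mul ((Smooth2.const 2).mul
    (Smooth2.of_snd (contDiff_id.inner ℝ contDiff_const)))).add
    ((smooth_radial hq.smooth_right).mul ((Smooth2.const 2).mul
      (smooth_inner.mul (smooth_inner_fst v))))

/-- A spherically symmetric metric with quadratic `Q` is a Douglas metric. -/
theorem IsQuadratic.isDouglas (hq : IsQuadratic (radii M) (Qfun φ) g c) (hF : IsFinsler M F)
    (hM : IsSymmDomain M) (hn : 3 ≤ n) (hφ : IsGivenBy M F φ) : IsDouglas M F := by
  intro x hx y hy j i k l
  have hU := isOpen_slit hM.isOpen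
  have hV := isOpen_generic hM.isOpen
  have hs : Smooth2 (slit M) (douglasCurv F j i k l) := by
    rw [douglasCurv_eq]
    exact (((hF.smooth_thomasCoeff hM.isOpen i).pdY hU l).pdY hU k).pdY hU j
  refine eq_on_slit_of_generic hn (f := douglasCurv F j i k l) (g := fun _ _ => 0) hU subset_rfl
    (fun x y h => hs.continuousAt hU h) (fun _ _ _ => continuousAt_const) ?_
    (mem_slit.2 ⟨hx, hy⟩)
  intro x y _ h
  set κ : ℝ := 1 / ((n : ℝ) + 1) with hκ
  have hκ1 : κ * ((n : ℝ) + 1) = 1 := one_div_mul_cancel (by positivity)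
  -- The trace of ∂G/∂y is (n + 1) P plus the derivative of |y|² Q in the direction x; dividing by n
  -- + 1 and subtracting removes P. What is left is a quadratic polynomial in y, whose third
  -- derivatives vanish.
  have h0 : ∀ x y, (x, y) ∈ generic M → thomasCoeff F i x y =
      quadSpray g c x y * x i - κ * quadSprayY g c x x y * y i := by
    intro x y h
    have hp1 : derivY y (projCoeff F φ) x y = projCoeff F φ x y := by
      have := derivY_self_of_homog (k := 1)
        ((hF.smooth_projCoeff hM hn hφ).differentiableAt_snd hV h)
        fun c hc => hF.projCoeff_smul hM hc h
      simpa using this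
    have h1 : ∑ m, pdY m (geodCoeff F m) x y =
        ((n : ℝ) + 1) * projCoeff F φ x y + quadSprayY g c x x y := by
      simp only [pdY_eq, hq.derivY_geodCoeff hF hM hn hφ h]
      rw [Finset.sum_add_distrib, Finset.sum_add_distrib]
      have e1 : ∑ m, derivY (EuclideanSpace.single m 1) (projCoeff F φ) x y * y m =
          projCoeff F φ x y := by
        rw [← hp1, ← sum_mul_pdY]
        exact Finset.sum_congr rfl fun m _ => mul_comm _ _
      have e2 : ∑ m, quadSprayY g c (EuclideanSpace.single m 1) x y * x m =
          quadSprayY g c x x y := by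
        rw [← derivY_quadSpray, ← sum_mul_pdY]
        refine Finset.sum_congr rfl fun m _ => ?_
        rw [pdY_eq, derivY_quadSpray, mul_comm]
      rw [e1, e2]
      simp
      ring
    rw [thomasCoeff, h1, hq.geodCoeff_eq hF hM hn hφ h, ← hκ]
    linear_combination (-projCoeff F φ x y * y i) * hκ1
  have h1 : ∀ v x y, (x, y) ∈ generic M → derivY v (thomasCoeff F i) x y =
      quadSprayY g c v x y * x i -
        κ * ((g ‖x‖ + c ‖x‖ * inner ℝ x x) * 2) * (inner ℝ x v * y i + inner ℝ x y * v i) := by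
    intro v x y h
    rw [derivY_congr hV h0 h]
    refine derivY_eq_of_line (γ := quadSpray g c x v * x i -
      κ * ((g ‖x‖ + c ‖x‖ * inner ℝ x x) * 2) * (inner ℝ x v * v i)) ?_ fun t => ?_
    · have hy : DifferentiableAt ℝ (fun z : E n => z i) y := by fun_prop
      exact ((differentiableAt_quadSpray g c x y).mul_const _).sub
        (((differentiableAt_quadSprayY g c x x y).const_mul κ).mul hy)
    · simp only [quadSpray, quadSprayY, inner_add_left, inner_add_right, real_inner_smul_left,
        real_inner_smul_right, real_inner_comm y v, real_inner_comm x y, real_inner_comm x v,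
        PiLp.add_apply, PiLp.smul_apply, smul_eq_mul]
      ring
  have h2 : ∀ u v x y, (x, y) ∈ generic M → derivY u (derivY v (thomasCoeff F i)) x y =
      (g ‖x‖ * (2 * inner ℝ u v) + c ‖x‖ * (2 * (inner ℝ x u * inner ℝ x v))) * x i -
        κ * ((g ‖x‖ + c ‖x‖ * inner ℝ x x) * 2) * (inner ℝ x v * u i + inner ℝ x u * v i) := by
    intro u v x y h
    rw [derivY_congr hV (h1 v) h]
    refine derivY_eq_of_line (γ := 0) ?_ fun t => ?_
    · have hy : DifferentiableAt ℝ (fun z : E n => z i) y := by fun_prop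
      exact ((differentiableAt_quadSprayY g c v x y).mul_const _).sub
        (((hy.const_mul _).add ((differentiableAt_inner_snd x).mul_const _)).const_mul _)
    · simp only [quadSprayY, inner_add_left, inner_add_right, real_inner_smul_left,
        real_inner_smul_right, PiLp.add_apply, PiLp.smul_apply, smul_eq_mul]
      ring
  rw [douglasCurv_eq, pdY_eq, pdY_eq, pdY_eq, derivY_congr hV (h2 _ _) h]
  exact derivY_of_fst (fun x : E n => (g ‖x‖ * (2 * inner ℝ (EuclideanSpace.single k (1 : ℝ))
    (EuclideanSpace.single l (1 : ℝ))) + c ‖x‖ * (2 * (inner ℝ x (EuclideanSpace.single k (1 : ℝ)) *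
      inner ℝ x (EuclideanSpace.single l (1 : ℝ))))) * x i -
        κ * ((g ‖x‖ + c ‖x‖ * inner ℝ x x) * 2) *
          (inner ℝ x (EuclideanSpace.single l (1 : ℝ)) * (EuclideanSpace.single k (1 : ℝ) : E n) i +
            inner ℝ x (EuclideanSpace.single k (1 : ℝ)) *
              (EuclideanSpace.single l (1 : ℝ) : E n) i)) _

/-- The obstruction to scalar flag curvature. -/
noncomputable def flagDefect (g c : ℝ → ℝ) (r : ℝ) : ℝ :=
  2 * deriv g r / r - 2 * c r + 4 * g r ^ 2 + 4 * g r * c r * r ^ 2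

/-- The Riemann curvature of a spherically symmetric metric with quadratic `Q`. -/
theorem IsQuadratic.riemApply_eq (hq : IsQuadratic (radii M) (Qfun φ) g c) (hF : IsFinsler M F)
    (hM : IsSymmDomain M) (hn : 3 ≤ n) (hφ : IsGivenBy M F φ) (h : (x, y) ∈ generic M) :
    ∃ ξ : ℝ, ∀ u, ∃ τ : ℝ, riemApply F x y u = ξ • u + τ • y +
      (flagDefect g c ‖x‖ * (inner ℝ y y * inner ℝ x u - inner ℝ x y * inner ℝ y u)) • x := by
  have hU := isOpen_generic hM.isOpen
  have hI := hM.isOpen_radii hn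
  have hp := hF.smooth_projCoeff hM hn hφ
  have hQ := hq.smooth_quadSpray
  have hx0 := norm_ne_zero_iff.2 h.2.1
  set p := projCoeff F φ x y with hpd
  set q := quadSpray g c x y with hqd
  set G := geodVec F x y with hGd
  refine ⟨2 * q - derivX y (projCoeff F φ) x y + 2 * derivY G (projCoeff F φ) x y - p ^ 2,
    fun u => ?_⟩
  set W := connVec F x y u with hWd
  refine ⟨2 * derivX u (projCoeff F φ) x y - derivX y (derivY u (projCoeff F φ)) x y -
    quadSprayY g c u x y + 2 * derivY G (derivY u (projCoeff F φ)) x y +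
    2 * derivY u (projCoeff F φ) x y * p - derivY W (projCoeff F φ) x y -
    p * derivY u (projCoeff F φ) x y, ?_⟩
  have hG : G = p • y + q • x := by
    rw [hGd, hF.geodVec_eq hM hn hφ h, hq.sprayCoeff_eq h]
  have hW : W = derivY u (projCoeff F φ) x y • y + p • u + quadSprayY g c u x y • x := by
    ext i
    simp only [hWd, connVec, PiLp.add_apply, PiLp.smul_apply, smul_eq_mul]
    exact hq.derivY_geodCoeff hF hM hn hφ h u i
  have hpu := hp.derivY hU u
  have hQu := hq.smooth_quadSprayY (n := n) u
  have d1 : ∀ i, derivX u (geodCoeff F i) x y =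
      derivX u (projCoeff F φ) x y * y i + derivX u (quadSpray g c) x y * x i + q * u i := by
    intro i
    rw [derivX_congr hU (fun x y h => hq.geodCoeff_eq hF hM hn hφ h i) h,
      (hp.mul (smooth_coord_snd i)).derivX_add_eq (hQ.mul (smooth_coord_fst i)) hU h,
      hp.derivX_mul_eq (smooth_coord_snd i) hU h, hQ.derivX_mul_eq (smooth_coord_fst i) hU h,
      derivX_coord, derivX_of_snd (fun y : E n => y i)]
    ring
  have d2 : ∀ i, derivX y (derivY u (geodCoeff F i)) x y =
      derivX y (derivY u (projCoeff F φ)) x y * y i + derivX y (projCoeff F φ) x y * u i +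
        derivX y (quadSprayY g c u) x y * x i + quadSprayY g c u x y * y i := by
    intro i
    rw [derivX_congr hU (fun x y h => hq.derivY_geodCoeff hF hM hn hφ h u i) h,
      ((hpu.mul (smooth_coord_snd i)).add (hp.mul (Smooth2.const (u i)))).derivX_add_eq
        (hQu.mul (smooth_coord_fst i)) hU h,
      (hpu.mul (smooth_coord_snd i)).derivX_add_eq (hp.mul (Smooth2.const (u i))) hU h,
      hpu.derivX_mul_eq (smooth_coord_snd i) hU h, hp.derivX_mul_eq (Smooth2.const (u i)) hU h,
      hQu.derivX_mul_eq (smooth_coord_fst i) hU h,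
      derivX_coord, derivX_of_snd (fun y : E n => y i), derivX_of_snd (fun _ : E n => u i)]
    ring
  have d3 : ∀ i, derivY G (derivY u (geodCoeff F i)) x y =
      derivY G (derivY u (projCoeff F φ)) x y * y i + derivY u (projCoeff F φ) x y * G i +
        derivY G (projCoeff F φ) x y * u i +
        (g ‖x‖ * (2 * inner ℝ G u) + c ‖x‖ * (2 * (inner ℝ x G * inner ℝ x u))) * x i := by
    intro i
    rw [derivY_congr hU (fun x y h => hq.derivY_geodCoeff hF hM hn hφ h u i) h,
      ((hpu.mul (smooth_coord_snd i)).add (hp.mul (Smooth2.const (u i)))).derivY_add_eq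
        (hQu.mul (smooth_coord_fst i)) hU h,
      (hpu.mul (smooth_coord_snd i)).derivY_add_eq (hp.mul (Smooth2.const (u i))) hU h,
      hpu.derivY_mul_eq (smooth_coord_snd i) hU h, hp.derivY_mul_eq (Smooth2.const (u i)) hU h,
      hQu.derivY_mul_eq (smooth_coord_fst i) hU h,
      derivY_coord, derivY_of_fst (fun x : E n => x i), derivY_of_fst (fun _ : E n => u i),
      derivY_quadSprayY]
    ring
  have d4 := hq.derivY_geodCoeff hF hM hn hφ h W
  ext i
  rw [hF.riemApply_apply hM.isOpen (generic_subset_slit h), ← hGd, ← hWd, d1, d2, d3, d4]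
  simp only [PiLp.add_apply, PiLp.smul_apply, smul_eq_mul]
  have hGi : G i = p * y i + q * x i := by rw [hG]; simp
  have hWi : W i = derivY u (projCoeff F φ) x y * y i + p * u i + quadSprayY g c u x y * x i := by
    rw [hW]; simp
  -- The total coefficient of x. Its terms containing P and the y-derivative of P cancel, so only
  -- the quadratic form and its derivatives survive.
  have key : 2 * derivX u (quadSpray g c) x y - derivX y (quadSprayY g c u) x y +
      2 * (derivY u (projCoeff F φ) x y * q + (g ‖x‖ * (2 * inner ℝ G u) +
        c ‖x‖ * (2 * (inner ℝ x G * inner ℝ x u)))) - p * quadSprayY g c u x y -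
      quadSprayY g c W x y = flagDefect g c ‖x‖ *
        (inner ℝ y y * inner ℝ x u - inner ℝ x y * inner ℝ y u) := by
    rw [derivX_quadSpray hI hM.isOpen hq.smooth_left hq.smooth_right h,
      derivX_quadSprayY hI hM.isOpen hq.smooth_left hq.smooth_right h, hG, hW, hqd]
    simp only [quadSpray, quadSprayY, flagDefect, inner_add_left, inner_add_right,
      real_inner_smul_left, real_inner_smul_right, real_inner_comm x y, real_inner_comm y u]
    rw [real_inner_self_eq_norm_sq x]
    field_simp
    ring
  rw [← key, hGi, hWi]
  ring

end QuadraticSpray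

/-! ### Scalar flag curvature as an equation for the coefficients of Q -/

section FlagCurvature

variable {n : ℕ} {M : Set (E n)} {F : E n → E n → ℝ} {φ : ℝ → ℝ → ℝ} {g c : ℝ → ℝ} {x y : E n}

theorem IsFinsler.innerAt_add_left (hF : IsFinsler M F) (hM : IsOpen M) (h : (x, y) ∈ slit M)
    (u v w : E n) : innerAt F x y (u + v) w = innerAt F x y u w + innerAt F x y v w := by
  simp only [innerAt_eq hF.smooth2 (isOpen_slit hM) h, derivY_add_vec]
  ring

theorem IsFinsler.innerAt_smul_left (hF : IsFinsler M F) (hM : IsOpen M) (h : (x, y) ∈ slit M)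
    (t : ℝ) (u w : E n) : innerAt F x y (t • u) w = t * innerAt F x y u w := by
  simp only [innerAt_eq hF.smooth2 (isOpen_slit hM) h, derivY_smul_vec]
  ring

theorem IsFinsler.innerAt_comm (hF : IsFinsler M F) (hM : IsOpen M) (h : (x, y) ∈ slit M)
    (u v : E n) : innerAt F x y u v = innerAt F x y v u := by
  simp only [innerAt_eq hF.smooth2 (isOpen_slit hM) h]
  rw [hF.smooth2.derivY_comm (isOpen_slit hM) h]
  ring

/-- The Gram determinant equals F³ times the y-Hessian of F at (u, u). -/
theorem IsFinsler.gram_pos (hF : IsFinsler M F) (hM : IsOpen M) (h : (x, y) ∈ slit M)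
    {u : E n} (hu : ∀ t : ℝ, u ≠ t • y) :
    0 < innerAt F x y y y * innerAt F x y u u - innerAt F x y y u ^ 2 := by
  have hpos := hF.pos hM h
  have h1 := hF.derivY_derivY_pos hM h hu
  rw [hF.innerAt_comm hM h y u, hF.innerAt_self hM h, hF.innerAt_self hM h, hF.derivY_self hM h,
    innerAt_eq hF.smooth2 (isOpen_slit hM) h]
  have : 0 < F x y ^ 3 * derivY u (derivY u F) x y := by positivity
  linarith

/-- Orthogonality of R_y(u) to y is a linear relation between ξ, τ and b; it eliminates τ from
g_y(R_y(u), u). -/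
theorem IsFinsler.flagCurv_eq (hF : IsFinsler M F) (hM : IsOpen M) (h : (x, y) ∈ slit M)
    {u : E n} (hu : ∀ t : ℝ, u ≠ t • y) {ξ τ b : ℝ}
    (hR : riemApply F x y u = ξ • u + τ • y + b • x) :
    F x y ^ 2 * flagCurv F x y u = ξ + b * (F x y ^ 2 * innerAt F x y x u -
      innerAt F x y x y * innerAt F x y u y) /
      (innerAt F x y y y * innerAt F x y u u - innerAt F x y y u ^ 2) := by
  have hpos := hF.pos hM h
  have hΔ := hF.gram_pos hM h hu
  have h1 : innerAt F x y (riemApply F x y u) y = 0 := by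
    rw [hF.innerAt_self hM h, hF.derivY_riemApply hM h, mul_zero]
  have hyy : innerAt F x y y y = F x y ^ 2 := by
    rw [hF.innerAt_self hM h, hF.derivY_self hM h, sq]
  rw [flagCurv]
  rw [hR, hF.innerAt_add_left hM h, hF.innerAt_add_left hM h, hF.innerAt_smul_left hM h,
    hF.innerAt_smul_left hM h, hF.innerAt_smul_left hM h, hyy] at h1
  rw [hR, hF.innerAt_add_left hM h, hF.innerAt_add_left hM h, hF.innerAt_smul_left hM h,
    hF.innerAt_smul_left hM h, hF.innerAt_smul_left hM h]
  rw [hyy] at hΔ ⊢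
  rw [hF.innerAt_comm hM h u y] at h1 ⊢
  rw [← mul_div_assoc, div_eq_iff hΔ.ne', add_mul, div_mul_cancel₀ _ hΔ.ne']
  linear_combination (innerAt F x y y u) * h1

theorem notParallel_of_linearIndependent {y u : E n} (h : LinearIndependent ℝ ![y, u]) (t : ℝ) :
    u ≠ t • y := fun he => by
  have := (LinearIndependent.pair_iff.1 h) t (-1) (by rw [he]; simp)
  simp at this

/-- Take y orthogonal to x and compare two flags. For u orthogonal to both, the x-term is absent and
F² K = ξ; for u = x it contributes the defect times r². The first flag needs a third dimension. -/
theorem IsQuadratic.flagDefect_eq_zero (hq : IsQuadratic (radii M) (Qfun φ) g c)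
    (hF : IsFinsler M F) (hM : IsSymmDomain M) (hn : 3 ≤ n) (hφ : IsGivenBy M F φ)
    (hK : HasScalarFlagCurv M F) {r : ℝ} (hr : r ∈ radii M) : flagDefect g c r = 0 := by
  obtain ⟨K, hK⟩ := hK
  have hr' := (hM.mem_radii_iff hn).1 hr
  have hr0 := hr'.1
  set x : E n := r • stdVec hn 0 with hx
  set y : E n := stdVec hn 1 with hy
  have hnx : ‖x‖ = r := norm_smul_stdVec hn 0 hr0.le
  have hny : ‖y‖ = 1 := norm_stdVec hn 1
  have hxy : inner ℝ x y = (0 : ℝ) := by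
    rw [hx, hy, real_inner_smul_left, inner_stdVec]; simp
  have h : (x, y) ∈ generic M := by
    refine ⟨hr'.2, by rw [← norm_pos_iff, hnx]; exact hr0,
      by rw [← norm_pos_iff, hny]; exact one_pos, ?_⟩
    simp only
    rw [hxy, hnx, hny]
    simpa using hr0
  have hsl := generic_subset_slit h
  have hF0 := hF.pos hM.isOpen hsl
  obtain ⟨ξ, hξ⟩ := hq.riemApply_eq hF hM hn hφ h
  have hindep : ∀ u : E n, u ≠ 0 → inner ℝ y u = (0 : ℝ) → LinearIndependent ℝ ![y, u] := by
    intro u hu hyu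
    rw [LinearIndependent.pair_iff]
    intro s t hst
    have h1 := congrArg (fun z => (inner ℝ y z : ℝ)) hst
    simp only [inner_add_right, real_inner_smul_right, hyu, real_inner_self_eq_norm_sq, hny,
      inner_zero_right] at h1
    have hs : s = 0 := by linarith
    rw [hs, zero_smul, zero_add] at hst
    exact ⟨hs, (smul_eq_zero.1 hst).resolve_right hu⟩
  have hz0 : stdVec hn 2 ≠ 0 := by rw [← norm_pos_iff, norm_stdVec]; exact one_pos
  have i1 := hindep (stdVec hn 2) hz0 (by rw [hy, inner_stdVec]; simp)
  have i2 := hindep x h.2.1 (by rw [real_inner_comm]; exact hxy)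
  obtain ⟨τ₁, h1⟩ := hξ (stdVec hn 2)
  obtain ⟨τ₂, h2⟩ := hξ x
  have e1 := hF.flagCurv_eq hM.isOpen hsl (notParallel_of_linearIndependent i1) h1
  have e2 := hF.flagCurv_eq hM.isOpen hsl (notParallel_of_linearIndependent i2) h2
  rw [hK x h.1 y _ i1] at e1
  rw [hK x h.1 y _ i2] at e2
  have hx2 : inner ℝ x (stdVec hn 2) = (0 : ℝ) := by
    rw [hx, real_inner_smul_left, inner_stdVec]; simp
  have hΔ := hF.gram_pos hM.isOpen hsl (notParallel_of_linearIndependent i2)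
  have hyy : innerAt F x y y y = F x y ^ 2 := by
    rw [hF.innerAt_self hM.isOpen hsl, hF.derivY_self hM.isOpen hsl, sq]
  rw [hyy, hF.innerAt_comm hM.isOpen hsl y x] at hΔ
  rw [hyy, hF.innerAt_comm hM.isOpen hsl y x, ← sq, mul_div_assoc, div_self hΔ.ne', hxy,
    hnx, real_inner_self_eq_norm_sq, real_inner_self_eq_norm_sq, hnx, hny] at e2
  rw [hx2, hxy] at e1
  simp only [mul_zero, zero_mul, sub_zero, zero_div, add_zero] at e1
  have e3 : flagDefect g c r * r ^ 2 = 0 := by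
    rw [e1] at e2
    linarith
  exact (mul_eq_zero.1 e3).resolve_right (pow_ne_zero 2 hr0.ne')

theorem IsFinsler.smooth_riemCurv (hF : IsFinsler M F) (hM : IsOpen M) (i k : Fin n) :
    Smooth2 (slit M) (riemCurv F i k) := by
  have hU := isOpen_slit hM
  have hG := hF.smooth_geodCoeff hM
  exact ((((Smooth2.const 2).mul ((hG i).pdX hU k)).sub
    (Smooth2.sum fun j _ => (smooth_coord_snd j).mul (((hG i).pdY hU k).pdX hU j))).add
    ((Smooth2.const 2).mul (Smooth2.sum fun j _ => (hG j).mul (((hG i).pdY hU k).pdY hU j)))).sub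
    (Smooth2.sum fun j _ => ((hG i).pdY hU j).mul ((hG j).pdY hU k))

theorem IsFinsler.smooth_innerAt (hF : IsFinsler M F) (hM : IsOpen M) {u v : E n → E n → E n}
    (hu : ∀ i, Smooth2 (slit M) fun x y => u x y i)
    (hv : ∀ i, Smooth2 (slit M) fun x y => v x y i) :
    Smooth2 (slit M) fun x y => innerAt F x y (u x y) (v x y) :=
  Smooth2.sum fun i _ => Smooth2.sum fun j _ =>
    ((hF.smooth2.fundTensor (isOpen_slit hM) i j).mul (hu i)).mul (hv j)

theorem IsFinsler.continuousAt_flagCurv (hF : IsFinsler M F) (hM : IsOpen M)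
    (h : (x, y) ∈ slit M) {u : E n} (hu : ∀ t : ℝ, u ≠ t • y) :
    ContinuousAt (fun p : E n × E n => flagCurv F p.1 p.2 u) (x, y) := by
  have hU := isOpen_slit hM
  have hc : ∀ v : E n, ∀ i, Smooth2 (slit M) fun _ _ => v i := fun v i => Smooth2.const _
  have hR : ∀ i, Smooth2 (slit M) fun x y => riemApply F x y u i := fun i => by
    have : Smooth2 (slit M) fun x y => ∑ k, riemCurv F i k x y * u k :=
      Smooth2.sum fun k _ => (hF.smooth_riemCurv hM i k).mul (Smooth2.const _)
    exact this
  have hyu : Smooth2 (slit M) fun x y => innerAt F x y y u ^ 2 :=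
    ContDiffOn.pow (hF.smooth_innerAt hM smooth_coord_snd (hc u)) 2
  refine ContinuousAt.div ((hF.smooth_innerAt hM hR (hc u)).continuousAt hU h) ?_
    (hF.gram_pos hM h hu).ne'
  exact (((hF.smooth_innerAt hM smooth_coord_snd smooth_coord_snd).mul
    (hF.smooth_innerAt hM (hc u) (hc u))).sub
    hyu).continuousAt hU h

/-- At generic points the x-term vanishes and F² K = ξ for every edge. -/
theorem IsQuadratic.hasScalarFlagCurv (hq : IsQuadratic (radii M) (Qfun φ) g c)
    (hF : IsFinsler M F) (hM : IsSymmDomain M) (hn : 3 ≤ n) (hφ : IsGivenBy M F φ)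
    (h0 : ∀ r ∈ radii M, flagDefect g c r = 0) : HasScalarFlagCurv M F := by
  have key : ∀ x ∈ M, ∀ y u v, LinearIndependent ℝ ![y, u] → LinearIndependent ℝ ![y, v] →
      flagCurv F x y u = flagCurv F x y v := by
    intro x hx y u v hu hv
    have hU := isOpen_slit hM.isOpen
    have hy : y ≠ 0 := by simpa using hu.ne_zero 0
    have hu0 : u ≠ 0 := by simpa using hu.ne_zero 1
    have hv0 : v ≠ 0 := by simpa using hv.ne_zero 1
    have hclosed : ∀ w : E n, IsOpen {p : E n × E n | p.2 ∉ Submodule.span ℝ {w}} := fun w =>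
      (Submodule.closed_of_finiteDimensional _).isOpen_compl.preimage continuous_snd
    have hnot : ∀ {y w : E n}, w ≠ 0 → y ∉ Submodule.span ℝ {w} → ∀ t : ℝ, w ≠ t • y := by
      intro y w hw hyw t ht
      refine hyw (Submodule.mem_span_singleton.2 ⟨t⁻¹, ?_⟩)
      have ht0 : t ≠ 0 := fun h => hw (by rw [ht, h, zero_smul])
      rw [ht, inv_smul_smul₀ ht0]
    have hmem : ∀ {w : E n}, w ≠ 0 → LinearIndependent ℝ ![y, w] → y ∉ Submodule.span ℝ {w} := by
      intro w hw hyw hm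
      obtain ⟨t, ht⟩ := Submodule.mem_span_singleton.1 hm
      have := (LinearIndependent.pair_iff.1 hyw) 1 (-t) (by rw [← ht]; simp)
      simp at this
    -- The edges u and v stay fixed while (x, y) moves. They remain transverse to y on an open set,
    -- where both flag curvatures are continuous and generic points are dense.
    refine eq_on_slit_of_generic hn (M := M) (f := fun x y => flagCurv F x y u)
      (g := fun x y => flagCurv F x y v)
      (V := slit M ∩ ({p | p.2 ∉ Submodule.span ℝ {u}} ∩ {p | p.2 ∉ Submodule.span ℝ {v}}))
      (hU.inter ((hclosed u).inter (hclosed v))) Set.inter_subset_left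
      (fun x y h => hF.continuousAt_flagCurv hM.isOpen h.1 (hnot hu0 h.2.1))
      (fun x y h => hF.continuousAt_flagCurv hM.isOpen h.1 (hnot hv0 h.2.2)) ?_
      ⟨mem_slit.2 ⟨hx, hy⟩, hmem hu0 hu, hmem hv0 hv⟩
    intro x y hV h
    obtain ⟨ξ, hξ⟩ := hq.riemApply_eq hF hM hn hφ h
    obtain ⟨τ₁, h1⟩ := hξ u
    obtain ⟨τ₂, h2⟩ := hξ v
    have e1 := hF.flagCurv_eq hM.isOpen hV.1 (hnot hu0 hV.2.1) h1
    have e2 := hF.flagCurv_eq hM.isOpen hV.1 (hnot hv0 hV.2.2) h2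
    rw [h0 _ (norm_mem_radii h.1 h.2.1)] at e1 e2
    simp only [zero_mul, zero_div, add_zero] at e1 e2
    exact mul_left_cancel₀ (pow_ne_zero 2 (hF.pos hM.isOpen hV.1).ne') (e1.trans e2.symm)
  classical
  -- K uses an arbitrary edge; the default 0 occurs only where no flag exists.
  refine ⟨fun x y => if h : ∃ u, LinearIndependent ℝ ![y, u] then flagCurv F x y h.choose else 0,
    fun x hx y u hu => ?_⟩
  have h : ∃ u, LinearIndependent ℝ ![y, u] := ⟨u, hu⟩
  simp only [h, dif_pos]
  exact key x hx y _ _ hu h.choose_spec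

end FlagCurvature

/-! ### Characteristics of the equation Q = a + b s² -/

section Characteristics

variable {I : Set ℝ} {φ : ℝ → ℝ → ℝ} {g c T Tb : ℝ → ℝ} {r s : ℝ}

/-- The function `w = r² - s²` along the characteristic on which `Tb - T / w = Z`. -/
noncomputable def charW (T Tb : ℝ → ℝ) (Z r : ℝ) : ℝ := T r / (Tb r - Z)

/-- The function `s` along the characteristic on which `Tb - T / w = Z`. -/
noncomputable def charS (T Tb : ℝ → ℝ) (σ Z r : ℝ) : ℝ := σ * √(r ^ 2 - charW T Tb Z r)

/-- The equation w' = 4 r w (a + b (r² - w)) is of Bernoulli type. With (log T)' = 4 r a + 4 r³ b it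
becomes (T/w)' = 4 r b T = Tb', so Tb - T/w is a first integral. -/
theorem hasDerivAt_charW {a b Z : ℝ} (hT : HasDerivAt T (T r * (4 * r * a + 4 * r ^ 3 * b)) r)
    (hTb : HasDerivAt Tb (4 * r * b * T r) r) (hZ : Tb r - Z ≠ 0) :
    HasDerivAt (charW T Tb Z)
      (4 * r * charW T Tb Z r * (a + b * (r ^ 2 - charW T Tb Z r))) r := by
  refine (hT.div (hTb.sub_const Z) hZ).congr_deriv ?_
  rw [charW]
  field_simp
  ring

theorem charS_sq {σ Z : ℝ} (hσ : σ ^ 2 = 1) (h : charW T Tb Z r < r ^ 2) :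
    charS T Tb σ Z r ^ 2 = r ^ 2 - charW T Tb Z r := by
  rw [charS, mul_pow, hσ, one_mul, Real.sq_sqrt (by linarith)]

theorem charS_mem {σ Z : ℝ} (hσ : σ ^ 2 = 1) (hr : r ∈ I) (hr0 : 0 < r)
    (h0 : 0 < charW T Tb Z r) (h : charW T Tb Z r < r ^ 2) :
    (r, charS T Tb σ Z r) ∈ polarDomain I :=
  ⟨hr, abs_lt_of_sq_lt_sq (by rw [charS_sq hσ h]; linarith) hr0.le⟩

theorem charS_ne_zero {σ Z : ℝ} (hσ : σ ^ 2 = 1) (h : charW T Tb Z r < r ^ 2) :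
    charS T Tb σ Z r ≠ 0 := fun h0 => by
  have := charS_sq hσ h
  rw [h0] at this
  linarith

/-- The derivative of `√w ψ` along a characteristic. -/
theorem hasDerivAt_along_char (hI : IsOpen I) (hφ : Smooth2 (polarDomain I) φ) (hr : r ∈ I)
    (hr0 : 0 < r) {a b Z σ : ℝ} (hT : HasDerivAt T (T r * (4 * r * a + 4 * r ^ 3 * b)) r)
    (hTb : HasDerivAt Tb (4 * r * b * T r) r) (hZ : Tb r - Z ≠ 0) (hσ : σ ^ 2 = 1)
    (h0 : 0 < charW T Tb Z r) (h : charW T Tb Z r < r ^ 2) :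
    HasDerivAt (fun r => √(charW T Tb Z r) * legendre φ r (charS T Tb σ Z r))
      (√(charW T Tb Z r) * (r * (2 * (a + b * charS T Tb σ Z r ^ 2) *
        radialHess φ r (charS T Tb σ Z r) - sprayNum φ r (charS T Tb σ Z r)))) r := by
  have hD := isOpen_polarDomain hI
  have hmem := charS_mem (I := I) hσ hr hr0 h0 h
  have hw := hasDerivAt_charW hT hTb hZ
  have hs0 := charS_ne_zero hσ h
  have hs2 := charS_sq hσ h
  have hs : HasDerivAt (charS T Tb σ Z) ((2 * r - 4 * r * charW T Tb Z r *
      (a + b * (r ^ 2 - charW T Tb Z r))) / (2 * charS T Tb σ Z r)) r := by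
    have h1 := (((hasDerivAt_pow 2 r).sub hw).sqrt (by
      simp only [Pi.sub_apply]; linarith)).const_mul σ
    refine HasDerivAt.congr_deriv h1 ?_
    have hq : √(r ^ 2 - charW T Tb Z r) ≠ 0 := (Real.sqrt_pos.2 (by linarith)).ne'
    have hσ0 : σ ≠ 0 := fun h => by rw [h] at hσ; norm_num at hσ
    simp only [charS, Pi.sub_apply]
    field_simp
    rw [hσ]
    push_cast
    ring
  have h1 := (hφ.legendre hD).hasDerivAt_comp hD (hasDerivAt_id r) hs hmem
  have h2 := (hw.sqrt h0.ne').mul h1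
  refine h2.congr_deriv ?_
  simp only [id]
  rw [hφ.ds_legendre hD hmem, hφ.dr_legendre hD hmem]
  generalize hse : charS T Tb σ Z r = S at *
  generalize charW T Tb Z r = w at *
  have hq : √w ≠ 0 := (Real.sqrt_pos.2 h0).ne'
  have hww : √w * √w = w := Real.mul_self_sqrt h0.le
  have e : r ^ 2 - w = S ^ 2 := hs2.symm
  have e' : r ^ 2 - S ^ 2 = w := by linarith
  rw [radialHess, sprayNum, e, e']
  generalize legendre φ r S = ψ
  generalize ds (ds φ) r S = A
  -- The contribution of (√w)' ψ, with the square root cleared.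
  have k1 : 4 * r * w * (a + b * S ^ 2) / (2 * √w) * ψ =
      √w * (2 * r * (a + b * S ^ 2) * ψ) := by
    rw [div_mul_eq_mul_div, div_eq_iff (by positivity)]
    linear_combination (-4 * r * (a + b * S ^ 2) * ψ) * hww
  rw [k1]
  field_simp
  ring

theorem IsTPair.hasDerivAt_g (hp : IsTPair I g T Tb) (hI : IsOpen I) (hr : r ∈ I) :
    HasDerivAt g (deriv g r) r :=
  (hp.diff_g.differentiableAt (hI.mem_nhds hr)).hasDerivAt

theorem IsTPair.eventually_uFun_ne (hp : IsTPair I g T Tb) (hI : IsOpen I) (hr : r ∈ I)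
    (hu : uFun g r ≠ 0) : ∀ᶠ t in nhds r, t ∈ I ∧ uFun g t ≠ 0 := by
  have hc : ContinuousAt (uFun g) r := by
    have := (hp.hasDerivAt_g hI hr).continuousAt
    unfold uFun
    fun_prop
  exact (hI.eventually_mem hr).and (hc.eventually_ne hu)

/-- The exponential formula for T amounts to (log T)' = 4 r g + 4 r³ b with b = (g' + 2 r g²) / (r
u), the form needed along characteristics. -/
theorem IsTPair.hasDerivAt_T (hp : IsTPair I g T Tb) (hI : IsOpen I) (hr : r ∈ I) (hr0 : 0 < r)
    (hu : uFun g r ≠ 0) : HasDerivAt T (T r * (4 * r * g r + 4 * r ^ 3 *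
      ((deriv g r + 2 * r * g r ^ 2) / (r * uFun g r)))) r := by
  obtain ⟨e, he⟩ := hp.eq_T
  have h1 : T =ᶠ[nhds r] fun t => Real.exp (-e t) / uFun g t ^ 2 := by
    filter_upwards [hp.eventually_uFun_ne hI hr hu] with t ht using (he t ht.1 ht.2).2
  have hg := hp.hasDerivAt_g hI hr
  have hu' : HasDerivAt (uFun g) (-(4 * r * g r + 2 * r ^ 2 * deriv g r)) r := by
    have := (((hasDerivAt_pow 2 r).const_mul 2).mul hg).const_sub 1
    refine this.congr_deriv ?_
    push_cast
    ring
  have h2 := ((he r hr hu).1.neg.exp).div (hu'.pow 2) (pow_ne_zero 2 hu)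
  refine (h2.congr_of_eventuallyEq h1).congr_deriv ?_
  rw [(he r hr hu).2]
  simp only [Pi.neg_apply, Pi.pow_apply]
  have e1 : 2 * r ^ 2 * g r = 1 - uFun g r := by rw [uFun]; ring
  have e2 : g r = (1 - uFun g r) / (2 * r ^ 2) := by
    rw [eq_div_iff (by positivity)]; linarith
  generalize uFun g r = u at *
  rw [e2]
  push_cast
  field_simp
  ring

theorem IsTPair.hasDerivAt_Tb (hp : IsTPair I g T Tb) (hr : r ∈ I) (hr0 : 0 < r)
    (hu : uFun g r ≠ 0) : HasDerivAt Tb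
      (4 * r * ((deriv g r + 2 * r * g r ^ 2) / (r * uFun g r)) * T r) r := by
  refine (hp.eq_Tb r hr hu).congr_deriv ?_
  field_simp

end Characteristics

/-! ### The stated form implies that Q is quadratic and the curvature equation holds -/

section Form

variable {I : Set ℝ} {φ J : ℝ → ℝ → ℝ} {g T Tb h ηp ηm : ℝ → ℝ} {r s : ℝ}

/-- `η(varphi) = √(r² - s²) (φ - s φ_s)`. -/
def EtaRepresents (I : Set ℝ) (φ : ℝ → ℝ → ℝ) (ηp ηm T Tb : ℝ → ℝ) : Prop :=
  ∀ r ∈ I, ∀ s, 0 < |s| → |s| < r →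
    etaComp ηp ηm T Tb r s = √(r ^ 2 - s ^ 2) * legendre φ r s

theorem sq_sub_sq_pos (hs : |s| < r) : 0 < r ^ 2 - s ^ 2 := by
  have := sq_lt_sq' (neg_lt_of_abs_lt hs) (lt_of_abs_lt hs)
  linarith

theorem eventually_abs_pos_lt (h0 : 0 < |s|) (hs : |s| < r) :
    ∀ᶠ t in nhds s, 0 < |t| ∧ |t| < r :=
  (continuous_abs.continuousAt.eventually (lt_mem_nhds h0)).and
    (continuous_abs.continuousAt.eventually (gt_mem_nhds hs))

/-- Differentiate φ/s = h - J in s: the function h drops out and ψ = s² J_s. -/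
theorem HasForm.etaRepresents (hf : HasForm I φ g T Tb h ηp ηm J) (hI : IsOpen I)
    (hφ : Smooth2 (polarDomain I) φ) : EtaRepresents I φ ηp ηm T Tb := by
  intro r hr s h0 hs
  have hs0 : s ≠ 0 := abs_pos.1 h0
  have hw := sq_sub_sq_pos hs
  have h1 := (hasDerivAt_id s).mul ((hf.primitive r hr s h0 hs).const_sub (h r))
  have h2 : (fun t => φ r t) =ᶠ[nhds s] (id * fun t => h r - J r t) := by
    filter_upwards [eventually_abs_pos_lt h0 hs] with t ht
    exact hf.formula r hr t ht.1 ht.2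
  have h3 := (h1.congr_of_eventuallyEq h2).unique
    (hφ.hasDerivAt_ds (isOpen_polarDomain hI) ⟨hr, hs⟩)
  have hq : √(r ^ 2 - s ^ 2) ≠ 0 := (Real.sqrt_pos.2 hw).ne'
  rw [legendre, ← h3, hf.formula r hr s h0 hs]
  simp only [id]
  field_simp
  ring

/-- From η = √w ψ and ψ_s = -s φ_ss one gets -(√w/s) ∂_s η = ψ + w φ_ss = H and η/√w = ψ. -/
theorem EtaRepresents.etaPositive_iff (he : EtaRepresents I φ ηp ηm T Tb) (hI : IsOpen I)
    (hφ : Smooth2 (polarDomain I) φ) : EtaPositive I ηp ηm T Tb ↔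
      ∀ r ∈ I, ∃ c : ℝ, 0 < c ∧ ∀ s, 0 < |s| → |s| < r →
        c ≤ radialHess φ r s ∧ c ≤ legendre φ r s := by
  have hD := isOpen_polarDomain hI
  have key : ∀ r ∈ I, ∀ s, 0 < |s| → |s| < r →
      -√(r ^ 2 - s ^ 2) / s * ds (etaComp ηp ηm T Tb) r s = radialHess φ r s ∧
      etaComp ηp ηm T Tb r s / √(r ^ 2 - s ^ 2) = legendre φ r s := by
    intro r hr s h0 hs
    have hs0 : s ≠ 0 := abs_pos.1 h0
    have hw := sq_sub_sq_pos hs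
    have hq : √(r ^ 2 - s ^ 2) ≠ 0 := (Real.sqrt_pos.2 hw).ne'
    have hqq : √(r ^ 2 - s ^ 2) ^ 2 = r ^ 2 - s ^ 2 := Real.sq_sqrt hw.le
    have hmem : (r, s) ∈ polarDomain I := ⟨hr, hs⟩
    have h1 : HasDerivAt (fun t => √(r ^ 2 - t ^ 2)) (-s / √(r ^ 2 - s ^ 2)) s := by
      have := ((hasDerivAt_pow 2 s).const_sub (r ^ 2)).sqrt hw.ne'
      refine this.congr_deriv ?_
      push_cast
      field_simp
    have h2 := h1.mul ((hφ.legendre hD).hasDerivAt_ds hD hmem)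
    have h3 : (fun t => etaComp ηp ηm T Tb r t) =ᶠ[nhds s]
        ((fun t => √(r ^ 2 - t ^ 2)) * fun t => legendre φ r t) := by
      filter_upwards [eventually_abs_pos_lt h0 hs] with t ht
      exact he r hr t ht.1 ht.2
    have h4 : ds (etaComp ηp ηm T Tb) r s = _ := (h2.congr_of_eventuallyEq h3).deriv
    rw [h4, hφ.ds_legendre hD hmem, he r hr s h0 hs, mul_div_cancel_left₀ _ hq, radialHess]
    refine ⟨?_, rfl⟩
    generalize √(r ^ 2 - s ^ 2) = q at *
    rw [← hqq]
    field_simp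
    ring
  constructor
  · intro h r hr
    obtain ⟨c, hc, h1⟩ := h r hr
    refine ⟨c, hc, fun s h0 hs => ?_⟩
    have := h1 s h0 hs
    rwa [(key r hr s h0 hs).1, (key r hr s h0 hs).2] at this
  · intro h r hr
    obtain ⟨c, hc, h1⟩ := h r hr
    refine ⟨c, hc, fun s h0 hs => ?_⟩
    rw [(key r hr s h0 hs).1, (key r hr s h0 hs).2]
    exact h1 s h0 hs

theorem varphi_charS {σ Z : ℝ} (hσ : σ ^ 2 = 1) (hT : 0 < T r)
    (h0 : 0 < charW T Tb Z r) (h : charW T Tb Z r < r ^ 2) :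
    varphi T Tb r (charS T Tb σ Z r) = 1 / Z := by
  have h1 : r ^ 2 - charS T Tb σ Z r ^ 2 = charW T Tb Z r := by rw [charS_sq hσ h]; ring
  have hZ : Tb r - Z ≠ 0 := fun h2 => by rw [charW, h2, div_zero] at h0; exact lt_irrefl _ h0
  have h2 : charW T Tb Z r * Tb r - T r = charW T Tb Z r * Z := by
    rw [charW]; field_simp; ring
  rw [varphi, h1, h2, ← mul_div_mul_left 1 Z h0.ne', mul_one]

theorem etaComp_charS {σ Z : ℝ} (hσ : σ = 1 ∨ σ = -1) (hT : 0 < T r)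
    (h0 : 0 < charW T Tb Z r) (h : charW T Tb Z r < r ^ 2) :
    etaComp ηp ηm T Tb r (charS T Tb σ Z r) = if σ = 1 then ηp (1 / Z) else ηm (1 / Z) := by
  have hpos : 0 < √(r ^ 2 - charW T Tb Z r) := Real.sqrt_pos.2 (by linarith)
  rcases hσ with rfl | rfl
  · rw [etaComp, varphi_charS (by norm_num) hT h0 h, if_pos (by rw [charS]; linarith), if_pos rfl]
  · rw [etaComp, varphi_charS (by norm_num) hT h0 h, if_neg (by rw [charS]; linarith),
      if_neg (by norm_num)]

/-- Follow the characteristic through (r, s). On it varphi is constant, so √w ψ = η(varphi) is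
constant, and `hasDerivAt_along_char` turns the vanishing derivative into the value of Q. No
derivative of η is taken. -/
theorem HasForm.Qfun_eq (hf : HasForm I φ g T Tb h ηp ηm J) (hI : IsOpen I)
    (hpos : ∀ r ∈ I, 0 < r) (hφ : Smooth2 (polarDomain I) φ) (hr : r ∈ I) (hu : uFun g r ≠ 0)
    (h0 : 0 < |s|) (hs : |s| < r) (hH : 0 < radialHess φ r s) :
    Qfun φ r s = g r + (deriv g r + 2 * r * g r ^ 2) / (r * uFun g r) * s ^ 2 := by
  have hp := hf.pair
  have hr0 := hpos r hr
  have hs0 : s ≠ 0 := abs_pos.1 h0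
  have hw := sq_sub_sq_pos hs
  have hT0 := hp.pos_T r hr
  have hdT := hp.hasDerivAt_T hI hr hr0 hu
  have hdTb := hp.hasDerivAt_Tb hr hr0 hu
  set b := (deriv g r + 2 * r * g r ^ 2) / (r * uFun g r)
  -- The parameter of the characteristic through the given point; σ below is the sign of s.
  set Z := Tb r - T r / (r ^ 2 - s ^ 2) with hZ
  have hTbZ : Tb r - Z = T r / (r ^ 2 - s ^ 2) := by rw [hZ]; ring
  have hTbZ0 : 0 < Tb r - Z := by rw [hTbZ]; positivity
  have hW : charW T Tb Z r = r ^ 2 - s ^ 2 := by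
    rw [charW, hTbZ]; field_simp
  have hs2 : 0 < s ^ 2 := by positivity
  obtain ⟨σ, hσ, hσs⟩ : ∃ σ : ℝ, (σ = 1 ∨ σ = -1) ∧ σ * |s| = s := by
    rcases le_total 0 s with h | h
    · exact ⟨1, Or.inl rfl, by rw [abs_of_nonneg h, one_mul]⟩
    · exact ⟨-1, Or.inr rfl, by rw [abs_of_nonpos h]; ring⟩
  have hσ2 : σ ^ 2 = 1 := by rcases hσ with rfl | rfl <;> norm_num
  have hS : charS T Tb σ Z r = s := by
    rw [charS, hW, show r ^ 2 - (r ^ 2 - s ^ 2) = s ^ 2 by ring, Real.sqrt_sq_eq_abs, hσs]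
  have h1 := hasDerivAt_along_char hI hφ hr hr0 hdT hdTb hTbZ0.ne' hσ2 (by rw [hW]; exact hw)
    (by rw [hW]; linarith)
  have hcW : ContinuousAt (charW T Tb Z) r := (hasDerivAt_charW hdT hdTb hTbZ0.ne').continuousAt
  have hev : ∀ᶠ t in nhds r, t ∈ I ∧ 0 < charW T Tb Z t ∧ charW T Tb Z t < t ^ 2 := by
    refine (hI.eventually_mem hr).and ((hcW.eventually (lt_mem_nhds (by rw [hW]; exact hw))).and ?_)
    exact hcW.eventually_lt (by fun_prop) (by rw [hW]; linarith)
  have he := hf.etaRepresents hI hφ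
  have h2 : (fun t => √(charW T Tb Z t) * legendre φ t (charS T Tb σ Z t)) =ᶠ[nhds r]
      fun _ => if σ = 1 then ηp (1 / Z) else ηm (1 / Z) := by
    filter_upwards [hev] with t ht
    have ht0 := hpos t ht.1
    have hm := charS_mem (I := I) hσ2 ht.1 ht0 ht.2.1 ht.2.2
    rw [← etaComp_charS hσ (hp.pos_T t ht.1) ht.2.1 ht.2.2,
      he t ht.1 _ (abs_pos.2 (charS_ne_zero hσ2 ht.2.2)) hm.2, charS_sq hσ2 ht.2.2,
      sub_sub_cancel]
  have h3 := (h1.congr_of_eventuallyEq h2.symm).unique (hasDerivAt_const r _)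
  rw [hS, hW] at h3
  have h4 := (mul_eq_zero.1 h3).resolve_left (Real.sqrt_pos.2 hw).ne'
  have h5 := (mul_eq_zero.1 h4).resolve_left hr0.ne'
  rw [SphFinsler.Qfun_eq, div_eq_iff (by positivity)]
  linarith

/-- The formula for Q is known only where s ≠ 0 and u ≠ 0. The coefficients are redefined through
the smooth function Q, and continuity carries both the formula and the curvature equation across s =
0 and across the zero of u. -/
theorem HasForm.exists_isQuadratic (hf : HasForm I φ g T Tb h ηp ηm J) (hI : IsOpen I)
    (hpos : ∀ r ∈ I, 0 < r) (hφ : Smooth2 (polarDomain I) φ)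
    (hQ : Smooth2 (polarDomain I) (Qfun φ))
    (hH : ∀ r s, (r, s) ∈ polarDomain I → 0 < radialHess φ r s) :
    ∃ a b : ℝ → ℝ, IsQuadratic I (Qfun φ) a b ∧ ∀ r ∈ I, flagDefect a b r = 0 := by
  have hD := isOpen_polarDomain hI
  have dense_ne : ∀ t : ℝ, Dense ({t}ᶜ : Set ℝ) := fun t => dense_compl_singleton t
  have h1 : ∀ r ∈ I, uFun g r ≠ 0 → ∀ s, |s| < r → Qfun φ r s =
      g r + (deriv g r + 2 * r * g r ^ 2) / (r * uFun g r) * s ^ 2 := by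
    intro r hr hu s hs
    have hc : ContinuousAt (fun t => Qfun φ r t) s :=
      (hQ.differentiableAt_snd hD (x := r) ⟨hr, hs⟩).continuousAt
    refine eq_of_dense (dense_ne 0) (g := fun s => g r + (deriv g r + 2 * r * g r ^ 2) /
      (r * uFun g r) * s ^ 2) hc (by fun_prop) ?_
    filter_upwards [continuous_abs.continuousAt.eventually (gt_mem_nhds hs)] with t ht ht0
    exact hf.Qfun_eq hI hpos hφ hr hu (abs_pos.2 ht0) ht (hH r t ⟨hr, ht⟩)
  set a : ℝ → ℝ := fun r => Qfun φ r 0 with ha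
  set b : ℝ → ℝ := fun r => 4 * (Qfun φ r (r / 2) - Qfun φ r 0) / r ^ 2 with hb
  have hmem0 : ∀ r ∈ I, (r, (0 : ℝ)) ∈ polarDomain I := fun r hr => ⟨hr, by simpa using hpos r hr⟩
  have hmem2 : ∀ r ∈ I, |r / 2| < r := fun r hr => by
    have := hpos r hr
    rw [abs_of_pos (by linarith)]
    linarith
  have hab : ∀ r ∈ I, uFun g r ≠ 0 → a r = g r ∧
      b r = (deriv g r + 2 * r * g r ^ 2) / (r * uFun g r) := by
    intro r hr hu
    have hr0 := hpos r hr
    simp only [ha, hb]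
    rw [h1 r hr hu 0 (hmem0 r hr).2, h1 r hr hu (r / 2) (hmem2 r hr)]
    constructor
    · ring
    · field_simp
      ring
  have hcr : ∀ r ∈ I, ∀ s, |s| < r → ContinuousAt (fun t => Qfun φ t s) r := fun r hr s hs =>
    (hQ.differentiableAt_fst hD (y := s) ⟨hr, hs⟩).continuousAt
  have hca : ∀ r ∈ I, ContinuousAt a r := fun r hr => hcr r hr 0 (hmem0 r hr).2
  have hcb : ∀ r ∈ I, ContinuousAt b r := by
    intro r hr
    have hc2 : ContinuousAt (fun t => Qfun φ t (t / 2)) r := by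
      have := hQ.continuousAt hD (x := r) (y := r / 2) ⟨hr, hmem2 r hr⟩
      exact ContinuousAt.comp (f := fun t : ℝ => (t, t / 2)) this (by fun_prop)
    exact (continuousAt_const.mul (hc2.sub (hca r hr))).div (by fun_prop)
      (pow_ne_zero 2 (hpos r hr).ne')
  -- As u has at most one zero, it is nonzero on a punctured neighbourhood of every point.
  have hne : ∀ r ∈ I, ∀ᶠ t in nhds r, t ∈ ({r}ᶜ : Set ℝ) → t ∈ I ∧ uFun g t ≠ 0 := by
    intro r hr
    by_cases hu : uFun g r = 0
    · filter_upwards [hI.mem_nhds hr] with t ht htr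
      exact ⟨ht, fun h0 => htr (hf.pair.zero ⟨ht, h0⟩ ⟨hr, hu⟩)⟩
    · filter_upwards [hf.pair.eventually_uFun_ne hI hr hu] with t ht _ using ht
  have hquad : ∀ r ∈ I, ∀ s, |s| < r → Qfun φ r s = a r + b r * s ^ 2 := by
    intro r hr s hs
    refine eq_of_dense (dense_ne r) (f := fun t => Qfun φ t s) (g := fun t => a t + b t * s ^ 2)
      (hcr r hr s hs) ((hca r hr).add ((hcb r hr).mul continuousAt_const)) ?_
    filter_upwards [hne r hr, lt_mem_nhds hs] with t ht hst htr
    obtain ⟨htI, htu⟩ := ht htr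
    rw [h1 t htI htu s hst, (hab t htI htu).1, (hab t htI htu).2]
  have hq := isQuadratic_of_exists hpos hQ fun r hr => ⟨a r, b r, hquad r hr⟩
  refine ⟨a, b, hq, fun r hr => ?_⟩
  have hca' : ContinuousAt (deriv a) r :=
    ((hq.smooth_left.continuousOn_deriv_of_isOpen hI (by simp)).continuousAt (hI.mem_nhds hr))
  refine eq_of_dense (dense_ne r) (f := flagDefect a b) (g := fun _ => 0) ?_ continuousAt_const ?_
  · have := hca r hr
    have := hcb r hr
    have hr0 := (hpos r hr).ne'
    unfold flagDefect
    fun_prop (disch := assumption)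
  · filter_upwards [hne r hr] with t ht htr
    obtain ⟨htI, htu⟩ := ht htr
    have hd : deriv a t = deriv g t := by
      refine Filter.EventuallyEq.deriv_eq ?_
      filter_upwards [hf.pair.eventually_uFun_ne hI htI htu] with t' ht'
      exact (hab t' ht'.1 ht'.2).1
    have ht0 := hpos t htI
    rw [flagDefect, hd, (hab t htI htu).1, (hab t htI htu).2]
    have e : uFun g t = 1 - 2 * t ^ 2 * g t := rfl
    have htu' := htu
    rw [e] at htu' ⊢
    field_simp
    ring

end Form

/-! ### Construction of T and Tb from a solution of the curvature equation -/

section PairConstruction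

variable {I : Set ℝ} {a b : ℝ → ℝ} {r : ℝ}

theorem exists_smooth_primitive (hI : IsOpen I) (hc : I.OrdConnected) {k : ℝ → ℝ}
    (hk : ContDiffOn ℝ ∞ k I) :
    ∃ K : ℝ → ℝ, ContDiffOn ℝ ∞ K I ∧ ∀ r ∈ I, HasDerivAt K (k r) r := by
  rcases I.eq_empty_or_nonempty with rfl | ⟨r₀, hr₀⟩
  · exact ⟨0, contDiffOn_const, fun r hr => hr.elim⟩
  have hd : ∀ r ∈ I, HasDerivAt (fun r => ∫ t in r₀..r, k t) (k r) r := by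
    intro r hr
    have hsub : Set.uIcc r₀ r ⊆ I := hc.uIcc_subset hr₀ hr
    exact intervalIntegral.integral_hasDerivAt_right
      ((hk.continuousOn.mono hsub).intervalIntegrable)
      (hk.continuousOn.stronglyMeasurableAtFilter hI r hr)
      (hk.continuousOn.continuousAt (hI.mem_nhds hr))
  refine ⟨_, ?_, hd⟩
  rw [contDiffOn_infty_iff_deriv_of_isOpen hI]
  exact ⟨fun r hr => (hd r hr).differentiableAt.differentiableWithinAt,
    hk.congr fun r hr => (hd r hr).deriv⟩

/-- The data `T`, `Tb` attached to a solution `a`, `b` of the curvature equation, together with the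
strictly decreasing function `Y = √T u / r`. -/
structure SolvedPair (I : Set ℝ) (a b T Tb Y : ℝ → ℝ) : Prop where
  pair : IsTPair I a T Tb
  smooth_T : ContDiffOn ℝ ∞ T I
  smooth_Tb : ContDiffOn ℝ ∞ Tb I
  deriv_T : ∀ r ∈ I, HasDerivAt T (T r * (4 * r * a r + 4 * r ^ 3 * b r)) r
  deriv_Tb : ∀ r ∈ I, HasDerivAt Tb (4 * r * b r * T r) r
  deriv_Y : ∀ r ∈ I, HasDerivAt Y (-√(T r) / r ^ 2) r
  eq_Y : ∀ r ∈ I, Y r = √(T r) * uFun a r / r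
  eq_Tb : ∀ r ∈ I, Tb r - T r / r ^ 2 = -1 - Y r ^ 2

theorem curvature_eq (h : flagDefect a b r = 0) (hr : 0 < r) :
    b r * r * uFun a r = deriv a r + 2 * r * a r ^ 2 := by
  rw [flagDefect] at h
  field_simp at h
  rw [uFun]
  linarith

/-- The curvature equation r b u = a' + 2 r a² cancels the denominators u: it gives (log T)' = 4 r a
+ 4 r³ b and integrates Tb to 4 T (a - r² a²) plus a constant. Both are thus smooth across a zero of
u. -/
theorem exists_solvedPair (hI : IsOpen I) (hc : I.OrdConnected) (hpos : ∀ r ∈ I, 0 < r)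
    (ha : ContDiffOn ℝ ∞ a I) (hb : ContDiffOn ℝ ∞ b I) (h0 : ∀ r ∈ I, flagDefect a b r = 0) :
    ∃ T Tb Y : ℝ → ℝ, SolvedPair I a b T Tb Y := by
  obtain ⟨K, hKs, hK⟩ := exists_smooth_primitive hI hc
    (k := fun r => 4 * r * a r + 4 * r ^ 3 * b r)
    (((contDiffOn_const.mul contDiffOn_id).mul ha).add
      ((contDiffOn_const.mul (contDiffOn_id.pow 3)).mul hb))
  have hda : ∀ r ∈ I, HasDerivAt a (deriv a r) r := fun r hr =>
    ((ha.contDiffAt (hI.mem_nhds hr)).differentiableAt (by simp)).hasDerivAt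
  set T : ℝ → ℝ := fun r => Real.exp (K r) with hT
  -- With the constant -1 one has Tb - T/r² = -1 - Y² < -1, which keeps the denominator of varphi
  -- negative and 1/varphi below -1.
  set Tb : ℝ → ℝ := fun r => 4 * (T r * (a r - r ^ 2 * a r ^ 2)) - 1 with hTb
  set Y : ℝ → ℝ := fun r => Real.exp (K r / 2) * (r⁻¹ - 2 * (r * a r)) with hY
  have hsq : ∀ r, √(T r) = Real.exp (K r / 2) := fun r => by
    rw [hT, Real.sqrt_eq_iff_mul_self_eq (Real.exp_pos _).le (Real.exp_pos _).le, ← Real.exp_add,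
      add_halves]
  have hu : ∀ r ∈ I, HasDerivAt (uFun a) (-(4 * r * a r + 2 * r ^ 2 * deriv a r)) r := by
    intro r hr
    have := (((hasDerivAt_pow 2 r).const_mul 2).mul (hda r hr)).const_sub 1
    refine this.congr_deriv ?_
    push_cast
    ring
  have hdT : ∀ r ∈ I, HasDerivAt T (T r * (4 * r * a r + 4 * r ^ 3 * b r)) r :=
    fun r hr => (hK r hr).exp
  have hTs : ContDiffOn ℝ ∞ T I := hKs.exp
  have hTbs : ContDiffOn ℝ ∞ Tb I :=
    (contDiffOn_const.mul (hTs.mul (ha.sub ((contDiffOn_id.pow 2).mul (ha.pow 2))))).sub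
      contDiffOn_const
  have hode : ∀ r ∈ I, b r * r * uFun a r = deriv a r + 2 * r * a r ^ 2 := fun r hr =>
    curvature_eq (h0 r hr) (hpos r hr)
  have hdTb : ∀ r ∈ I, HasDerivAt Tb (4 * r * b r * T r) r := by
    intro r hr
    have h1 := (((hdT r hr).mul ((hda r hr).sub ((hasDerivAt_pow 2 r).mul
      ((hda r hr).pow 2)))).const_mul 4).sub_const 1
    refine h1.congr_deriv ?_
    have h2 := hode r hr
    rw [uFun] at h2
    have h3 : deriv a r = b r * r * (1 - 2 * r ^ 2 * a r) - 2 * r * a r ^ 2 := by linarith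
    simp only [Pi.mul_apply, Pi.sub_apply, Pi.pow_apply]
    rw [h3]
    push_cast
    ring
  have hYu : ∀ r ∈ I, Y r = √(T r) * uFun a r / r := by
    intro r hr
    have hr0 := (hpos r hr).ne'
    rw [hsq, uFun]
    simp only [hY]
    field_simp
  have hdY : ∀ r ∈ I, HasDerivAt Y (-√(T r) / r ^ 2) r := by
    intro r hr
    have hr0 := (hpos r hr).ne'
    have h1 := ((hK r hr).div_const 2).exp.mul ((hasDerivAt_inv hr0).sub
      (((hasDerivAt_id r).mul (hda r hr)).const_mul 2))
    refine h1.congr_deriv ?_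
    have h2 := hode r hr
    rw [uFun] at h2
    have h3 : deriv a r = b r * r * (1 - 2 * r ^ 2 * a r) - 2 * r * a r ^ 2 := by linarith
    simp only [Pi.mul_apply, Pi.sub_apply, id]
    rw [h3, hsq]
    field_simp
    ring
  have hYanti : StrictAntiOn Y I := by
    refine strictAntiOn_of_deriv_neg hc.convex
      (fun r hr => (hdY r hr).continuousAt.continuousWithinAt) fun r hr => ?_
    rw [hI.interior_eq] at hr
    rw [(hdY r hr).deriv, neg_div, neg_lt_zero, hsq]
    have := hpos r hr
    positivity
  -- The exponent -K - 2 log|u| is forced by T = e^K. The real logarithm ignores the sign of u, so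
  -- both sides of a zero are covered at once.
  refine ⟨T, Tb, Y, ⟨ha.differentiableOn (by simp), ?_, hTs.continuousOn, hTbs.continuousOn,
    fun r _ => Real.exp_pos _, ⟨fun r => -K r - 2 * Real.log (uFun a r), fun r hr hur => ⟨?_, ?_⟩⟩,
    fun r hr hur => (hdTb r hr).congr_deriv ?_⟩, hTs, hTbs, hdT, hdTb, hdY, hYu, ?_⟩
  -- A zero of u is a zero of the injective function Y.
  · rintro r ⟨hr, hr1⟩ t ⟨ht, ht1⟩
    refine hYanti.injOn hr ht ?_
    rw [hYu r hr, hYu t ht, hr1, ht1]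
    simp
  · have h1 := (hK r hr).neg.sub (((hu r hr).log hur).const_mul 2)
    refine h1.congr_deriv ?_
    have h2 := hode r hr
    have e : uFun a r = 1 - 2 * r ^ 2 * a r := rfl
    field_simp
    rw [e] at h2 ⊢
    linear_combination (-4 * r ^ 2) * h2
  · simp only [hT]
    rw [eq_div_iff (pow_ne_zero 2 hur), neg_sub, sub_neg_eq_add, add_comm, Real.exp_add,
      two_mul (Real.log _), Real.exp_add, Real.exp_log_eq_abs hur, ← sq, sq_abs]
  · rw [← hode r hr, mul_div_cancel_right₀ _ hur]
    ring
  · intro r hr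
    have hr0 := (hpos r hr).ne'
    have h1 : T r = Real.exp (K r / 2) ^ 2 := by
      rw [← hsq, Real.sq_sqrt (Real.exp_pos _).le]
    simp only [hTb, hY]
    rw [h1]
    field_simp
    ring

end PairConstruction

/-! ### Construction of η from φ -/

section EtaConstruction

variable {I : Set ℝ} {φ : ℝ → ℝ → ℝ} {a b T Tb Y : ℝ → ℝ} {r s Z σ : ℝ}

/-- The characteristic with parameter `Z` passes over the radius `r`. -/
def CharOver (I : Set ℝ) (Y : ℝ → ℝ) (Z r : ℝ) : Prop := r ∈ I ∧ Z < -1 - Y r ^ 2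

/-- Since Tb - T/r² = -1 - Y², the condition on Z says T/r² < Tb - Z. Hence 0 < w < r², so s is real
and nonzero. -/
theorem SolvedPair.charW_pos_lt (hp : SolvedPair I a b T Tb Y) (hpos : ∀ r ∈ I, 0 < r)
    (h : CharOver I Y Z r) : 0 < charW T Tb Z r ∧ charW T Tb Z r < r ^ 2 := by
  have hr0 := hpos r h.1
  have hT := hp.pair.pos_T r h.1
  have h1 : T r / r ^ 2 < Tb r - Z := by linarith [hp.eq_Tb r h.1, h.2]
  have h2 : 0 < Tb r - Z := lt_trans (by positivity) h1
  refine ⟨div_pos hT h2, ?_⟩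
  rw [charW, div_lt_iff₀ h2]
  rw [div_lt_iff₀ (by positivity)] at h1
  linarith

theorem SolvedPair.sub_ne_zero (hp : SolvedPair I a b T Tb Y) (hpos : ∀ r ∈ I, 0 < r)
    (h : CharOver I Y Z r) : Tb r - Z ≠ 0 := fun h0 => by
  have := (hp.charW_pos_lt hpos h).1
  rw [charW, h0, div_zero] at this
  exact lt_irrefl _ this

theorem SolvedPair.strictAntiOn (hp : SolvedPair I a b T Tb Y) (hI : IsOpen I)
    (hc : I.OrdConnected) (hpos : ∀ r ∈ I, 0 < r) : StrictAntiOn Y I := by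
  refine strictAntiOn_of_deriv_neg hc.convex
    (fun r hr => (hp.deriv_Y r hr).continuousAt.continuousWithinAt) fun r hr => ?_
  rw [hI.interior_eq] at hr
  rw [(hp.deriv_Y r hr).deriv, neg_div, neg_lt_zero]
  have := hpos r hr
  have := hp.pair.pos_T r hr
  positivity

/-- The condition bounds Y² from above, that is, confines the monotone function Y to a symmetric
interval. -/
theorem SolvedPair.ordConnected_charOver (hp : SolvedPair I a b T Tb Y) (hI : IsOpen I)
    (hc : I.OrdConnected) (hpos : ∀ r ∈ I, 0 < r) (Z : ℝ) : {r | CharOver I Y Z r}.OrdConnected := by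
  have hanti := (hp.strictAntiOn hI hc hpos).antitoneOn
  refine ⟨fun p hp' q hq t ht => ?_⟩
  have htI : t ∈ I := hc.out hp'.1 hq.1 ht
  refine ⟨htI, ?_⟩
  have h1 := hanti hp'.1 htI ht.1
  have h2 := hanti htI hq.1 ht.2
  have h3 := hp'.2
  have h4 := hq.2
  rcases le_total 0 (Y t) with h | h <;> nlinarith

theorem SolvedPair.isOpen_charOver (hp : SolvedPair I a b T Tb Y) (hI : IsOpen I) (Z : ℝ) :
    IsOpen {r | CharOver I Y Z r} := by
  rw [isOpen_iff_mem_nhds]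
  intro r hr
  have hcY := (hp.deriv_Y r hr.1).continuousAt
  have h1 : ∀ᶠ t in nhds r, Z < -1 - Y t ^ 2 :=
    (continuousAt_const.sub (hcY.pow 2)).eventually (lt_mem_nhds hr.2)
  filter_upwards [hI.eventually_mem hr.1, h1] with t ht1 ht2 using ⟨ht1, ht2⟩

/-- The value of `√w ψ` over the radius `r` on the characteristic with parameter `Z`. -/
noncomputable def charVal (φ : ℝ → ℝ → ℝ) (T Tb : ℝ → ℝ) (σ r Z : ℝ) : ℝ :=
  √(charW T Tb Z r) * legendre φ r (charS T Tb σ Z r)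

/-- The derivative along the characteristic vanishes because Q = a + b s², and the radii form an
interval. This makes η independent of the radius chosen to evaluate it. -/
theorem SolvedPair.charVal_eq (hp : SolvedPair I a b T Tb Y) (hI : IsOpen I)
    (hc : I.OrdConnected) (hpos : ∀ r ∈ I, 0 < r) (hφ : Smooth2 (polarDomain I) φ)
    (hq : IsQuadratic I (Qfun φ) a b) (hH : ∀ r s, (r, s) ∈ polarDomain I → 0 < radialHess φ r s)
    (hσ : σ ^ 2 = 1) {t : ℝ} (hr : CharOver I Y Z r) (ht : CharOver I Y Z t) :
    charVal φ T Tb σ r Z = charVal φ T Tb σ t Z := by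
  have hd : ∀ r, CharOver I Y Z r → HasDerivAt (fun r => charVal φ T Tb σ r Z) 0 r := by
    intro r hr
    have hw := hp.charW_pos_lt hpos hr
    have hr0 := hpos r hr.1
    have hm := charS_mem (I := I) hσ hr.1 hr0 hw.1 hw.2
    refine (hasDerivAt_along_char hI hφ hr.1 hr0 (hp.deriv_T r hr.1) (hp.deriv_Tb r hr.1)
      (hp.sub_ne_zero hpos hr) hσ hw.1 hw.2).congr_deriv ?_
    have h1 := hq.eq r hr.1 _ hm.2
    rw [SphFinsler.Qfun_eq, div_eq_iff (mul_pos two_pos (hH _ _ hm)).ne'] at h1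
    rw [h1]
    ring
  exact (hp.isOpen_charOver hI Z).is_const_of_deriv_eq_zero
    (hp.ordConnected_charOver hI hc hpos Z).isPreconnected
    (fun r hr => (hd r hr).differentiableAt.differentiableWithinAt)
    (fun r hr => (hd r hr).deriv) hr ht

open Classical in
/-- The function `η` on the component with sign `σ`. -/
noncomputable def etaFun (I : Set ℝ) (φ : ℝ → ℝ → ℝ) (T Tb Y : ℝ → ℝ) (σ v : ℝ) : ℝ :=
  if h : ∃ r, CharOver I Y (1 / v) r then charVal φ T Tb σ h.choose (1 / v) else 0

/-- The hypotheses under which `η` is constructed. -/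
structure EtaSetup (I : Set ℝ) (φ : ℝ → ℝ → ℝ) (a b T Tb Y : ℝ → ℝ) : Prop where
  solved : SolvedPair I a b T Tb Y
  isOpen : IsOpen I
  conn : I.OrdConnected
  pos : ∀ r ∈ I, 0 < r
  smooth : Smooth2 (polarDomain I) φ
  quad : IsQuadratic I (Qfun φ) a b
  hess : ∀ r s, (r, s) ∈ polarDomain I → 0 < radialHess φ r s

theorem EtaSetup.etaFun_eq (hS : EtaSetup I φ a b T Tb Y) (hσ : σ ^ 2 = 1) {v : ℝ}
    (h : CharOver I Y (1 / v) r) : etaFun I φ T Tb Y σ v = charVal φ T Tb σ r (1 / v) := by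
  have h' : ∃ r, CharOver I Y (1 / v) r := ⟨r, h⟩
  rw [etaFun, dif_pos h']
  exact hS.solved.charVal_eq hS.isOpen hS.conn hS.pos hS.smooth hS.quad hS.hess hσ h'.choose_spec h

theorem EtaSetup.den_neg (hS : EtaSetup I φ a b T Tb Y) (hr : r ∈ I) (hs : |s| < r) :
    (r ^ 2 - s ^ 2) * Tb r - T r < 0 := by
  have hw := sq_sub_sq_pos hs
  have hr0 := hS.pos r hr
  have h1 := hS.solved.eq_Tb r hr
  have hT := hS.solved.pair.pos_T r hr
  have h2 : Tb r = T r / r ^ 2 - 1 - Y r ^ 2 := by linarith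
  have h3 : (r ^ 2 - s ^ 2) * (T r / r ^ 2) ≤ T r := by
    rw [mul_div_assoc', div_le_iff₀ (by positivity)]
    nlinarith [sq_nonneg s]
  rw [h2]
  nlinarith [mul_nonneg hw.le (sq_nonneg (Y r))]

theorem EtaSetup.one_div_varphi (hS : EtaSetup I φ a b T Tb Y) (hr : r ∈ I) (hs : |s| < r) :
    1 / varphi T Tb r s = Tb r - T r / (r ^ 2 - s ^ 2) := by
  have hw := (sq_sub_sq_pos hs).ne'
  have hd := (hS.den_neg hr hs).ne
  rw [varphi]
  field_simp

theorem EtaSetup.charOver_varphi (hS : EtaSetup I φ a b T Tb Y) (hr : r ∈ I) (h0 : 0 < |s|)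
    (hs : |s| < r) : CharOver I Y (1 / varphi T Tb r s) r := by
  refine ⟨hr, ?_⟩
  have hw := sq_sub_sq_pos hs
  rw [hS.one_div_varphi hr hs, ← hS.solved.eq_Tb r hr]
  have hT := hS.solved.pair.pos_T r hr
  have hs0 : s ≠ 0 := abs_pos.1 h0
  have : 0 < s ^ 2 := by positivity
  have := div_lt_div_of_pos_left hT hw (by linarith : r ^ 2 - s ^ 2 < r ^ 2)
  linarith

theorem EtaSetup.mem_varphiRange_iff (hS : EtaSetup I φ a b T Tb Y) {v : ℝ} :
    v ∈ varphiRange I T Tb ↔ ∃ r, CharOver I Y (1 / v) r := by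
  constructor
  · rintro ⟨r, hr, s, h0, hs, rfl⟩
    exact ⟨r, hS.charOver_varphi hr h0 hs⟩
  · rintro ⟨r, h⟩
    have hw := hS.solved.charW_pos_lt hS.pos h
    have hr0 := hS.pos r h.1
    have hσ : (1 : ℝ) ^ 2 = 1 := one_pow 2
    refine ⟨r, h.1, charS T Tb 1 (1 / v) r, abs_pos.2 (charS_ne_zero hσ hw.2),
      (charS_mem (I := I) hσ h.1 hr0 hw.1 hw.2).2, ?_⟩
    rw [varphi_charS hσ (hS.solved.pair.pos_T r h.1) hw.1 hw.2, one_div_one_div]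

theorem EtaSetup.charVal_varphi (hS : EtaSetup I φ a b T Tb Y) (hr : r ∈ I)
    (hs : |s| < r) (hσ : σ * |s| = s) :
    charVal φ T Tb σ r (1 / varphi T Tb r s) = √(r ^ 2 - s ^ 2) * legendre φ r s := by
  have hw := (sq_sub_sq_pos hs).ne'
  have hT := (hS.solved.pair.pos_T r hr).ne'
  have h1 : charW T Tb (1 / varphi T Tb r s) r = r ^ 2 - s ^ 2 := by
    rw [charW, hS.one_div_varphi hr hs, sub_sub_cancel]
    field_simp
  rw [charVal, charS, h1, sub_sub_cancel, Real.sqrt_sq_eq_abs, hσ]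

theorem EtaSetup.etaRepresents (hS : EtaSetup I φ a b T Tb Y) : EtaRepresents I φ
    (etaFun I φ T Tb Y 1) (etaFun I φ T Tb Y (-1)) T Tb := by
  intro r hr s h0 hs
  have hov := hS.charOver_varphi hr h0 hs
  rw [etaComp]
  split_ifs with h
  · rw [hS.etaFun_eq (by norm_num) hov, hS.charVal_varphi hr hs (by rw [abs_of_pos h, one_mul])]
  · rw [hS.etaFun_eq (by norm_num) hov, hS.charVal_varphi hr hs (by
      rw [abs_of_nonpos (not_lt.1 h)]; ring)]

theorem EtaSetup.charOver_lt_neg_one (h : CharOver I Y Z r) : Z < -1 := by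
  nlinarith [h.2, sq_nonneg (Y r)]

/-- A radius that serves v serves all nearby values, so locally η is a fixed smooth expression. Here
v ≠ 0, as 1/v < -1. -/
theorem EtaSetup.smooth_etaFun (hS : EtaSetup I φ a b T Tb Y) (hσ : σ ^ 2 = 1) :
    ContDiffOn ℝ ∞ (etaFun I φ T Tb Y σ) (varphiRange I T Tb) := by
  intro v hv
  obtain ⟨r, h⟩ := hS.mem_varphiRange_iff.1 hv
  have hv0 : v ≠ 0 := fun h0 => by
    have := EtaSetup.charOver_lt_neg_one h
    rw [h0, div_zero] at this
    linarith
  have hw := hS.solved.charW_pos_lt hS.pos h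
  have hr0 := hS.pos r h.1
  have hm := charS_mem (I := I) hσ h.1 hr0 hw.1 hw.2
  have hD := isOpen_polarDomain hS.isOpen
  have h1 : ContDiffAt ℝ ∞ (fun v : ℝ => 1 / v) v := contDiffAt_const.div contDiffAt_id hv0
  have h2 : ContDiffAt ℝ ∞ (fun v : ℝ => charW T Tb (1 / v) r) v :=
    contDiffAt_const.div (contDiffAt_const.sub h1) (hS.solved.sub_ne_zero hS.pos h)
  have h3 : ContDiffAt ℝ ∞ (fun v : ℝ => charS T Tb σ (1 / v) r) v :=
    contDiffAt_const.mul ((contDiffAt_const.sub h2).sqrt (by linarith))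
  have h3' : ContDiffAt ℝ ∞ (fun v : ℝ => legendre φ r (charS T Tb σ (1 / v) r)) v :=
    ContDiffAt.comp (g := fun q : ℝ × ℝ => legendre φ q.1 q.2)
      (f := fun v => (r, charS T Tb σ (1 / v) r)) v ((hS.smooth.legendre hD).contDiffAt hD hm)
      (contDiffAt_const.prodMk h3)
  have h4 : ContDiffAt ℝ ∞ (fun v : ℝ => charVal φ T Tb σ r (1 / v)) v :=
    (h2.sqrt hw.1.ne').mul h3'
  refine (h4.congr_of_eventuallyEq ?_).contDiffWithinAt
  have h5 : ∀ᶠ v' in nhds v, 1 / v' < -1 - Y r ^ 2 :=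
    h1.continuousAt.eventually (gt_mem_nhds h.2)
  filter_upwards [h5] with v' hv'
  exact hS.etaFun_eq hσ ⟨h.1, hv'⟩

/-- At s = 0 the parameter Z₀ is -1 - Y(r)², just outside the characteristics over r. If some
characteristic with parameter Z₀ passes over another radius t, the values over t and over r agree
for Z < Z₀ and hence in the limit; over r the limit has s = 0, where the sign σ plays no role. -/
theorem EtaSetup.etaFun_agree (hS : EtaSetup I φ a b T Tb Y) (hr : r ∈ I) :
    etaFun I φ T Tb Y 1 (varphi T Tb r 0) = etaFun I φ T Tb Y (-1) (varphi T Tb r 0) := by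
  have hr0 := hS.pos r hr
  have hrr : |(0 : ℝ)| < r := by simpa using hr0
  by_cases hex : ∃ t, CharOver I Y (1 / varphi T Tb r 0) t
  swap
  -- Outside the range of varphi both branches take the default value 0.
  · rw [etaFun, etaFun, dif_neg hex, dif_neg hex]
  obtain ⟨t, ht⟩ := hex
  rw [hS.etaFun_eq (by norm_num) ht, hS.etaFun_eq (by norm_num) ht]
  set Z₀ := 1 / varphi T Tb r 0 with hZ₀
  have hZ : Z₀ = -1 - Y r ^ 2 := by
    rw [hZ₀, hS.one_div_varphi hr hrr, ← hS.solved.eq_Tb r hr]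
    simp
  have hD := isOpen_polarDomain hS.isOpen
  have hcont : ∀ {σ p : ℝ}, p ∈ I → Tb p - Z₀ ≠ 0 → |charS T Tb σ Z₀ p| < p →
      ContinuousAt (fun Z => charVal φ T Tb σ p Z) Z₀ := by
    intro σ p hp h1 h2
    have hcw : ContinuousAt (fun Z => charW T Tb Z p) Z₀ := by
      unfold charW
      exact continuousAt_const.div (by fun_prop) h1
    have hcs : ContinuousAt (fun Z => charS T Tb σ Z p) Z₀ :=
      continuousAt_const.mul (continuousAt_const.sub hcw).sqrt
    exact hcw.sqrt.mul (ContinuousAt.comp (g := fun q : ℝ × ℝ => legendre φ q.1 q.2)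
      (f := fun Z => (p, charS T Tb σ Z p))
      ((hS.smooth.legendre hD).continuousAt hD ⟨hp, h2⟩) (continuousAt_const.prodMk hcs))
  have hW : charW T Tb Z₀ r = r ^ 2 := by
    have hT := (hS.solved.pair.pos_T r hr).ne'
    rw [charW, hZ₀, hS.one_div_varphi hr hrr, sub_sub_cancel]
    field_simp
    ring
  have hS0 : ∀ σ, charS T Tb σ Z₀ r = 0 := fun σ => by rw [charS, hW]; simp
  have hTbr : Tb r - Z₀ ≠ 0 := fun h0 => by
    rw [charW, h0, div_zero] at hW
    exact (pow_ne_zero 2 hr0.ne') hW.symm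
  have key : ∀ σ : ℝ, σ ^ 2 = 1 → charVal φ T Tb σ t Z₀ = charVal φ T Tb σ r Z₀ := by
    intro σ hσ
    have hw := hS.solved.charW_pos_lt hS.pos ht
    have hc1 := hcont (σ := σ) ht.1 (hS.solved.sub_ne_zero hS.pos ht)
      (charS_mem (I := I) hσ ht.1 (hS.pos t ht.1) hw.1 hw.2).2
    have hc2 := hcont (σ := σ) hr hTbr (by rw [hS0]; exact hrr)
    refine tendsto_nhds_unique_of_eventuallyEq (l := nhdsWithin Z₀ (Set.Iio Z₀))
      (hc1.mono_left nhdsWithin_le_nhds) (hc2.mono_left nhdsWithin_le_nhds) ?_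
    filter_upwards [self_mem_nhdsWithin] with Z hZlt
    have hZlt' : Z < Z₀ := hZlt
    exact hS.solved.charVal_eq hS.isOpen hS.conn hS.pos hS.smooth hS.quad hS.hess hσ
      ⟨ht.1, hZlt'.trans ht.2⟩ ⟨hr, hZ ▸ hZlt'⟩
  rw [key 1 (by norm_num), key (-1) (by norm_num), charVal, charVal, hS0, hS0]

/-- The derivative of r Y² is -(T/r²) u (2 - u). Hence Y² grows at least like a constant over r at
the origin. -/
theorem EtaSetup.mul_sq_antitoneOn (hS : EtaSetup I φ a b T Tb Y) {δ : ℝ}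
    (hδ : ∀ r, 0 < r → r < δ → r ∈ I ∧ 0 < uFun a r ∧ uFun a r < 2) :
    AntitoneOn (fun r => r * Y r ^ 2) (Set.Ioo 0 δ) := by
  have hd : ∀ r ∈ Set.Ioo 0 δ, HasDerivAt (fun r => r * Y r ^ 2)
      (1 * Y r ^ 2 + r * (2 * Y r * (-√(T r) / r ^ 2))) r := by
    intro r hr
    have h1 := (hasDerivAt_id r).mul ((hS.solved.deriv_Y r (hδ r hr.1 hr.2).1).pow 2)
    refine h1.congr_deriv ?_
    simp
  refine antitoneOn_of_deriv_nonpos (convex_Ioo 0 δ)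
    (fun r hr => (hd r hr).continuousAt.continuousWithinAt)
    (fun r hr => (hd r (interior_subset hr)).differentiableAt.differentiableWithinAt)
    fun r hr => ?_
  have hr' := interior_subset hr
  obtain ⟨hrI, hu0, hu2⟩ := hδ r hr'.1 hr'.2
  have hr0 := hr'.1
  rw [(hd r hr').deriv, hS.solved.eq_Y r hrI]
  have hT := hS.solved.pair.pos_T r hrI
  have hq : 0 < √(T r) := Real.sqrt_pos.2 hT
  generalize √(T r) = q at *
  generalize uFun a r = u at *
  have e : 1 * (q * u / r) ^ 2 + r * (2 * (q * u / r) * (-q / r ^ 2)) =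
      -(q ^ 2 / r ^ 2 * (u * (2 - u))) := by
    field_simp
    ring
  rw [e, neg_nonpos]
  have := mul_pos hu0 (sub_pos.2 hu2)
  positivity

/-- Y² is arbitrarily large near the origin, so by the intermediate value theorem every parameter
1/v in use equals -1 - Y(r)² for some r. Then v is a value of varphi at s = 0, where the branches
agree. -/
theorem EtaSetup.etaFun_eq_of_origin (hS : EtaSetup I φ a b T Tb Y) {δ : ℝ} (hδ0 : 0 < δ)
    (hδ : ∀ r, 0 < r → r < δ → r ∈ I ∧ 0 < uFun a r ∧ uFun a r < 2) :
    etaFun I φ T Tb Y 1 = etaFun I φ T Tb Y (-1) := by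
  funext v
  by_cases hex : ∃ t, CharOver I Y (1 / v) t
  swap
  · rw [etaFun, etaFun, dif_neg hex, dif_neg hex]
  obtain ⟨r₁, h₁⟩ := hex
  have hanti := hS.mul_sq_antitoneOn hδ
  set k := -1 - 1 / v with hk
  have hk1 : Y r₁ ^ 2 < k := by linarith [h₁.2]
  have hr₁ := hS.pos r₁ h₁.1
  set m := δ / 2 with hm
  have hmI := hδ m (by linarith) (by linarith)
  have hm0 : 0 < m := by linarith
  have hYm : 0 < m * Y m ^ 2 := by
    have hq : 0 < √(T m) := Real.sqrt_pos.2 (hS.solved.pair.pos_T m hmI.1)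
    have : 0 < Y m := by
      rw [hS.solved.eq_Y m hmI.1]
      have := hmI.2.1
      positivity
    positivity
  have hk0 : 0 < k := lt_of_le_of_lt (sq_nonneg _) hk1
  -- The last entry gives t k ≤ m Y(m)² ≤ t Y(t)², so Y(t)² ≥ k; the others keep t near the origin
  -- and to the left of r₁.
  set t := min (min m r₁) (m * Y m ^ 2 / k) with ht
  have ht0 : 0 < t := lt_min (lt_min hm0 hr₁) (by positivity)
  have htm : t ≤ m := (min_le_left _ _).trans (min_le_left _ _)
  have htr : t ≤ r₁ := (min_le_left _ _).trans (min_le_right _ _)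
  have htI := (hδ t ht0 (by linarith)).1
  have hYt : k ≤ Y t ^ 2 := by
    have h1 := hanti ⟨ht0, by linarith⟩ ⟨hm0, by linarith⟩ htm
    simp only at h1
    have h2 : t * k ≤ m * Y m ^ 2 := by
      rw [← le_div_iff₀ hk0]; exact min_le_right _ _
    exact le_of_mul_le_mul_left (h2.trans h1) ht0
  have hcont : ContinuousOn (fun r => Y r ^ 2) (Set.Icc t r₁) := fun r hr =>
    ((hS.solved.deriv_Y r (hS.conn.out htI h₁.1 hr)).continuousAt.pow 2).continuousWithinAt
  obtain ⟨r, hr, hrk⟩ := intermediate_value_Icc' htr hcont ⟨hk1.le, hYt⟩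
  have hrI := hS.conn.out htI h₁.1 hr
  have hrr : |(0 : ℝ)| < r := by simpa using hS.pos r hrI
  have hv : v = varphi T Tb r 0 := by
    have h1 : 1 / varphi T Tb r 0 = 1 / v := by
      rw [hS.one_div_varphi hrI hrr]
      have h2 := hS.solved.eq_Tb r hrI
      simp only at hrk
      rw [hrk] at h2
      simp only [ne_eq, OfNat.ofNat_ne_zero, not_false_eq_true, zero_pow, sub_zero]
      linarith
    rw [one_div, one_div] at h1
    exact (inv_injective h1).symm
  rw [hv]
  exact hS.etaFun_agree hrI

/-- `φ` has the stated form with `h = 0` and `J = -φ / s`. -/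
theorem EtaSetup.hasForm (hS : EtaSetup I φ a b T Tb Y) :
    HasForm I φ a T Tb (fun _ => 0) (etaFun I φ T Tb Y 1) (etaFun I φ T Tb Y (-1))
      fun r s => -(φ r s / s) where
  pair := hS.solved.pair
  den _ hr _ hs := (hS.den_neg hr hs).ne
  diff_h := differentiableOn_const _
  diff_ηp := (hS.smooth_etaFun (by norm_num)).differentiableOn (by simp)
  diff_ηm := (hS.smooth_etaFun (by norm_num)).differentiableOn (by simp)
  primitive r hr s h0 hs := by
    have hs0 : s ≠ 0 := abs_pos.1 h0
    have hD := isOpen_polarDomain hS.isOpen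
    have h1 := (((hS.smooth.hasDerivAt_ds hD ⟨hr, hs⟩).div (hasDerivAt_id s) hs0)).neg
    refine h1.congr_deriv ?_
    have hq : √(r ^ 2 - s ^ 2) ≠ 0 := (Real.sqrt_pos.2 (sq_sub_sq_pos hs)).ne'
    rw [hS.etaRepresents r hr s h0 hs, legendre]
    simp only [id]
    field_simp
    ring
  formula r hr s h0 hs := by
    have hs0 : s ≠ 0 := abs_pos.1 h0
    field_simp
    ring

end EtaConstruction

/-! ### The expression R₂ for quadratic Q -/

section CurvatureExpression

variable {I : Set ℝ} {Q : ℝ → ℝ → ℝ} {a b : ℝ → ℝ} {r s : ℝ}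

/-- All terms containing s cancel, leaving the function of r that obstructs scalar flag curvature.
-/
theorem IsQuadratic.R2_eq (hq : IsQuadratic I Q a b) (hI : IsOpen I) (hpos : ∀ r ∈ I, 0 < r)
    (hr : r ∈ I) (hs : |s| < r) : R2 Q r s = flagDefect a b r := by
  have hda : HasDerivAt a (deriv a r) r :=
    ((hq.smooth_left.contDiffAt (hI.mem_nhds hr)).differentiableAt (by simp)).hasDerivAt
  have hdb : HasDerivAt b (deriv b r) r :=
    ((hq.smooth_right.contDiffAt (hI.mem_nhds hr)).differentiableAt (by simp)).hasDerivAt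
  have h1 : ∀ r ∈ I, ∀ s, |s| < r → ds Q r s = 2 * b r * s := by
    intro r hr s hs
    have e : (fun t => Q r t) =ᶠ[nhds s] fun t => a r + b r * t ^ 2 := by
      filter_upwards [continuous_abs.continuousAt.eventually (gt_mem_nhds hs)] with t ht
      exact hq.eq r hr t ht
    have := ((hasDerivAt_pow 2 s).const_mul (b r)).const_add (a r)
    rw [ds, e.deriv_eq, this.deriv]
    push_cast
    ring
  have h2 : ds (ds Q) r s = 2 * b r := by
    have e : (fun t => ds Q r t) =ᶠ[nhds s] fun t => 2 * b r * t := by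
      filter_upwards [continuous_abs.continuousAt.eventually (gt_mem_nhds hs)] with t ht
      exact h1 r hr t ht
    rw [ds, e.deriv_eq]
    simp
  have h3 : dr Q r s = deriv a r + deriv b r * s ^ 2 := by
    have e : (fun t => Q t s) =ᶠ[nhds r] fun t => a t + b t * s ^ 2 := by
      filter_upwards [hI.mem_nhds hr, lt_mem_nhds hs] with t ht hst
      exact hq.eq t ht s hst
    rw [dr, e.deriv_eq]
    exact (hda.add (hdb.mul_const _)).deriv
  have h4 : dr (ds Q) r s = 2 * deriv b r * s := by
    have e : (fun t => ds Q t s) =ᶠ[nhds r] fun t => 2 * b t * s := by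
      filter_upwards [hI.mem_nhds hr, lt_mem_nhds hs] with t ht hst
      exact h1 t ht s hst
    rw [dr, e.deriv_eq]
    exact ((hdb.const_mul 2).mul_const s).deriv
  have hr0 := (hpos r hr).ne'
  rw [R2, h1 r hr s hs, h2, h3, h4, hq.eq r hr s hs, flagDefect]
  field_simp
  ring

end CurvatureExpression

/-! ### Behaviour of u near the origin -/

section Origin

variable {n : ℕ} {M : Set (E n)} {F : E n → E n → ℝ} {φ : ℝ → ℝ → ℝ} {a b : ℝ → ℝ}

/-- The geodesic coefficients are smooth at the origin, so `r² a(r)` tends to `0` there. -/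
theorem IsQuadratic.exists_uFun_near_one (hq : IsQuadratic (radii M) (Qfun φ) a b)
    (hF : IsFinsler M F) (hM : IsSymmDomain M) (hn : 3 ≤ n) (hφ : IsGivenBy M F φ)
    (h0 : (0 : E n) ∈ M) :
    ∃ δ : ℝ, 0 < δ ∧ ∀ r, 0 < r → r < δ → r ∈ radii M ∧ 0 < uFun a r ∧ uFun a r < 2 := by
  set i₀ : Fin n := Fin.castLE hn 0
  set i₁ : Fin n := Fin.castLE hn 1
  have hi : i₀ ≠ i₁ := by simp [i₀, i₁, Fin.ext_iff]
  have harc : arcVec hn 0 = stdVec hn 1 := by simp [arcVec]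
  -- For y = e₁ orthogonal to x = r e₀ the component along x of the geodesic vector is r Q(r, 0), so
  -- u is expressed through a quantity continuous at the origin.
  have hG : ∀ r ∈ radii M,
      geodCoeff F i₀ (r • stdVec hn 0) (stdVec hn 1) = r * a r := by
    intro r hr
    have hr0 : 0 < r := hr.1
    have hs : |(0 : ℝ)| < r := by simpa using hr0
    have hg := smul_stdVec_arcVec_mem_generic hM hn hr hs
    have hp := polar_arcVec hn (Qfun φ) hr0 hs.le
    rw [zero_div, harc] at hg hp
    rw [hF.geodCoeff_eq hM hn hφ hg, sprayCoeff, hp, norm_stdVec, hq.eq r hr 0 hs]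
    simp [stdVec, i₀, i₁, hi]
    ring
  have hc : ContinuousAt (fun r : ℝ => geodCoeff F i₀ (r • stdVec hn 0) (stdVec hn 1)) 0 := by
    have hmem : ((0 : ℝ) • stdVec hn 0, stdVec hn 1) ∈ slit M := by
      rw [zero_smul]
      exact mem_slit.2 ⟨h0, by rw [← norm_ne_zero_iff, norm_stdVec]; simp⟩
    exact ContinuousAt.comp (g := fun p : E n × E n => geodCoeff F i₀ p.1 p.2)
      (f := fun r : ℝ => (r • stdVec hn 0, stdVec hn 1))
      ((hF.smooth_geodCoeff hM.isOpen i₀).continuousOn.continuousAt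
        ((isOpen_slit hM.isOpen).mem_nhds hmem)) (by fun_prop)
  have ht : Filter.Tendsto
      (fun r : ℝ => 1 - 2 * (r * geodCoeff F i₀ (r • stdVec hn 0) (stdVec hn 1)))
      (nhds 0) (nhds 1) := by
    have : ContinuousAt
        (fun r : ℝ => 1 - 2 * (r * geodCoeff F i₀ (r • stdVec hn 0) (stdVec hn 1))) 0 :=
      continuousAt_const.sub (continuousAt_const.mul (continuousAt_id.mul hc))
    simpa [ContinuousAt] using this
  have hev : ∀ᶠ r in nhdsWithin (0 : ℝ) (Set.Ioi 0),
      r ∈ radii M ∧ 0 < uFun a r ∧ uFun a r < 2 := by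
    filter_upwards [hM.eventually_mem_radii hn h0,
      nhdsWithin_le_nhds (ht.eventually (Ioo_mem_nhds one_pos one_lt_two))] with r hr h1
    have e : uFun a r = 1 - 2 * (r * geodCoeff F i₀ (r • stdVec hn 0) (stdVec hn 1)) := by
      rw [hG r hr, uFun]; ring
    exact ⟨hr, by rw [e]; exact h1.1, by rw [e]; exact h1.2⟩
  obtain ⟨δ, hδ, h⟩ := mem_nhdsGT_iff_exists_Ioo_subset.1 hev
  exact ⟨δ, hδ, fun r hr0 hr => h ⟨hr0, hr⟩⟩

end Origin

end SphFinsler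

/-! ### The classification theorem -/

theorem theorem2 (n : ℕ) (hn : 3 ≤ n) (M : Set (E n)) (hM : IsSymmDomain M) :
    -- every such metric has the stated form, with the positivity conditions
    (∀ F : E n → E n → ℝ, IsFinsler M F → IsSphericallySymmetric M F → IsDouglas M F →
      HasScalarFlagCurv M F →
      ∃ (φ : ℝ → ℝ → ℝ) (g T Tb h ηp ηm : ℝ → ℝ) (J : ℝ → ℝ → ℝ),
        (∀ x ∈ M, ∀ y, y ≠ 0 → F x y = sphericalF φ x y) ∧
        (∀ x ∈ M, ∀ s, |s| ≤ ‖x‖ → 0 < φ ‖x‖ s) ∧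
        ContDiffOn ℝ ∞ (fun p : ℝ × ℝ => φ p.1 p.2) {p | p.1 ∈ radii M ∧ |p.2| < p.1} ∧
        HasForm (radii M) φ g T Tb h ηp ηm J ∧
        ContDiffOn ℝ ∞ g (radii M) ∧ ContDiffOn ℝ ∞ T (radii M) ∧
        ContDiffOn ℝ ∞ Tb (radii M) ∧ ContDiffOn ℝ ∞ h (radii M) ∧
        ContDiffOn ℝ ∞ (fun p : ℝ × ℝ => J p.1 p.2)
          {p | p.1 ∈ radii M ∧ 0 < |p.2| ∧ |p.2| < p.1} ∧
        ContDiffOn ℝ ∞ ηp (varphiRange (radii M) T Tb) ∧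
        ContDiffOn ℝ ∞ ηm (varphiRange (radii M) T Tb) ∧
        -- one function `η` if `M` contains the origin; in general `ηp` and `ηm` agree on all
        -- values that `varphi` takes at `s = 0`
        ((0 : E n) ∈ M → ηp = ηm) ∧
        (∀ r ∈ radii M, ηp (varphi T Tb r 0) = ηm (varphi T Tb r 0)) ∧
        (∀ r ∈ radii M, ∀ s, |s| < r → R2 (Qfun φ) r s = 0) ∧
        EtaPositive (radii M) ηp ηm T Tb) ∧
    -- a positive smooth function of this form is a Finsler metric exactly under the positivity
    -- conditions, and is then a Douglas metric of scalar flag curvature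
    (∀ (φ : ℝ → ℝ → ℝ) (g T Tb h ηp ηm : ℝ → ℝ) (J : ℝ → ℝ → ℝ),
      HasForm (radii M) φ g T Tb h ηp ηm J →
      (∀ x ∈ M, ∀ s, |s| ≤ ‖x‖ → 0 < φ ‖x‖ s) →
      ContDiffOn ℝ ∞ (fun p : E n × E n => sphericalF φ p.1 p.2) (M ×ˢ {0}ᶜ) →
      (IsFinsler M (sphericalF φ) ↔ EtaPositive (radii M) ηp ηm T Tb) ∧
      (EtaPositive (radii M) ηp ηm T Tb →
        IsSphericallySymmetric M (sphericalF (n := n) φ) ∧ IsDouglas M (sphericalF (n := n) φ) ∧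
        HasScalarFlagCurv M (sphericalF (n := n) φ))) := by
  have hI := hM.isOpen_radii hn
  have hpos : ∀ r ∈ radii M, 0 < r := fun r hr => hr.1
  refine ⟨fun F hF hS hD hK => ?_, fun φ g T Tb h ηp ηm J hf hφpos hsm => ?_⟩
  · have hg := hS.exists_isGivenBy hM hn hF
    set φ : ℝ → ℝ → ℝ := fun r s => F (r • stdVec hn 0) (arcVec hn (s / r))
    have hφ := hg.smooth_phi hM hn hF.smooth2
    have hq := isQuadratic_of_exists hpos (hF.smooth_Qfun hM hn hg) fun r hr =>
      hD.exists_Qfun_eq hF hM hn hg hr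
    have hfd := fun r hr => hq.flagDefect_eq_zero hF hM hn hg hK (r := r) hr
    obtain ⟨T, Tb, Y, hT⟩ := exists_solvedPair hI (hM.ordConnected_radii hn) hpos hq.smooth_left
      hq.smooth_right hfd
    have hE : EtaSetup (radii M) φ _ _ T Tb Y :=
      ⟨hT, hI, hM.ordConnected_radii hn, hpos, hφ, hq, fun r s => hF.radialHess_pos hM hn hg⟩
    -- The integration constant is absorbed in J = -φ/s, which allows h = 0. This J is smooth
    -- because s = 0 is excluded.
    refine ⟨φ, _, T, Tb, _, _, _, _, hg, fun x hx s hs => ?_, hφ, hE.hasForm, hq.smooth_left,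
      hT.smooth_T, hT.smooth_Tb, contDiffOn_const, ?_, hE.smooth_etaFun (by norm_num),
      hE.smooth_etaFun (by norm_num), fun h0 => ?_, fun r => hE.etaFun_agree,
      fun r hr s hs => (hq.R2_eq hI hpos hr hs).trans (hfd r hr), ?_⟩
    · exact hF.pos hM.isOpen (mem_slit.2
        ⟨hM.mem_of_norm_eq (norm_smul_stdVec hn 0 (norm_nonneg x)) hx,
          arcVec_ne_zero hn (abs_div_le_one hs)⟩)
    · exact ((ContDiffOn.mono hφ fun p hp => ⟨hp.1, hp.2.2⟩).div contDiffOn_snd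
        fun p hp => abs_pos.1 hp.2.1).neg
    · obtain ⟨δ, hδ0, hδ⟩ := hq.exists_uFun_near_one hF hM hn hg h0
      exact hE.etaFun_eq_of_origin hδ0 hδ
    · refine (hE.etaRepresents.etaPositive_iff hI hφ).2 fun r hr => ?_
      obtain ⟨c, hc, h⟩ := hF.exists_lower_bound hM hn hg hr
      exact ⟨c, hc, fun s _ => h s⟩
  · have hg : IsGivenBy M (sphericalF φ) φ := fun _ _ _ _ => rfl
    have hφ := hg.smooth_phi hM hn hsm
    have he := (hf.etaRepresents hI hφ).etaPositive_iff hI hφ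
    have hfin : EtaPositive (radii M) ηp ηm T Tb → IsFinsler M (sphericalF φ) := fun h =>
      sphericalF_isFinsler hn hM hφpos hsm (he.1 h)
    refine ⟨⟨fun hF => he.2 fun r hr => ?_, hfin⟩, fun hη => ?_⟩
    · obtain ⟨c, hc, h⟩ := hF.exists_lower_bound hM hn hg hr
      exact ⟨c, hc, fun s _ => h s⟩
    · have hF := hfin hη
      obtain ⟨a, b, hq, h0⟩ := hf.exists_isQuadratic hI hpos hφ (hF.smooth_Qfun hM hn hg)
        fun r s => hF.radialHess_pos hM hn hg
      exact ⟨sphericalF_isSphericallySymmetric M φ, hq.isDouglas hF hM hn hg,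
        hq.hasScalarFlagCurv hF hM hn hg h0⟩
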